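/- Let $\mathcal P = P(\partial_z) + z^{-1} Q(\partial_z) + z^{-2} R(z^{-1})$, where $P$ is a monic complex polynomial of degree $d$ with only simple roots, $Q$ is a complex polynomial of degree $d-1$ that is non-zero at every root of $P$, and $w \mapsto R(w)$ is holomorphic on the disk $|w| < 1/A$ for some $A > 0$. Let $-\alpha$ be a root of $P$, put $\tau = \tau_\alpha = Q(-\alpha)/P'(-\alpha)$, and assume $\operatorname{Re}\tau > 0$. Let $\theta_1 < \theta_2 \le \theta_1 + \pi$, and let $\Omega_\alpha = \{\alpha + re^{i\theta} : r > 0,\ \theta_1 < \theta < \theta_2\}$ be an open sector whose closure contains no root of $P(-\zeta)$ other than $\alpha$. For $\Lambda \ge A$ let $\widehat\Omega^\Lambda$ be the union of the half-planes $\operatorname{Re}(e^{i\theta} z) > \Lambda$, $\theta_1 < \theta < \theta_2$, and let $\Delta$ be the distance to its boundary. On $\widehat\Omega^\Lambda$ the branch of $z^{-\tau}$ is the one with $\arg z$ within $\pi$ of $-(\theta_1+\theta_2)/2$. (a) For some $\Lambda \ge A$ the equation $\mathcal P\Psi = 0$ has a solution on $\widehat\Omega^\Lambda$ of the form $\Psi_\alpha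 = e^{-\alpha z}\left(z^{-\tau} + E\right)$ with $E$ holomorphic on $\widehat\Omega^\Lambda$ and $|E| \le C \Delta^{-\operatorname{Re}\tau - 1}$ for some constant $C$. Any two such solutions, on $\widehat\Omega^{\Lambda}$ and $\widehat\Omega^{\Lambda'}$ with $\Lambda,\Lambda'\ge A$, agree on $\widehat\Omega^{\max(\Lambda, \Lambda')}$. (b) Let $\tilde\Psi = e^{-\alpha z} z^{-\tau} \sum_{n \ge 0} a_n z^{-n}$ be a formal solution of $\mathcal P \tilde\Psi = 0$ that is $1$-Gevrey, i.e. $|a_{n+1}| \le C B^n n!$ for all $n \ge 0$ and some constants $B, C > 0$. Then $\tilde\Psi$ is Borel summable at $\alpha$ along every ray in $\Omega_\alpha$ with tip $\alpha$, and its Borel sums are one scalar multiple of $\Psi_\alpha$. Explicitly, let $\Psi_\alpha$ be given on $\widehat\Omega^\Lambda$ as in (a). Then the Borel transform $(\zeta-\alpha)^{\tau-1} \sum_{n \ge 0} \frac{a_n}{\Gamma(\tau+n)} (\zeta-\alpha)^n$ converges near $\zeta = \alpha$, and there are $c \in \mathbb C$ and $\Lambda' \ge \Lambda$ such that for every $\theta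 \in (\theta_1, \theta_2)$ its sum, with $\arg(\zeta - \alpha) = \theta$ on the ray, continues analytically along $\alpha + e^{i\theta}(0,\infty)$ to a function $\varphi$ that is locally integrable on the closed ray, is bounded by a constant multiple of $e^{\Lambda'|\zeta-\alpha|}$ for $|\zeta - \alpha| \ge 1$ on the ray, and satisfies $$\int_{\alpha + e^{i\theta}[0,\infty)} e^{-z\zeta} \varphi(\zeta)\, d\zeta = c\, \Psi_\alpha(z) \qquad \text{whenever } \operatorname{Re}(e^{i\theta} z) > \Lambda'.$$ -/

import Mathlib

open Set Filter Topology MeasureTheory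
open scoped PowerSeries

noncomputable section

/-! ### Sectors, half-planes and branches of powers -/

/-- The open sector with tip `α`, consisting of the open rays `α + e^{iθ}(0,∞)`
with `θ₁ < θ < θ₂`. -/
def openSector (α : ℂ) (θ₁ θ₂ : ℝ) : Set ℂ :=
  {ζ | ∃ r : ℝ, 0 < r ∧ ∃ θ ∈ Ioo θ₁ θ₂, ζ = α + r * Complex.exp (θ * Complex.I)}

/-- The half-plane `Re (e^{iθ} z) > Λ`. -/
def freqHalfPlane (θ Λ : ℝ) : Set ℂ :=
  {z | Λ < (Complex.exp (θ * Complex.I) * z).re}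

/-- The union of the half-planes `Re (e^{iθ} z) > Λ` over all angles `θ₁ < θ < θ₂`. -/
def dualSector (θ₁ θ₂ Λ : ℝ) : Set ℂ :=
  {z | ∃ θ ∈ Ioo θ₁ θ₂, z ∈ freqHalfPlane θ Λ}

/-- The power `w ^ s`, for the branch of `arg w` with values in `(θ - π, θ + π]`. -/
def branchPow (θ : ℝ) (s w : ℂ) : ℂ :=
  Complex.exp (s * (Complex.log (w * Complex.exp (-(θ * Complex.I))) + θ * Complex.I))

/-- The point at distance `t` from `α` on the ray that leaves `α` at angle `θ`. -/
def rayPoint (α : ℂ) (θ t : ℝ) : ℂ := α + t * Complex.exp (θ * Complex.I)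

/-! ### The differential operator -/

/-- The action of `P(∂/∂z) + z⁻¹ Q(∂/∂z) + z⁻² R(z⁻¹)` on a function `Ψ` of `z`. -/
def levelOneOp (P Q : Polynomial ℂ) (R : ℂ → ℂ) (Ψ : ℂ → ℂ) (z : ℂ) : ℂ :=
  (P.sum fun k a => a * iteratedDeriv k Ψ z)
    + z⁻¹ * (Q.sum fun k a => a * iteratedDeriv k Ψ z)
    + (z ^ 2)⁻¹ * R z⁻¹ * Ψ z

/-- The exponent `τ_α = Q(-α) / P'(-α)`. -/
def tauExp (P Q : Polynomial ℂ) (α : ℂ) : ℂ :=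
  Q.eval (-α) / P.derivative.eval (-α)

/-- The formal derivative `∂/∂z` on the space `e^{-αz} z^{-τ} ℂ⟦z⁻¹⟧`. The trans-monomial
`e^{-αz} z^{-τ} ∑ aₙ z^{-n}` is represented by the power series `∑ aₙ Xⁿ`, so `X` stands for
`z⁻¹`, and `∂/∂z (e^{-αz} z^{-τ-n}) = e^{-αz} z^{-τ} (-α z^{-n} - (τ + n) z^{-n-1})`. -/
def transDeriv (α τ : ℂ) : Module.End ℂ ℂ⟦X⟧ where
  toFun F := -(α • F) - τ • (PowerSeries.X * F) - PowerSeries.X ^ 2 * PowerSeries.derivative ℂ F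
  map_add' F G := by
    simp only [smul_add, mul_add, map_add]
    ring
  map_smul' c F := by
    simp only [Derivation.map_smul, mul_smul_comm, RingHom.id_apply, smul_sub, smul_neg,
      smul_comm c]

/-- The Taylor series `∑ R_j X^j` of `R` at `0`. -/
def taylorPS (R : ℂ → ℂ) : ℂ⟦X⟧ :=
  PowerSeries.mk fun j => iteratedDeriv j R 0 / (j.factorial : ℂ)

/-- The action of `P(∂/∂z) + z⁻¹ Q(∂/∂z) + z⁻² R(z⁻¹)` on the trans-monomial
`e^{-αz} z^{-τ} F(z⁻¹)`, with `e^{-αz} z^{-τ}` factored out. -/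
def formalLevelOneOp (P Q : Polynomial ℂ) (R : ℂ → ℂ) (α τ : ℂ) (F : ℂ⟦X⟧) : ℂ⟦X⟧ :=
  Polynomial.aeval (transDeriv α τ) P F
    + PowerSeries.X * Polynomial.aeval (transDeriv α τ) Q F
    + PowerSeries.X ^ 2 * taylorPS R * F

/-- `∑ cₙ z^{-n}` is `1`-Gevrey: the coefficient of `z^{-n-1}` is bounded by a constant multiple
of `Aⁿ n!`. -/
def IsOneGevrey (F : ℂ⟦X⟧) : Prop :=
  ∃ A : ℝ, 0 < A ∧ ∃ C : ℝ, ∀ n : ℕ,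
    ‖PowerSeries.coeff (n + 1) F‖ ≤ C * (A ^ n * (n.factorial : ℝ))

/-! ### The distinguished analytic solution -/

/-- The space of holomorphic functions `Φ` on `S` with `|Φ| ≲ Δ^σ`, where `Δ` is the distance to
the boundary of `S`. -/
def MemDecaySpace (σ : ℝ) (S : Set ℂ) (Φ : ℂ → ℂ) : Prop :=
  DifferentiableOn ℂ Φ S ∧
    ∃ C : ℝ, ∀ z ∈ S, ‖Φ z‖ ≤ C * Metric.infDist z (frontier S) ^ σ

/-- On the union `S` of the half-planes `Re (e^{iθ} z) > Λ`, `θ₁ < θ < θ₂`, the function `Ψ`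
solves the equation and lies in the affine space `e^{-αz} [z^{-τ} + {E | |E| ≲ Δ^{-Re τ - 1}}]`.
Here `z^{-τ}` is taken with `arg z` near `-(θ₁ + θ₂)/2`. Only levels `Λ ≥ A > 0` are used, so
that the coefficients of the equation are holomorphic on `S`; only large `Λ` matter. -/
def IsDistinguishedSolution (P Q : Polynomial ℂ) (R : ℂ → ℂ) (A : ℝ) (α : ℂ) (θ₁ θ₂ : ℝ)
    (Λ : ℝ) (Ψ : ℂ → ℂ) : Prop :=
  A ≤ Λ ∧
  (∃ E : ℂ → ℂ, MemDecaySpace (-(tauExp P Q α).re - 1) (dualSector θ₁ θ₂ Λ) E ∧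
    ∀ z ∈ dualSector θ₁ θ₂ Λ,
      Ψ z = Complex.exp (-α * z) *
        (branchPow (-((θ₁ + θ₂) / 2)) (-(tauExp P Q α)) z + E z)) ∧
  ∀ z ∈ dualSector θ₁ θ₂ Λ, levelOneOp P Q R Ψ z = 0

/-! ### Borel summation -/

/-- The Laplace transform from the base point `α` in direction `θ`: the integral of
`e^{-zζ} φ(ζ) dζ` along the ray `α + e^{iθ}[0,∞)`. -/
def laplaceRay (α : ℂ) (θ : ℝ) (φ : ℂ → ℂ) (z : ℂ) : ℂ :=
  ∫ t in Ioi (0 : ℝ), Complex.exp (-z * rayPoint α θ t) * φ (rayPoint α θ t)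
    * Complex.exp (θ * Complex.I)

/-- The `n`-th coefficient of the Borel transform `(ζ-α)^{τ-1} ∑ bₙ (ζ-α)^n` of
`e^{-αz} z^{-τ} F(z⁻¹)`: the Borel transform sends `e^{-αz} z^{-τ-n}` to
`(ζ-α)^{τ+n-1} / Γ(τ+n)`. -/
def borelCoeff (τ : ℂ) (F : ℂ⟦X⟧) (n : ℕ) : ℂ :=
  PowerSeries.coeff n F / Complex.Gamma (τ + n)

/-- The Borel transform of `e^{-αz} z^{-τ} F(z⁻¹)` converges near `ζ = α`, and `φ` is an analytic
continuation of its sum along the ray that leaves `α` at angle `θ`. -/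
structure IsBorelContinuation (α τ : ℂ) (F : ℂ⟦X⟧) (θ : ℝ) (φ : ℂ → ℂ) : Prop where
  converges : ∃ r : ℝ, 0 < r ∧ ∀ w : ℂ, ‖w‖ < r → Summable fun n => borelCoeff τ F n * w ^ n
  analytic : AnalyticOnNhd ℂ φ (rayPoint α θ '' Ioi 0)
  eq_sum : ∀ᶠ t in 𝓝[>] (0 : ℝ), φ (rayPoint α θ t) =
    branchPow θ (τ - 1) (rayPoint α θ t - α)
      * ∑' n, borelCoeff τ F n * (rayPoint α θ t - α) ^ n

/-- `φ` is locally integrable on the closed ray and, away from the tip, uniformly of exponential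
type `Λ`. -/
structure HasExpTypeOnRay (α : ℂ) (θ Λ : ℝ) (φ : ℂ → ℂ) : Prop where
  locallyIntegrable : LocallyIntegrableOn (fun t : ℝ => φ (rayPoint α θ t)) (Ici 0)
  bound : ∃ C : ℝ, ∀ t : ℝ, 1 ≤ t → ‖φ (rayPoint α θ t)‖ ≤ C * Real.exp (Λ * t)

/-- `e^{-αz} z^{-τ} F(z⁻¹)` is Borel summable at `α` in direction `θ`, its Laplace transform is
given by a convergent integral on the half-plane `Re (e^{iθ} z) > Λ`, and its Borel sum is equal
to `Φ` there. -/
def IsBorelSum (α τ : ℂ) (F : ℂ⟦X⟧) (θ Λ : ℝ) (Φ : ℂ → ℂ) : Prop :=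
  ∃ φ : ℂ → ℂ, IsBorelContinuation α τ F θ φ ∧ HasExpTypeOnRay α θ Λ φ ∧
    ∀ z ∈ freqHalfPlane θ Λ, Φ z = laplaceRay α θ φ z

end

/-! ### Holomorphic dependence of integrals on a parameter -/

/-! The equation is solved in the Borel plane. Write `Ψ` as the integral of `e^{-zζ} φ(ζ) dζ` along
a ray leaving `α`. Then `∂_z` becomes multiplication by `-ζ`, `z⁻¹` becomes convolution with `1`,
and `z⁻² R(z⁻¹)` becomes convolution with the entire function `borelKernel`. Put `φ(α + u) = u^{τ-1}
h(u)` and divide by `u^τ`. The result is the Volterra equation `p(u) h(u) + ∫₀¹ t^{τ-1} K(t,u) h(tu)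
dt = 0` with `p(u) = P(-α-u)/u` and `K(t,u) = Q(-α-tu) + k((1-t)u)`, where `k` is the `borelKernel`.

Existence. On `uⁿ` the equation acts to leading order as multiplication by `p(0) n/(τ+n)`, so `h(0)`
is free and all later orders can be solved. After finitely many of them the remainder carries a
factor `u^{N+1}`, which replaces `τ` by `τ+N+1`. The Volterra operator is then a contraction in an
exponentially weighted norm (`IsRegularSingular.exists_solution`). Uniformity on the whole sector
holds because `p` has no zero on the closed sector and has the same degree as `Q`
(`exists_isRegularSingular`). The Laplace integral of `u^{τ-1} h(u)` solves the equation
(`levelOneOp_rayIntegral`). It does not depend on the direction, by Cauchy's theorem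
(`rayIntegral_eq`). It differs from `Γ(τ) e^{-αz} z^{-τ}` by the transform of `u^{τ-1}(h(u) - 1)`,
which gains one power of decay (`norm_exp_mul_rayIntegral_sub_le`).

Uniqueness. The difference `y` of two error terms solves the equation conjugated by `e^{-αz}`, whose
symbols are `X p` and `τ p + X Q₁`. The roots of `p` correspond to the other roots of `P(-ζ)`, none
of which lies on the ray. Hence `p(∂)` can be inverted by integrating from infinity inside a
half-plane (`exists_norm_polyDeriv_le`). The function `g = p(∂)y` satisfies `g' + τ g/z = O(sup
|z|^{Re τ+1}|g| · |z|^{-Re τ-3})`. Since `y` decays faster than `z^{-τ}`, integration from infinity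
improves the bound on `g` by a factor `O(1/|z|)`. Far out this halves the bound, so `g` and then `y`
vanish (`exists_eq_zero_of_forall`), and the identity theorem does the rest.

Formal solutions. The Borel transform turns the formal equation into the same Volterra equation for
power series, whose solutions are determined by their constant term. The Borel transform of a formal
solution is therefore a multiple of the expansion of `h` (`exists_hasSum_borelCoeff`). This gives
convergence, continuation, growth and the value of the Borel sum together. -/

theorem hasDerivAt_integral_of_holomorphic {T : Type*} [MeasurableSpace T] {μ : Measure T}
    {V : Set ℂ} (hV : IsOpen V) {F : ℂ → T → ℂ} {bound : T → ℝ}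
    (hmeas : ∀ u ∈ V, AEStronglyMeasurable (F u) μ)
    (hol : ∀ᵐ t ∂μ, DifferentiableOn ℂ (fun u => F u t) V)
    (hb : ∀ᵐ t ∂μ, ∀ u ∈ V, ‖F u t‖ ≤ bound t) (hint : Integrable bound μ)
    {u : ℂ} (hu : u ∈ V) :
    HasDerivAt (fun u => ∫ t, F u t ∂μ) (∫ t, deriv (fun u => F u t) u ∂μ) u := by
  obtain ⟨r, hr, hrV⟩ := Metric.isOpen_iff.1 hV u hu
  have hr2 : 0 < r / 2 := by positivity
  have hball : Metric.ball u (r / 2) ⊆ V :=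
    (Metric.ball_subset_ball (by linarith)).trans hrV
  have hint1 : Integrable (F u) μ :=
    hint.mono' (hmeas u hu) (hb.mono fun t ht => ht u hu)
  -- The derivative is a pointwise limit of difference quotients along the real increments `r / 4 /
  -- (n + 1)`, which stay in the ball.
  have hmeas' : AEStronglyMeasurable (fun t => deriv (fun u => F u t) u) μ := by
    have hlim : ∀ᵐ t ∂μ, Tendsto
        (fun n : ℕ => ((r / 4 / (n + 1) : ℝ) : ℂ)⁻¹ • (F (u + (r / 4 / (n + 1) : ℝ)) t - F u t))
        atTop (𝓝 (deriv (fun u => F u t) u)) := by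
      filter_upwards [hol] with t ht
      have hd := ((ht u hu).differentiableAt (hV.mem_nhds hu)).hasDerivAt
      rw [hasDerivAt_iff_tendsto_slope_zero] at hd
      refine hd.comp (tendsto_nhdsWithin_iff.2 ⟨?_, Eventually.of_forall fun n => ?_⟩)
      · have h0 : Tendsto (fun n : ℕ => r / 4 / ((n : ℝ) + 1)) atTop (𝓝 0) := by
          have := (tendsto_one_div_add_atTop_nhds_zero_nat (𝕜 := ℝ)).const_mul (r / 4)
          simpa [div_eq_mul_inv] using this
        exact_mod_cast (Complex.continuous_ofReal.tendsto 0).comp h0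
      · have : (0 : ℝ) < r / 4 / (n + 1) := by positivity
        exact Complex.ofReal_ne_zero.2 this.ne'
    refine aestronglyMeasurable_of_tendsto_ae atTop (fun n => ?_) hlim
    have hmem : u + ((r / 4 / (n + 1) : ℝ) : ℂ) ∈ Metric.ball u (r / 2) := by
      rw [Metric.mem_ball, dist_eq_norm, add_sub_cancel_left, Complex.norm_real, Real.norm_eq_abs,
        abs_of_pos (by positivity)]
      refine (div_le_self (by positivity) ?_).trans_lt (by linarith)
      linarith [n.cast_nonneg (α := ℝ)]
    exact ((hmeas _ (hball hmem)).sub (hmeas u hu)).const_smul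
      (((r / 4 / (n + 1) : ℝ) : ℂ)⁻¹)
  refine (hasDerivAt_integral_of_dominated_loc_of_deriv_le
    (F' := fun v t => deriv (fun u => F u t) v) (bound := fun t => bound t / (r / 2))
    (Metric.ball_mem_nhds u hr2) ?_ hint1 hmeas' ?_ (hint.div_const _) ?_).2
  · filter_upwards [hV.mem_nhds hu] with v hv using hmeas v hv
  -- Cauchy's estimate on circles of radius `r / 2` turns the bound on `F` into one on its
  -- derivative.
  · filter_upwards [hol, hb] with t ht hbt v hv
    have hvV : Metric.closedBall v (r / 2) ⊆ V := by
      refine fun w hw => hrV ?_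
      rw [Metric.mem_closedBall] at hw
      rw [Metric.mem_ball] at hv ⊢
      linarith [dist_triangle w v u]
    refine Complex.norm_deriv_le_of_forall_mem_sphere_norm_le hr2 ?_ fun w hw =>
      hbt w (hvV (Metric.sphere_subset_closedBall hw))
    exact (ht.mono hvV).diffContOnCl_ball subset_rfl
  · filter_upwards [hol] with t ht v hv
    exact ((ht v (hball hv)).differentiableAt (hV.mem_nhds (hball hv))).hasDerivAt

theorem differentiableOn_integral_of_holomorphic {T : Type*} [MeasurableSpace T] {μ : Measure T}
    {V : Set ℂ} (hV : IsOpen V) {F : ℂ → T → ℂ} {bound : T → ℝ}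
    (hmeas : ∀ u ∈ V, AEStronglyMeasurable (F u) μ)
    (hol : ∀ᵐ t ∂μ, DifferentiableOn ℂ (fun u => F u t) V)
    (hb : ∀ᵐ t ∂μ, ∀ u ∈ V, ‖F u t‖ ≤ bound t) (hint : Integrable bound μ) :
    DifferentiableOn ℂ (fun u => ∫ t, F u t ∂μ) V := fun _ hu =>
  (hasDerivAt_integral_of_holomorphic hV hmeas hol hb hint hu).differentiableAt.differentiableWithinAt

/-! ### Functions of exponential type -/

/-- `f` is bounded on `S` by a constant multiple of an exponential of `|u|`. -/
def ExpTypeOn (f : ℂ → ℂ) (S : Set ℂ) : Prop :=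
  ∃ C B : ℝ, ∀ u ∈ S, ‖f u‖ ≤ C * Real.exp (B * ‖u‖)

theorem ExpTypeOn.exists_nonneg {f : ℂ → ℂ} {S : Set ℂ} (h : ExpTypeOn f S) :
    ∃ C B : ℝ, 0 ≤ C ∧ 0 ≤ B ∧ ∀ u ∈ S, ‖f u‖ ≤ C * Real.exp (B * ‖u‖) := by
  obtain ⟨C, B, h⟩ := h
  refine ⟨|C|, |B|, abs_nonneg _, abs_nonneg _, fun u hu => (h u hu).trans ?_⟩
  gcongr
  · exact le_abs_self C
  · exact le_abs_self B

theorem ExpTypeOn.mono {f : ℂ → ℂ} {S T : Set ℂ} (h : ExpTypeOn f S) (hT : T ⊆ S) :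
    ExpTypeOn f T := by
  obtain ⟨C, B, h⟩ := h
  exact ⟨C, B, fun u hu => h u (hT hu)⟩

theorem ExpTypeOn.add {f g : ℂ → ℂ} {S : Set ℂ} (hf : ExpTypeOn f S) (hg : ExpTypeOn g S) :
    ExpTypeOn (fun u => f u + g u) S := by
  obtain ⟨C, B, hC, hB, h⟩ := hf.exists_nonneg
  obtain ⟨C', B', hC', hB', h'⟩ := hg.exists_nonneg
  refine ⟨C + C', max B B', fun u hu => (norm_add_le _ _).trans ?_⟩
  rw [add_mul]
  have h1 := h u hu
  have h2 := h' u hu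
  have e1 : Real.exp (B * ‖u‖) ≤ Real.exp (max B B' * ‖u‖) := by
    gcongr; exact le_max_left _ _
  have e2 : Real.exp (B' * ‖u‖) ≤ Real.exp (max B B' * ‖u‖) := by
    gcongr; exact le_max_right _ _
  exact add_le_add (h1.trans (by gcongr)) (h2.trans (by gcongr))

theorem ExpTypeOn.mul {f g : ℂ → ℂ} {S : Set ℂ} (hf : ExpTypeOn f S) (hg : ExpTypeOn g S) :
    ExpTypeOn (fun u => f u * g u) S := by
  obtain ⟨C, B, hC, hB, h⟩ := hf.exists_nonneg
  obtain ⟨C', B', hC', hB', h'⟩ := hg.exists_nonneg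
  refine ⟨C * C', B + B', fun u hu => ?_⟩
  rw [norm_mul, add_mul, Real.exp_add, mul_mul_mul_comm]
  exact mul_le_mul (h u hu) (h' u hu) (norm_nonneg _) (by positivity)

theorem expTypeOn_const (c : ℂ) (S : Set ℂ) : ExpTypeOn (fun _ => c) S :=
  ⟨‖c‖, 0, fun u _ => by simp⟩

theorem expTypeOn_id (S : Set ℂ) : ExpTypeOn (fun u => u) S :=
  ⟨1, 1, fun u _ => by linarith [Real.add_one_le_exp (1 * ‖u‖)]⟩

theorem ExpTypeOn.pow {f : ℂ → ℂ} {S : Set ℂ} (hf : ExpTypeOn f S) (n : ℕ) :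
    ExpTypeOn (fun u => f u ^ n) S := by
  induction n with
  | zero => simpa using expTypeOn_const 1 S
  | succ n ih => simpa only [pow_succ] using ih.mul hf

theorem expTypeOn_polynomial (q : Polynomial ℂ) (S : Set ℂ) :
    ExpTypeOn (fun u => q.eval u) S := by
  induction q using Polynomial.induction_on' with
  | add p q hp hq => simpa using hp.add hq
  | monomial n a =>
    simpa using (expTypeOn_const a S).mul ((expTypeOn_id S).pow n)

/-- A continuous function is of exponential type if it is so away from `0`. -/
theorem ExpTypeOn.of_compl_ball {f : ℂ → ℂ} (hf : Continuous f)
    (h : ExpTypeOn f (Metric.ball 0 1)ᶜ) : ExpTypeOn f univ := by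
  obtain ⟨C, B, hC, hB, h⟩ := h.exists_nonneg
  obtain ⟨M, hM⟩ := (isCompact_closedBall (0 : ℂ) 1).exists_bound_of_continuousOn hf.continuousOn
  have hM0 : 0 ≤ M := (norm_nonneg _).trans (hM 0 (by simp))
  refine ⟨M + C, B, fun u _ => ?_⟩
  have he : 1 ≤ Real.exp (B * ‖u‖) := Real.one_le_exp (by positivity)
  by_cases hu : u ∈ Metric.ball (0 : ℂ) 1
  · have := hM u (Metric.ball_subset_closedBall hu)
    nlinarith
  · have := h u hu
    nlinarith

/-- Outside the unit ball the quotient is no larger than its numerator; inside, continuity suffices.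
This permits division by `u` of a residual that vanishes at the tip. -/
theorem ExpTypeOn.dslope {f : ℂ → ℂ} (hd : Differentiable ℂ f) (hf : ExpTypeOn f univ) :
    ExpTypeOn (dslope f 0) univ := by
  have hd' : Differentiable ℂ (_root_.dslope f 0) := by
    rw [← differentiableOn_univ] at hd ⊢
    exact (Complex.differentiableOn_dslope univ_mem).2 hd
  refine ExpTypeOn.of_compl_ball hd'.continuous ?_
  obtain ⟨C, B, h⟩ := hf.add (expTypeOn_const (-f 0) univ)
  refine ⟨C, B, fun u hu => ?_⟩
  have h1 : 1 ≤ ‖u‖ := by simpa using hu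
  have hu0 : u ≠ 0 := by rintro rfl; simp at h1; linarith
  have hs := h u (mem_univ _)
  rw [dslope_of_ne _ hu0, slope_def_field, norm_div]
  refine (div_le_self (norm_nonneg _) (by simpa using h1)).trans ?_
  simpa [sub_eq_add_neg] using hs

/-! ### Integrals against the weight `t ^ (s - 1)` on `[0, 1]` -/

theorem intervalIntegrable_cpow_mul {s : ℂ} (hs : 0 < s.re) {g : ℝ → ℂ}
    (hg : ContinuousOn g (Icc 0 1)) :
    IntervalIntegrable (fun t : ℝ => (t : ℂ) ^ (s - 1) * g t) volume 0 1 := by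
  refine (intervalIntegral.intervalIntegrable_cpow' ?_).mul_continuousOn ?_
  · simpa using hs
  · rwa [uIcc_of_le zero_le_one]

theorem norm_cpow_sub_one_mul {s : ℂ} {t : ℝ} (ht : 0 < t) (w : ℂ) :
    ‖(t : ℂ) ^ (s - 1) * w‖ = t ^ (s.re - 1) * ‖w‖ := by
  rw [norm_mul, Complex.norm_cpow_eq_rpow_re_of_pos ht]
  simp

theorem intervalIntegrable_rpow_sub_one {a : ℝ} (ha : 0 < a) :
    IntervalIntegrable (fun t : ℝ => t ^ (a - 1)) volume 0 1 :=
  intervalIntegral.intervalIntegrable_rpow' (by linarith)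

/-- The factor `1 / s.re` is the integral of `t^(s.re - 1)`. It makes the Volterra operator small
once `s.re` is large. -/
theorem norm_integral_cpow_mul_le {s : ℂ} (hs : 0 < s.re) {g : ℝ → ℂ} {M : ℝ}
    (hM : ∀ t ∈ Ioc (0 : ℝ) 1, ‖g t‖ ≤ M) :
    ‖∫ t in (0 : ℝ)..1, (t : ℂ) ^ (s - 1) * g t‖ ≤ M / s.re := by
  have h1 : ‖∫ t in (0 : ℝ)..1, (t : ℂ) ^ (s - 1) * g t‖ ≤
      ∫ t in (0 : ℝ)..1, t ^ (s.re - 1) * M := by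
    refine intervalIntegral.norm_integral_le_of_norm_le zero_le_one ?_
      ((intervalIntegrable_rpow_sub_one hs).mul_const M)
    refine Eventually.of_forall fun t ht => ?_
    rw [norm_cpow_sub_one_mul ht.1]
    exact mul_le_mul_of_nonneg_left (hM t ht) (Real.rpow_nonneg ht.1.le _)
  refine h1.trans_eq ?_
  rw [intervalIntegral.integral_mul_const, integral_rpow (Or.inl (by linarith))]
  simp [hs.ne', div_eq_inv_mul]

theorem hasSum_integral_cpow_mul {s : ℂ} (hs : 0 < s.re) {g : ℕ → ℝ → ℂ} {M : ℕ → ℝ}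
    (hg : ∀ n, ContinuousOn (g n) (Icc 0 1)) (hM : ∀ n, ∀ t ∈ Icc (0 : ℝ) 1, ‖g n t‖ ≤ M n)
    (hsum : Summable M) :
    HasSum (fun n => ∫ t in (0 : ℝ)..1, (t : ℂ) ^ (s - 1) * g n t)
      (∫ t in (0 : ℝ)..1, (t : ℂ) ^ (s - 1) * ∑' n, g n t) := by
  have hI : uIoc (0 : ℝ) 1 = Ioc 0 1 := uIoc_of_le zero_le_one
  refine intervalIntegral.hasSum_integral_of_dominated_convergence
    (fun n t => t ^ (s.re - 1) * M n) (fun n => ?_) (fun n => ?_) ?_ ?_ ?_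
  · exact ((intervalIntegrable_iff.1 (intervalIntegrable_cpow_mul hs (hg n)))).1
  · refine Eventually.of_forall fun t ht => ?_
    rw [hI] at ht
    rw [norm_cpow_sub_one_mul ht.1]
    exact mul_le_mul_of_nonneg_left (hM n t ⟨ht.1.le, ht.2⟩) (Real.rpow_nonneg ht.1.le _)
  · exact Eventually.of_forall fun t _ => hsum.mul_left _
  · simp_rw [tsum_mul_left]
    exact (intervalIntegrable_rpow_sub_one hs).mul_const _
  · refine Eventually.of_forall fun t ht => ?_
    rw [hI] at ht
    refine HasSum.mul_left _ (Summable.hasSum ?_)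
    exact Summable.of_norm_bounded hsum fun n => hM n t ⟨ht.1.le, ht.2⟩

/-! ### Volterra operators with a regular singularity at the tip -/

/-- The operator `f ↦ ∫₀¹ t ^ (s - 1) K(t, u) f(t u) dt`. -/
noncomputable def volterraOp (K : ℝ → ℂ → ℂ) (s : ℂ) (f : ℂ → ℂ) (u : ℂ) : ℂ :=
  ∫ t in (0 : ℝ)..1, (t : ℂ) ^ (s - 1) * (K t u * f (t * u))

section Star

variable {U : Set ℂ} {K : ℝ → ℂ → ℂ} {f g : ℂ → ℂ} {s u : ℂ}

theorem continuousOn_volterra_integrand (hstar : ∀ u ∈ U, ∀ t ∈ Icc (0 : ℝ) 1, (t : ℂ) * u ∈ U)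
    (hK : Continuous (Function.uncurry K)) (hf : ContinuousOn f U) :
    ContinuousOn (fun x : ℝ × ℂ => K x.1 x.2 * f (x.1 * x.2)) (Icc 0 1 ×ˢ U) := by
  refine (ContinuousOn.mul (f := fun x : ℝ × ℂ => K x.1 x.2) hK.continuousOn ?_)
  refine hf.comp (Continuous.continuousOn (by fun_prop)) ?_
  rintro ⟨t, u⟩ ⟨ht, hu⟩
  exact hstar u hu t ht

theorem continuousOn_volterra_integrand_left
    (hstar : ∀ u ∈ U, ∀ t ∈ Icc (0 : ℝ) 1, (t : ℂ) * u ∈ U)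
    (hK : Continuous (Function.uncurry K)) (hf : ContinuousOn f U) (hu : u ∈ U) :
    ContinuousOn (fun t : ℝ => K t u * f (t * u)) (Icc 0 1) :=
  (continuousOn_volterra_integrand hstar hK hf).comp (f := fun t : ℝ => (t, u))
    (Continuous.continuousOn (by fun_prop)) fun _ ht => ⟨ht, hu⟩

theorem volterraOp_add (hs : 0 < s.re)
    (hstar : ∀ u ∈ U, ∀ t ∈ Icc (0 : ℝ) 1, (t : ℂ) * u ∈ U)
    (hK : Continuous (Function.uncurry K)) (hf : ContinuousOn f U) (hg : ContinuousOn g U)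
    (hu : u ∈ U) :
    volterraOp K s (fun u => f u + g u) u = volterraOp K s f u + volterraOp K s g u := by
  unfold volterraOp
  rw [← intervalIntegral.integral_add
    (intervalIntegrable_cpow_mul hs (continuousOn_volterra_integrand_left hstar hK hf hu))
    (intervalIntegrable_cpow_mul hs (continuousOn_volterra_integrand_left hstar hK hg hu))]
  congr 1; ext t; ring

theorem volterraOp_const_mul (c : ℂ) :
    volterraOp K s (fun u => c * f u) u = c * volterraOp K s f u := by
  unfold volterraOp
  rw [← intervalIntegral.integral_const_mul]
  congr 1; ext t; ring

/-- Since `(tu)ⁿ = tⁿ uⁿ`, a factor `uⁿ` passes through the operator at the price of raising the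
exponent. Solving to high order thus reduces to large `s`. -/
theorem volterraOp_pow_mul (n : ℕ) :
    volterraOp K s (fun u => u ^ n * f u) u = u ^ n * volterraOp K (s + n) f u := by
  unfold volterraOp
  rw [← intervalIntegral.integral_const_mul]
  refine intervalIntegral.integral_congr_ae (Eventually.of_forall fun t ht => ?_)
  rw [uIoc_of_le zero_le_one] at ht
  have ht0 : (t : ℂ) ≠ 0 := Complex.ofReal_ne_zero.2 ht.1.ne'
  have : (t : ℂ) ^ (s + n - 1) = (t : ℂ) ^ (s - 1) * (t : ℂ) ^ n := by
    rw [← Complex.cpow_natCast, ← Complex.cpow_add _ _ ht0]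
    congr 1; ring
  simp only
  rw [this, mul_pow]
  ring

theorem differentiableOn_volterraOp (hU : IsOpen U)
    (hstar : ∀ u ∈ U, ∀ t ∈ Icc (0 : ℝ) 1, (t : ℂ) * u ∈ U)
    (hK : Continuous (Function.uncurry K)) (hKd : ∀ t, Differentiable ℂ (K t))
    (hs : 0 < s.re) (hf : DifferentiableOn ℂ f U) :
    DifferentiableOn ℂ (volterraOp K s f) U := by
  intro u₀ hu₀
  obtain ⟨r, hr, hrU⟩ := Metric.nhds_basis_closedBall.mem_iff.1 (hU.mem_nhds hu₀)
  have hbU : Metric.ball u₀ r ⊆ U := Metric.ball_subset_closedBall.trans hrU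
  obtain ⟨M, hM⟩ := (isCompact_Icc.prod (isCompact_closedBall u₀ r)).exists_bound_of_continuousOn
    ((continuousOn_volterra_integrand hstar hK hf.continuousOn).mono
      (Set.prod_mono subset_rfl hrU))
  have hd : DifferentiableOn ℂ (volterraOp K s f) (Metric.ball u₀ r) := by
    have : volterraOp K s f = fun u => ∫ t in Ioc (0 : ℝ) 1,
        (t : ℂ) ^ (s - 1) * (K t u * f (t * u)) := by
      ext u
      rw [volterraOp, intervalIntegral.integral_of_le zero_le_one]
    rw [this]
    refine differentiableOn_integral_of_holomorphic (bound := fun t => t ^ (s.re - 1) * M)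
      Metric.isOpen_ball (fun u hu => ?_) ?_ ?_ ?_
    · exact ((intervalIntegrable_iff_integrableOn_Ioc_of_le zero_le_one).1
        (intervalIntegrable_cpow_mul hs (continuousOn_volterra_integrand_left hstar hK
          hf.continuousOn (hbU hu)))).1
    · refine (ae_restrict_iff' measurableSet_Ioc).2 (Eventually.of_forall fun t ht => ?_)
      refine DifferentiableOn.const_mul (((hKd t).differentiableOn).mul ?_) _
      refine hf.comp (Differentiable.differentiableOn (by fun_prop)) fun u hu => ?_
      exact hstar u (hbU hu) t ⟨ht.1.le, ht.2⟩
    · refine (ae_restrict_iff' measurableSet_Ioc).2 (Eventually.of_forall fun t ht u hu => ?_)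
      rw [norm_cpow_sub_one_mul ht.1]
      exact mul_le_mul_of_nonneg_left
        (hM (t, u) ⟨⟨ht.1.le, ht.2⟩, Metric.ball_subset_closedBall hu⟩)
        (Real.rpow_nonneg ht.1.le _)
    · exact ((intervalIntegrable_iff_integrableOn_Ioc_of_le zero_le_one).1
        (intervalIntegrable_rpow_sub_one hs)).mul_const M
  exact (hd.differentiableAt (Metric.ball_mem_nhds u₀ hr)).differentiableWithinAt

end Star

/-- The data of a regular singular Volterra equation `p(u) h(u) + ∫₀¹ t ^ (τ - 1) K(t, u) h(t u) dt
= 0` on a domain `U` that is star-shaped about `0`, with indicial root `0`. -/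
structure IsRegularSingular (U : Set ℂ) (p : ℂ → ℂ) (K : ℝ → ℂ → ℂ) (τ : ℂ) : Prop where
  isOpen : IsOpen U
  zero_mem : (0 : ℂ) ∈ U
  star : ∀ u ∈ U, ∀ t ∈ Icc (0 : ℝ) 1, (t : ℂ) * u ∈ U
  differentiable_left : Differentiable ℂ p
  expType_left : ExpTypeOn p univ
  le_norm_left : ∃ c : ℝ, 0 < c ∧ ∀ u ∈ U, c ≤ ‖p u‖
  continuous_kernel : Continuous (Function.uncurry K)
  differentiable_kernel : ∀ t, Differentiable ℂ (K t)
  expType_kernel : ∃ C B : ℝ, 0 ≤ C ∧ 0 ≤ B ∧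
    ∀ t ∈ Icc (0 : ℝ) 1, ∀ u, ‖K t u‖ ≤ C * Real.exp (B * ‖u‖)
  -- The weight has `(1 - t)‖u‖` rather than `‖u‖`: multiplied by the growth `exp (D t ‖u‖)` of `h
  -- (t u)` it gives back `exp (D ‖u‖)`, so the exponential type does not increase under iteration.
  norm_kernel_le : ∃ C B : ℝ, 0 ≤ C ∧ 0 ≤ B ∧ ∀ t ∈ Icc (0 : ℝ) 1, ∀ u ∈ U,
    ‖K t u‖ ≤ C * ‖p u‖ * Real.exp (B * ((1 - t) * ‖u‖))
  re_pos : 0 < τ.re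
  -- As `∫₀¹ t^(τ-1) dt = 1/τ`, the equation holds at `u = 0` for every value of `h 0`.
  indicial : ∀ t, K t 0 = -(τ * p 0)

/-! ### Solving regular singular Volterra equations: approximation at the tip and Neumann series. -/

namespace IsRegularSingular

variable {U : Set ℂ} {p : ℂ → ℂ} {K : ℝ → ℂ → ℂ} {τ : ℂ}

theorem left_zero_ne (h : IsRegularSingular U p K τ) : p 0 ≠ 0 := by
  obtain ⟨c, hc, h1⟩ := h.le_norm_left
  have := h1 0 h.zero_mem
  exact norm_pos_iff.1 (hc.trans_le this)

theorem expTypeOn_volterraOp (h : IsRegularSingular U p K τ) {s : ℂ} (hs : 0 < s.re) {f : ℂ → ℂ}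
    (hf : ExpTypeOn f univ) : ExpTypeOn (volterraOp K s f) univ := by
  obtain ⟨C, B, hC, hB, hK⟩ := h.expType_kernel
  obtain ⟨C', B', hC', hB', hf⟩ := hf.exists_nonneg
  refine ⟨C * C' / s.re, B + B', fun u _ => ?_⟩
  rw [div_mul_eq_mul_div]
  refine norm_integral_cpow_mul_le hs fun t ht => ?_
  rw [norm_mul, add_mul, Real.exp_add, mul_mul_mul_comm]
  refine mul_le_mul (hK t ⟨ht.1.le, ht.2⟩ u) ((hf _ (mem_univ _)).trans ?_) (norm_nonneg _)
    (by positivity)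
  gcongr
  rw [norm_mul, Complex.norm_real, Real.norm_of_nonneg ht.1.le]
  exact mul_le_of_le_one_left (norm_nonneg _) ht.2

theorem volterraOp_apply_zero (h : IsRegularSingular U p K τ) {s : ℂ} (hs : 0 < s.re)
    (f : ℂ → ℂ) : volterraOp K s f 0 = -(τ * p 0) * f 0 / s := by
  have hs0 : s ≠ 0 := by rintro rfl; simp at hs
  simp only [volterraOp, h.indicial, mul_zero]
  rw [intervalIntegral.integral_mul_const, integral_cpow (Or.inl (by simpa using hs))]
  simp [hs0]
  ring

/-- Approximate solutions of arbitrary order. -/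
theorem exists_approx (h : IsRegularSingular U p K τ) (N : ℕ) :
    ∃ H g : ℂ → ℂ, Differentiable ℂ H ∧ ExpTypeOn H univ ∧ H 0 = 1 ∧
      Differentiable ℂ g ∧ ExpTypeOn g univ ∧
      ∀ u, p u * H u + volterraOp K τ H u = u ^ (N + 1) * g u := by
  have hstar : ∀ u ∈ (univ : Set ℂ), ∀ t ∈ Icc (0 : ℝ) 1, (t : ℂ) * u ∈ (univ : Set ℂ) :=
    fun _ _ _ _ => mem_univ _
  have hop : ∀ {s : ℂ}, 0 < s.re → ∀ {f : ℂ → ℂ}, Differentiable ℂ f →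
      Differentiable ℂ (volterraOp K s f) := fun hs f hf =>
    differentiableOn_univ.1 (differentiableOn_volterraOp isOpen_univ hstar h.continuous_kernel
      h.differentiable_kernel hs hf.differentiableOn)
  have hslope : ∀ {f : ℂ → ℂ}, Differentiable ℂ f → ExpTypeOn f univ → f 0 = 0 →
      ∃ g : ℂ → ℂ, Differentiable ℂ g ∧ ExpTypeOn g univ ∧ ∀ u, f u = u * g u := by
    intro f hf hfe hf0
    refine ⟨dslope f 0, ?_, hfe.dslope hf, fun u => ?_⟩
    · rw [← differentiableOn_univ] at hf ⊢
      exact (Complex.differentiableOn_dslope univ_mem).2 hf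
    · have := sub_smul_dslope f 0 u
      simpa [hf0] using this.symm
  have hτ0 : τ ≠ 0 := by rintro rfl; simpa using h.re_pos
  induction N with
  | zero =>
    have h1 : Differentiable ℂ (fun _ : ℂ => (1 : ℂ)) := differentiable_const _
    -- For `H = 1` the residual vanishes at `0` by the indicial condition, hence is divisible by
    -- `u`.
    obtain ⟨g, hg, hge, hgu⟩ := hslope (f := fun u => p u * 1 + volterraOp K τ (fun _ => 1) u)
      ((h.differentiable_left.mul h1).add (hop h.re_pos h1))
      ((h.expType_left.mul (expTypeOn_const 1 _)).add
        (h.expTypeOn_volterraOp h.re_pos (expTypeOn_const 1 _)))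
      (by rw [h.volterraOp_apply_zero h.re_pos]; field_simp; ring)
    exact ⟨fun _ => 1, g, h1, expTypeOn_const 1 _, rfl, hg, hge, by simpa using hgu⟩
  | succ N ih =>
    obtain ⟨H, g, hH, hHe, hH0, hg, hge, hHg⟩ := ih
    have hs : 0 < (τ + (N + 1 : ℕ)).re := by
      have := h.re_pos
      simp only [Complex.add_re, Complex.natCast_re]
      positivity
    have hs0 : τ + (N + 1 : ℕ) ≠ 0 := by intro h0; rw [h0] at hs; simp at hs
    -- `u^(N+1) ℓ(u)` is the image of `u^(N+1)`, and `ℓ 0 = p 0 (N+1)/(τ+N+1)` is nonzero. A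
    -- multiple of `u^(N+1)` can therefore cancel the leading term `g 0` of the residual.
    set ℓ : ℂ → ℂ := fun u => p u * 1 + volterraOp K (τ + (N + 1 : ℕ)) (fun _ => 1) u with hℓ
    have h1 : Differentiable ℂ (fun _ : ℂ => (1 : ℂ)) := differentiable_const _
    have hℓd : Differentiable ℂ ℓ := (h.differentiable_left.mul h1).add (hop hs h1)
    have hℓe : ExpTypeOn ℓ univ := (h.expType_left.mul (expTypeOn_const 1 _)).add
        (h.expTypeOn_volterraOp hs (expTypeOn_const 1 _))
    have hℓ0 : ℓ 0 ≠ 0 := by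
      have : ℓ 0 = p 0 * ((N + 1 : ℕ) / (τ + (N + 1 : ℕ))) := by
        simp only [hℓ, h.volterraOp_apply_zero hs]
        field_simp
        ring
      rw [this]
      refine mul_ne_zero h.left_zero_ne (div_ne_zero ?_ hs0)
      exact Nat.cast_ne_zero.2 N.succ_ne_zero
    set b : ℂ := -(g 0 / ℓ 0) with hb
    obtain ⟨g', hg', hge', hgu'⟩ := hslope (f := fun u => g u + b * ℓ u)
      (hg.add (hℓd.const_mul b)) (hge.add ((expTypeOn_const b _).mul hℓe))
      (by rw [hb]; field_simp; ring)
    refine ⟨fun u => H u + b * (u ^ (N + 1) * 1), g', by fun_prop, ?_, by simp [hH0], hg', hge',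
      fun u => ?_⟩
    · exact hHe.add ((expTypeOn_const b _).mul (((expTypeOn_id _).pow _).mul (expTypeOn_const 1 _)))
    · rw [volterraOp_add (U := univ) h.re_pos hstar h.continuous_kernel hH.continuous.continuousOn
        (Continuous.continuousOn (by fun_prop)) (mem_univ u), volterraOp_const_mul,
        volterraOp_pow_mul]
      calc p u * (H u + b * (u ^ (N + 1) * 1)) + (volterraOp K τ H u
            + b * (u ^ (N + 1) * volterraOp K (τ + (N + 1 : ℕ)) (fun _ => 1) u))
          = (p u * H u + volterraOp K τ H u) + b * u ^ (N + 1) * ℓ u := by simp only [hℓ]; ring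
        _ = u ^ (N + 1) * (g u + b * ℓ u) := by rw [hHg]; ring
        _ = u ^ (N + 1 + 1) * g' u := by rw [hgu']; ring

/-- A solution of the inhomogeneous equation whose exponent `s` is so large that the Volterra
operator is a contraction. -/
theorem exists_solution_of_contraction (h : IsRegularSingular U p K τ) {C B : ℝ} (hC : 0 ≤ C)
    (hB : 0 ≤ B) (hK : ∀ t ∈ Icc (0 : ℝ) 1, ∀ u ∈ U,
      ‖K t u‖ ≤ C * ‖p u‖ * Real.exp (B * ((1 - t) * ‖u‖)))
    {s : ℂ} (hs : 0 < s.re) (hCs : 2 * C ≤ s.re) {g : ℂ → ℂ} (hg : Differentiable ℂ g)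
    (hge : ExpTypeOn g univ) :
    ∃ f : ℂ → ℂ, DifferentiableOn ℂ f U ∧ ExpTypeOn f U ∧
      ∀ u ∈ U, p u * f u + volterraOp K s f u = -g u := by
  obtain ⟨c, hc, hp⟩ := h.le_norm_left
  have hp0 : ∀ u ∈ U, p u ≠ 0 := fun u hu => norm_pos_iff.1 (hc.trans_le (hp u hu))
  obtain ⟨C₁, B₁, hC₁, hB₁, hg1⟩ := hge.exists_nonneg
  set M := C₁ / c with hM
  have hM0 : 0 ≤ M := by positivity
  set D := max B B₁ with hD
  -- Terms of the Neumann series: `F₀ = -g/p` and `F_{n+1} = -(V F_n)/p`, where `V` is the Volterra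
  -- operator.
  let F : ℕ → ℂ → ℂ := fun n => Nat.rec (fun u => -g u / p u)
    (fun _ f u => -volterraOp K s f u / p u) n
  have hF0 : ∀ u, F 0 u = -g u / p u := fun u => rfl
  have hFs : ∀ n u, F (n + 1) u = -volterraOp K s (F n) u / p u := fun n u => rfl
  have hFd : ∀ n, DifferentiableOn ℂ (F n) U := by
    intro n
    induction n with
    | zero =>
      exact (hg.neg.differentiableOn).div h.differentiable_left.differentiableOn hp0
    | succ n ih =>
      exact (differentiableOn_volterraOp h.isOpen h.star h.continuous_kernel
        h.differentiable_kernel hs ih).neg.div h.differentiable_left.differentiableOn hp0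
  have hFb : ∀ n, ∀ u ∈ U, ‖F n u‖ ≤ M * Real.exp (D * ‖u‖) * (1 / 2) ^ n := by
    intro n
    induction n with
    | zero =>
      intro u hu
      rw [hF0, norm_div, norm_neg, div_le_iff₀ (norm_pos_iff.2 (hp0 u hu)), pow_zero, mul_one]
      refine (hg1 u (mem_univ _)).trans ?_
      have e1 : Real.exp (B₁ * ‖u‖) ≤ Real.exp (D * ‖u‖) := by
        gcongr; exact le_max_right _ _
      calc C₁ * Real.exp (B₁ * ‖u‖) ≤ C₁ * Real.exp (D * ‖u‖) := by gcongr
        _ = M * Real.exp (D * ‖u‖) * c := by rw [hM]; field_simp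
        _ ≤ M * Real.exp (D * ‖u‖) * ‖p u‖ := by gcongr; exact hp u hu
    | succ n ih =>
      intro u hu
      rw [hFs, norm_div, norm_neg, div_le_iff₀ (norm_pos_iff.2 (hp0 u hu))]
      have hle : ∀ t ∈ Ioc (0 : ℝ) 1, ‖K t u * F n (t * u)‖ ≤
          C * ‖p u‖ * (M * Real.exp (D * ‖u‖) * (1 / 2) ^ n) := by
        intro t ht
        have ht' : t ∈ Icc (0 : ℝ) 1 := ⟨ht.1.le, ht.2⟩
        have hn : ‖(t : ℂ) * u‖ = t * ‖u‖ := by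
          rw [norm_mul, Complex.norm_real, Real.norm_of_nonneg ht.1.le]
        have h1 := ih _ (h.star u hu t ht')
        rw [hn] at h1
        have h2 : Real.exp (B * ((1 - t) * ‖u‖)) ≤ Real.exp (D * ((1 - t) * ‖u‖)) := by
          have : 0 ≤ (1 - t) * ‖u‖ := mul_nonneg (by linarith [ht.2]) (norm_nonneg _)
          gcongr; exact le_max_left _ _
        rw [norm_mul]
        calc ‖K t u‖ * ‖F n (t * u)‖
            ≤ (C * ‖p u‖ * Real.exp (D * ((1 - t) * ‖u‖))) *
              (M * Real.exp (D * (t * ‖u‖)) * (1 / 2) ^ n) := by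
              refine mul_le_mul ((hK t ht' u hu).trans ?_) h1 (norm_nonneg _) (by positivity)
              gcongr
          _ = C * ‖p u‖ * (M * (Real.exp (D * ((1 - t) * ‖u‖)) * Real.exp (D * (t * ‖u‖)))
              * (1 / 2) ^ n) := by ring
          _ = _ := by
              rw [← Real.exp_add]
              congr 4; ring_nf
      -- The ratio of successive bounds is `C / s.re ≤ 1/2`.
      refine (norm_integral_cpow_mul_le hs hle).trans ?_
      rw [div_le_iff₀ hs]
      have : 0 ≤ ‖p u‖ * (M * Real.exp (D * ‖u‖) * (1 / 2) ^ n) := by positivity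
      rw [pow_succ]
      nlinarith
  have hgeo : Summable fun n : ℕ => ((1 : ℝ) / 2) ^ n :=
    summable_geometric_of_lt_one (by norm_num) (by norm_num)
  have hsumF : ∀ u ∈ U, Summable fun n => F n u := fun u hu =>
    Summable.of_norm_bounded (hgeo.mul_left _) fun n => hFb n u hu
  refine ⟨fun u => ∑' n, F n u, fun u hu => ?_, ⟨M * 2, D, fun u hu => ?_⟩, fun u hu => ?_⟩
  · have hV : IsOpen (U ∩ Metric.ball 0 (‖u‖ + 1)) := h.isOpen.inter Metric.isOpen_ball
    have hd := Complex.differentiableOn_tsum_of_summable_norm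
      (u := fun n => M * Real.exp (D * (‖u‖ + 1)) * (1 / 2) ^ n) (hgeo.mul_left _)
      (fun n => (hFd n).mono inter_subset_left) hV (fun n w hw => (hFb n w hw.1).trans ?_)
    · exact (hd.differentiableAt (hV.mem_nhds ⟨hu, by simp⟩)).differentiableWithinAt
    · have : ‖w‖ ≤ ‖u‖ + 1 := by simpa using (Metric.mem_ball.1 hw.2).le
      have hD0 : 0 ≤ D := hB.trans (le_max_left _ _)
      gcongr
  · refine (tsum_of_norm_bounded (hgeo.hasSum.mul_left _) fun n => hFb n u hu).trans_eq ?_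
    rw [tsum_geometric_of_lt_one (by norm_num) (by norm_num)]
    ring
  · have hseg : HasSum (fun n => volterraOp K s (F n) u)
        (volterraOp K s (fun u => ∑' n, F n u) u) := by
      obtain ⟨A, hA⟩ := isCompact_Icc.exists_bound_of_continuousOn (f := fun t : ℝ => K t u)
        (s := Icc (0 : ℝ) 1) (Continuous.continuousOn
          (h.continuous_kernel.comp (f := fun t : ℝ => (t, u)) (by fun_prop)))
      have hD0 : 0 ≤ D := hB.trans (le_max_left _ _)
      have hA0 : 0 ≤ A := (norm_nonneg _).trans (hA 0 (by simp))
      have := hasSum_integral_cpow_mul hs (g := fun n t => K t u * F n (t * u))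
        (M := fun n => A * (M * Real.exp (D * ‖u‖) * (1 / 2) ^ n))
        (fun n => continuousOn_volterra_integrand_left h.star h.continuous_kernel
          (hFd n).continuousOn hu) (fun n t ht => ?_) ((hgeo.mul_left _).mul_left _)
      · simpa only [volterraOp, tsum_mul_left] using this
      · rw [norm_mul]
        refine mul_le_mul (hA t ht) ((hFb n _ (h.star u hu t ht)).trans ?_) (norm_nonneg _) hA0
        gcongr
        rw [norm_mul, Complex.norm_real, Real.norm_of_nonneg ht.1]
        exact mul_le_of_le_one_left (norm_nonneg _) ht.2
    -- By the recursion, applying the operator to the sum only shifts the series by one term, so all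
    -- but the term `F₀` cancel.
    have h2 : HasSum (fun n => -(p u * F (n + 1) u)) (volterraOp K s (fun u => ∑' n, F n u) u) := by
      convert hseg using 2 with n
      rw [hFs]
      field_simp [hp0 u hu]
    have h3 := (hsumF u hu).tsum_eq_zero_add
    have h4 := h2.tsum_eq
    rw [tsum_neg, tsum_mul_left] at h4
    beta_reduce
    rw [← h4, h3, hF0]
    field_simp [hp0 u hu]
    ring

/-- The solution of a regular singular Volterra equation with value `1` at the tip. -/
theorem exists_solution (h : IsRegularSingular U p K τ) :
    ∃ f : ℂ → ℂ, DifferentiableOn ℂ f U ∧ ExpTypeOn f U ∧ f 0 = 1 ∧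
      ∀ u ∈ U, p u * f u + volterraOp K τ f u = 0 := by
  obtain ⟨C, B, hC, hB, hK⟩ := h.norm_kernel_le
  -- This order of approximation brings the exponent `τ + N + 1` into the contraction range.
  obtain ⟨N, hN⟩ := exists_nat_ge (2 * C)
  obtain ⟨H, g, hH, hHe, hH0, hg, hge, hHg⟩ := h.exists_approx N
  have hτ := h.re_pos
  have hs : 0 < (τ + (N + 1 : ℕ)).re := by
    simp only [Complex.add_re, Complex.natCast_re]
    positivity
  obtain ⟨f, hf, hfe, hfu⟩ := h.exists_solution_of_contraction hC hB hK hs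
    (by rw [Complex.add_re, Complex.natCast_re]; push_cast; linarith) hg hge
  refine ⟨fun u => H u + u ^ (N + 1) * f u, ?_, ?_, by simp [hH0], fun u hu => ?_⟩
  · exact hH.differentiableOn.add ((differentiable_id.pow _).differentiableOn.mul hf)
  · exact (hHe.mono (subset_univ _)).add (((expTypeOn_id _).pow _).mul hfe)
  · beta_reduce
    rw [volterraOp_add (g := fun u => u ^ (N + 1) * f u) h.re_pos h.star h.continuous_kernel
      hH.continuous.continuousOn ((continuous_id.pow _).continuousOn.mul hf.continuousOn) hu, volterraOp_pow_mul]
    calc p u * (H u + u ^ (N + 1) * f u) + (volterraOp K τ H u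
          + u ^ (N + 1) * volterraOp K (τ + (N + 1 : ℕ)) f u)
        = (p u * H u + volterraOp K τ H u)
          + u ^ (N + 1) * (p u * f u + volterraOp K (τ + (N + 1 : ℕ)) f u) := by ring
      _ = 0 := by rw [hHg, hfu u hu]; ring

end IsRegularSingular

/-! ### Taylor coefficients and the Borel kernel -/

theorem exists_norm_coeff_taylorPS_le {R : ℂ → ℂ} {A : ℝ} (hA : 0 < A)
    (hR : DifferentiableOn ℂ R (Metric.ball 0 A⁻¹)) :
    ∃ M B : ℝ, 0 ≤ M ∧ 0 < B ∧ ∀ j, ‖PowerSeries.coeff j (taylorPS R)‖ ≤ M * B ^ j := by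
  set ρ := A⁻¹ / 2 with hρ
  have hρ0 : 0 < ρ := by positivity
  have hsub : Metric.closedBall (0 : ℂ) ρ ⊆ Metric.ball 0 A⁻¹ :=
    Metric.closedBall_subset_ball (half_lt_self (inv_pos.2 hA))
  obtain ⟨M, hM⟩ := (isCompact_closedBall (0 : ℂ) ρ).exists_bound_of_continuousOn
    (hR.continuousOn.mono hsub)
  refine ⟨M, ρ⁻¹, (norm_nonneg _).trans (hM 0 (by simp [hρ0.le])), inv_pos.2 hρ0, fun j => ?_⟩
  have h := Complex.norm_iteratedDeriv_le_of_forall_mem_sphere_norm_le j hρ0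
    ((hR.mono hsub).diffContOnCl_ball subset_rfl)
    fun z hz => hM z (Metric.sphere_subset_closedBall hz)
  have hj : (0 : ℝ) < j.factorial := by positivity
  rw [taylorPS, PowerSeries.coeff_mk, norm_div, Complex.norm_natCast, div_le_iff₀ hj]
  refine h.trans_eq ?_
  rw [inv_pow]
  field_simp

theorem hasSum_coeff_taylorPS {R : ℂ → ℂ} {A : ℝ}
    (hR : DifferentiableOn ℂ R (Metric.ball 0 A⁻¹)) {w : ℂ} (hw : ‖w‖ < A⁻¹) :
    HasSum (fun j => PowerSeries.coeff j (taylorPS R) * w ^ j) (R w) := by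
  have h := Complex.hasSum_taylorSeries_on_ball hR (z := w) (by simpa using hw)
  refine h.congr_fun fun j => ?_
  simp only [taylorPS, PowerSeries.coeff_mk, sub_zero, smul_eq_mul, div_eq_mul_inv]
  ring

/-- The Borel transform `∑ r_j u ^ (j + 1) / (j + 1)!` of `z⁻² ∑ r_j z⁻ʲ`. -/
noncomputable def borelKernel (r : ℕ → ℂ) (u : ℂ) : ℂ :=
  ∑' j, r j / ((j + 1).factorial : ℂ) * u ^ (j + 1)

theorem norm_borelKernel_term_le {r : ℕ → ℂ} {M B : ℝ} (hB : 0 < B)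
    (hr : ∀ j, ‖r j‖ ≤ M * B ^ j) (j : ℕ) (u : ℂ) :
    ‖r j / ((j + 1).factorial : ℂ) * u ^ (j + 1)‖ ≤
      M / B * ((B * ‖u‖) ^ (j + 1) / ((j + 1).factorial : ℝ)) := by
  have hj : (0 : ℝ) < (j + 1).factorial := by positivity
  rw [norm_mul, norm_div, norm_pow, Complex.norm_natCast, mul_pow, pow_succ B]
  calc ‖r j‖ / ((j + 1).factorial : ℝ) * ‖u‖ ^ (j + 1)
      ≤ M * B ^ j / ((j + 1).factorial : ℝ) * ‖u‖ ^ (j + 1) := by gcongr; exact hr j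
    _ = _ := by field_simp

theorem hasSum_pow_succ_div_factorial (x : ℝ) :
    HasSum (fun j : ℕ => x ^ (j + 1) / ((j + 1).factorial : ℝ)) (Real.exp x - 1) := by
  have h := NormedSpace.expSeries_div_hasSum_exp x
  rw [← Real.exp_eq_exp_ℝ] at h
  simpa using (hasSum_nat_add_iff' 1).2 h

theorem hasSum_borelKernel {r : ℕ → ℂ} {M B : ℝ} (hB : 0 < B) (hr : ∀ j, ‖r j‖ ≤ M * B ^ j)
    (u : ℂ) :
    HasSum (fun j => r j / ((j + 1).factorial : ℂ) * u ^ (j + 1)) (borelKernel r u) :=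
  (Summable.of_norm_bounded ((hasSum_pow_succ_div_factorial (B * ‖u‖)).summable.mul_left _)
    fun j => norm_borelKernel_term_le hB hr j u).hasSum

theorem norm_borelKernel_le {r : ℕ → ℂ} {M B : ℝ} (hM : 0 ≤ M) (hB : 0 < B)
    (hr : ∀ j, ‖r j‖ ≤ M * B ^ j) (u : ℂ) :
    ‖borelKernel r u‖ ≤ M / B * Real.exp (B * ‖u‖) := by
  refine (tsum_of_norm_bounded ((hasSum_pow_succ_div_factorial (B * ‖u‖)).mul_left (M / B))
    fun j => norm_borelKernel_term_le hB hr j u).trans ?_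
  have : 0 ≤ M / B := by positivity
  nlinarith

theorem differentiable_borelKernel {r : ℕ → ℂ} {M B : ℝ} (hM : 0 ≤ M) (hB : 0 < B)
    (hr : ∀ j, ‖r j‖ ≤ M * B ^ j) : Differentiable ℂ (borelKernel r) := by
  intro u
  have hd := Complex.differentiableOn_tsum_of_summable_norm
    (F := fun j u => r j / ((j + 1).factorial : ℂ) * u ^ (j + 1))
    (((hasSum_pow_succ_div_factorial (B * (‖u‖ + 1))).summable).mul_left (M / B))
    (fun j => (Differentiable.differentiableOn (by fun_prop)))
    (Metric.isOpen_ball (x := (0 : ℂ)) (ε := ‖u‖ + 1)) (fun j w hw => ?_)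
  · exact hd.differentiableAt (Metric.isOpen_ball.mem_nhds (by simp))
  · refine (norm_borelKernel_term_le hB hr j w).trans ?_
    have : ‖w‖ ≤ ‖u‖ + 1 := by simpa using (Metric.mem_ball.1 hw).le
    gcongr

theorem borelKernel_zero (r : ℕ → ℂ) : borelKernel r 0 = 0 := by
  simp [borelKernel]

/-! ### Polynomial bounds -/

theorem Polynomial.exists_norm_eval_le (q : Polynomial ℂ) :
    ∃ C : ℝ, 0 ≤ C ∧ ∀ w : ℂ, ‖q.eval w‖ ≤ C * (1 + ‖w‖) ^ q.natDegree := by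
  refine ⟨∑ i ∈ Finset.range (q.natDegree + 1), ‖q.coeff i‖, by positivity, fun w => ?_⟩
  rw [Polynomial.eval_eq_sum_range, Finset.sum_mul]
  refine (norm_sum_le _ _).trans (Finset.sum_le_sum fun i hi => ?_)
  rw [norm_mul, norm_pow]
  have hi' : i ≤ q.natDegree := by simpa [Nat.lt_succ_iff] using hi
  gcongr
  calc ‖w‖ ^ i ≤ (1 + ‖w‖) ^ i := by gcongr; linarith
    _ ≤ _ := pow_le_pow_right₀ (by linarith [norm_nonneg w]) hi'

/-- Induction on the degree, splitting off a root `β`. Its distance to the closed set `V` is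
positive, so `|u - β|` dominates a multiple of `1 + |u|` on `V`. -/
theorem Polynomial.exists_le_norm_eval {V : Set ℂ} (hV : IsClosed V) (n : ℕ) :
    ∀ q : Polynomial ℂ, q.natDegree = n → (∀ u ∈ V, q.eval u ≠ 0) →
      ∃ c : ℝ, 0 < c ∧ ∀ u ∈ V, c * (1 + ‖u‖) ^ n ≤ ‖q.eval u‖ := by
  rcases V.eq_empty_or_nonempty with rfl | hVn
  · exact fun q _ _ => ⟨1, one_pos, by simp⟩
  induction n with
  | zero =>
    intro q hq hqV
    obtain ⟨a, rfl⟩ := Polynomial.natDegree_eq_zero.1 hq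
    obtain ⟨v, hv⟩ := hVn
    have ha : a ≠ 0 := by simpa using hqV v hv
    exact ⟨‖a‖, norm_pos_iff.2 ha, by simp⟩
  | succ n ih =>
    intro q hq hqV
    obtain ⟨β, hβ⟩ := IsAlgClosed.exists_root q (fun h => by
      rw [Polynomial.natDegree_eq_zero_iff_degree_le_zero.2 h.le] at hq
      omega)
    have hfac := Polynomial.mul_divByMonic_eq_iff_isRoot.2 hβ
    set q' := q /ₘ (Polynomial.X - Polynomial.C β)
    have heval : ∀ u, q.eval u = (u - β) * q'.eval u := fun u => by
      conv_lhs => rw [← hfac]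
      simp
    have hdeg : q'.natDegree = n := by
      rw [Polynomial.natDegree_divByMonic _ (Polynomial.monic_X_sub_C β), hq,
        Polynomial.natDegree_X_sub_C]
      rfl
    obtain ⟨c, hc, hcV⟩ := ih q' hdeg fun u hu h0 => hqV u hu (by rw [heval, h0, mul_zero])
    have hβV : β ∉ V := fun h => hqV β h hβ
    have hδ : 0 < Metric.infDist β V := (hV.notMem_iff_infDist_pos hVn).1 hβV
    set δ := Metric.infDist β V
    have hk : 0 < (1 + ‖β‖) / δ + 1 := by positivity
    refine ⟨((1 + ‖β‖) / δ + 1)⁻¹ * c, by positivity, fun u hu => ?_⟩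
    have h1 : δ ≤ ‖u - β‖ := by
      rw [← dist_eq_norm, dist_comm]
      exact Metric.infDist_le_dist_of_mem hu
    have h2 : 1 + ‖u‖ ≤ ((1 + ‖β‖) / δ + 1) * ‖u - β‖ := by
      have h3 : ‖u‖ ≤ ‖β‖ + ‖u - β‖ := by simpa using norm_add_le β (u - β)
      have h4 : 1 + ‖β‖ ≤ (1 + ‖β‖) / δ * ‖u - β‖ := by
        rw [div_mul_eq_mul_div, le_div_iff₀ hδ]
        gcongr
      linarith
    rw [heval, norm_mul, pow_succ]
    calc ((1 + ‖β‖) / δ + 1)⁻¹ * c * ((1 + ‖u‖) ^ n * (1 + ‖u‖))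
        = (((1 + ‖β‖) / δ + 1)⁻¹ * (1 + ‖u‖)) * (c * (1 + ‖u‖) ^ n) := by ring
      _ ≤ ‖u - β‖ * ‖q'.eval u‖ := by
        refine mul_le_mul ?_ (hcV u hu) (by positivity) (norm_nonneg _)
        rw [inv_mul_le_iff₀ hk]
        exact h2

/-! ### Sectors -/

/-- As the image of a horizontal strip under the open map `exp`, the sector is open whatever its
opening; the same coordinate serves later for rotating the contour. -/
theorem openSector_zero_eq (θ₁ θ₂ : ℝ) :
    openSector 0 θ₁ θ₂ = Complex.exp '' {w | w.im ∈ Ioo θ₁ θ₂} := by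
  ext ζ
  constructor
  · rintro ⟨r, hr, θ, hθ, rfl⟩
    refine ⟨Real.log r + θ * Complex.I, by simpa using hθ, ?_⟩
    rw [Complex.exp_add, ← Complex.ofReal_exp, Real.exp_log hr, zero_add]
  · rintro ⟨w, hw, rfl⟩
    refine ⟨Real.exp w.re, Real.exp_pos _, w.im, hw, ?_⟩
    rw [Complex.ofReal_exp, ← Complex.exp_add, Complex.re_add_im, zero_add]

theorem isOpen_openSector_zero (θ₁ θ₂ : ℝ) : IsOpen (openSector 0 θ₁ θ₂) := by
  rw [openSector_zero_eq]
  exact Complex.isOpenMap_exp _ (isOpen_Ioo.preimage Complex.continuous_im)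

theorem ofReal_mul_mem_openSector_zero {θ₁ θ₂ t : ℝ} {u : ℂ} (ht : 0 < t)
    (hu : u ∈ openSector 0 θ₁ θ₂) : (t : ℂ) * u ∈ openSector 0 θ₁ θ₂ := by
  obtain ⟨r, hr, θ, hθ, rfl⟩ := hu
  exact ⟨t * r, mul_pos ht hr, θ, hθ, by push_cast; ring⟩

theorem add_mem_closure_openSector {α u : ℂ} {θ₁ θ₂ : ℝ}
    (hu : u ∈ closure (openSector 0 θ₁ θ₂)) : α + u ∈ closure (openSector α θ₁ θ₂) := by
  refine map_mem_closure (f := fun u => α + u) (by fun_prop) hu ?_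
  rintro v ⟨r, hr, θ, hθ, rfl⟩
  exact ⟨r, hr, θ, hθ, by ring⟩

/-! ### The Volterra equation of the differential equation -/

/-- The polynomial `P(-α - u) / u` of `u`. -/
noncomputable def leadCoeffFn (P : Polynomial ℂ) (α u : ℂ) : ℂ :=
  -(P /ₘ (Polynomial.X - Polynomial.C (-α))).eval (-α - u)

/-- The kernel `Q(-α - t u) + k((1 - t) u)`, where `k` is the Borel transform of
`z⁻² ∑ r_j z⁻ʲ`. -/
noncomputable def volterraKernel (Q : Polynomial ℂ) (α : ℂ) (r : ℕ → ℂ) (t : ℝ) (u : ℂ) : ℂ :=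
  Q.eval (-α - t * u) + borelKernel r ((1 - t : ℝ) * u)

theorem mul_leadCoeffFn {P : Polynomial ℂ} {α : ℂ} (hα : P.IsRoot (-α)) (u : ℂ) :
    u * leadCoeffFn P α u = P.eval (-α - u) := by
  have h := congrArg (Polynomial.eval (-α - u)) (Polynomial.mul_divByMonic_eq_iff_isRoot.2 hα)
  rw [← h, leadCoeffFn, Polynomial.eval_mul, Polynomial.eval_sub, Polynomial.eval_X,
    Polynomial.eval_C]
  ring

theorem leadCoeffFn_zero {P : Polynomial ℂ} {α : ℂ} (hα : P.IsRoot (-α)) :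
    leadCoeffFn P α 0 = -P.derivative.eval (-α) := by
  have h := congrArg (fun q => (Polynomial.derivative q).eval (-α))
    (Polynomial.mul_divByMonic_eq_iff_isRoot.2 hα)
  rw [leadCoeffFn, ← h]
  simp

theorem derivative_eval_ne_zero {P : Polynomial ℂ} (hP : P ≠ 0) (hroots : P.roots.Nodup)
    {x : ℂ} (hx : P.IsRoot x) : P.derivative.eval x ≠ 0 := by
  intro h
  have h1 := (Polynomial.one_lt_rootMultiplicity_iff_isRoot hP).2 ⟨hx, h⟩
  rw [← Polynomial.count_roots] at h1
  have := Multiset.nodup_iff_count_le_one.1 hroots x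
  omega

/-- `U` is the sector together with a small ball, so that solutions are holomorphic at the tip. The
polynomial `p` has the degree of `Q` and no zeros on the closure of `U`, so `|p|` is at least a
multiple of `(1 + |u|)^{deg Q}`. This bounds `Q/p`, and the remaining part of the kernel contributes
the exponential weight. -/
theorem exists_isRegularSingular {P Q : Polynomial ℂ} (hP : P.Monic) (hProots : P.roots.Nodup)
    (hQdeg : Q.natDegree + 1 = P.natDegree) {α : ℂ} (hα : P.IsRoot (-α))
    (hτ : 0 < (tauExp P Q α).re) {θ₁ θ₂ : ℝ}
    (hsector : ∀ β ∈ closure (openSector α θ₁ θ₂), P.IsRoot (-β) → β = α)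
    {r : ℕ → ℂ} {M B : ℝ} (hM : 0 ≤ M) (hB : 0 < B) (hr : ∀ j, ‖r j‖ ≤ M * B ^ j) :
    ∃ U : Set ℂ, openSector 0 θ₁ θ₂ ⊆ U ∧
      IsRegularSingular U (leadCoeffFn P α) (volterraKernel Q α r) (tauExp P Q α) := by
  have hP' := derivative_eval_ne_zero hP.ne_zero hProots hα
  have hkd := differentiable_borelKernel hM hB hr
  have hkb := norm_borelKernel_le hM hB hr
  set q : Polynomial ℂ := (P /ₘ (Polynomial.X - Polynomial.C (-α))).comp
    (Polynomial.C (-α) - Polynomial.X) with hq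
  have hqe : ∀ u, leadCoeffFn P α u = -q.eval u := fun u => by
    simp [leadCoeffFn, hq, Polynomial.eval_comp]
  have hqn : ∀ u, ‖leadCoeffFn P α u‖ = ‖q.eval u‖ := fun u => by rw [hqe, norm_neg]
  have hqdeg : q.natDegree = Q.natDegree := by
    have h1 : (Polynomial.C (-α) - Polynomial.X : Polynomial ℂ).natDegree = 1 := by
      rw [Polynomial.natDegree_sub_eq_right_of_natDegree_lt (by simp), Polynomial.natDegree_X]
    rw [hq, Polynomial.natDegree_comp, h1,
      Polynomial.natDegree_divByMonic _ (Polynomial.monic_X_sub_C _), Polynomial.natDegree_X_sub_C]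
    omega
  have hq0 : q.eval 0 ≠ 0 := by
    have := hqe 0
    rw [leadCoeffFn_zero hα, neg_inj] at this
    rwa [← this]
  obtain ⟨ε, hε, hεq⟩ : ∃ ε > 0, ∀ u ∈ Metric.closedBall (0 : ℂ) ε, q.eval u ≠ 0 :=
    Metric.nhds_basis_closedBall.eventually_iff.1 (q.continuous.continuousAt.eventually_ne hq0)
  obtain ⟨c, hc, hcV⟩ := Polynomial.exists_le_norm_eval
    (V := Metric.closedBall 0 ε ∪ closure (openSector 0 θ₁ θ₂))
    (Metric.isClosed_closedBall.union isClosed_closure) Q.natDegree q hqdeg (by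
      rintro u (hu | hu)
      · exact hεq u hu
      -- A zero `u` of `q` in the closed sector makes `α + u` a root of `P(-ζ)`, so `u = 0`; but `q`
      -- does not vanish there because the root is simple.
      · intro h0
        have hroot : P.IsRoot (-(α + u)) := by
          rw [Polynomial.IsRoot.def, neg_add', ← mul_leadCoeffFn hα, hqe, h0]
          simp
        have := hsector _ (add_mem_closure_openSector hu) hroot
        rw [add_eq_left] at this
        exact hq0 (this ▸ h0))
  obtain ⟨CQ, hCQ, hQb⟩ := Q.exists_norm_eval_le
  set D := CQ * (1 + ‖α‖) ^ Q.natDegree with hD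
  have hD0 : 0 ≤ D := by positivity
  have hQb' : ∀ t ∈ Icc (0 : ℝ) 1, ∀ u : ℂ,
      ‖Q.eval (-α - t * u)‖ ≤ D * (1 + ‖u‖) ^ Q.natDegree := by
    intro t ht u
    refine (hQb _).trans ?_
    rw [hD, mul_assoc, ← mul_pow]
    gcongr
    have h1 : ‖(-α - t * u)‖ ≤ ‖α‖ + ‖u‖ := by
      refine (norm_sub_le _ _).trans ?_
      rw [norm_neg, norm_mul, Complex.norm_real, Real.norm_of_nonneg ht.1]
      linarith [mul_le_of_le_one_left (norm_nonneg u) ht.2]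
    nlinarith [norm_nonneg u, norm_nonneg α]
  have hkn : ∀ t ∈ Icc (0 : ℝ) 1, ∀ u : ℂ,
      ‖borelKernel r ((1 - t : ℝ) * u)‖ ≤ M / B * Real.exp (B * ((1 - t) * ‖u‖)) := by
    intro t ht u
    have := hkb ((1 - t : ℝ) * u)
    rwa [norm_mul, Complex.norm_real, Real.norm_of_nonneg (by linarith [ht.2])] at this
  have hMB : 0 ≤ M / B := by positivity
  refine ⟨Metric.ball 0 ε ∪ openSector 0 θ₁ θ₂, subset_union_right, ?_⟩
  have hUV : Metric.ball 0 ε ∪ openSector 0 θ₁ θ₂ ⊆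
      Metric.closedBall 0 ε ∪ closure (openSector 0 θ₁ θ₂) :=
    union_subset_union Metric.ball_subset_closedBall subset_closure
  refine
    { isOpen := Metric.isOpen_ball.union (isOpen_openSector_zero _ _)
      zero_mem := Or.inl (by simpa using hε)
      star := ?_
      differentiable_left := ?_
      expType_left := ?_
      le_norm_left := ⟨c, hc, fun u hu => ?_⟩
      continuous_kernel := ?_
      differentiable_kernel := fun t => ?_
      expType_kernel := ?_
      norm_kernel_le := ?_
      re_pos := hτ
      indicial := fun t => ?_ }
  · rintro u (hu | hu) t ht
    · left
      rw [mem_ball_zero_iff] at hu ⊢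
      rw [norm_mul, Complex.norm_real, Real.norm_of_nonneg ht.1]
      exact (mul_le_of_le_one_left (norm_nonneg _) ht.2).trans_lt hu
    · rcases ht.1.eq_or_lt with rfl | h0
      · left; simpa using hε
      · right; exact ofReal_mul_mem_openSector_zero h0 hu
  · simp only [funext hqe]
    fun_prop
  · rw [funext hqe]
    simpa using expTypeOn_polynomial (-q) univ
  · rw [hqn]
    refine le_trans ?_ (hcV u (hUV hu))
    exact le_mul_of_one_le_right hc.le (one_le_pow₀ (by linarith [norm_nonneg u]))
  · have := hkd.continuous
    unfold Function.uncurry volterraKernel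
    fun_prop
  · unfold volterraKernel
    fun_prop
  · refine ⟨D + M / B, max Q.natDegree B, by positivity, by positivity, fun t ht u => ?_⟩
    refine (norm_add_le _ _).trans ?_
    rw [add_mul]
    refine add_le_add ((hQb' t ht u).trans ?_) ((hkn t ht u).trans ?_)
    · gcongr
      calc (1 + ‖u‖) ^ Q.natDegree ≤ Real.exp ‖u‖ ^ Q.natDegree := by
            gcongr; linarith [Real.add_one_le_exp ‖u‖]
        _ = Real.exp (Q.natDegree * ‖u‖) := by rw [← Real.exp_nat_mul]
        _ ≤ _ := by gcongr; exact le_max_left _ _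
    · have h1 : (1 - t) * ‖u‖ ≤ ‖u‖ :=
        mul_le_of_le_one_left (norm_nonneg _) (by linarith [ht.1])
      have h2 : B ≤ max (Q.natDegree : ℝ) B := le_max_right _ _
      have h3 : 0 ≤ (1 - t) * ‖u‖ := mul_nonneg (by linarith [ht.2]) (norm_nonneg _)
      gcongr
  · refine ⟨D / c + M / B / c, B, by positivity, hB.le, fun t ht u hu => ?_⟩
    have hpu := hcV u (hUV hu)
    rw [← hqn] at hpu
    have hone : 1 ≤ (1 + ‖u‖) ^ Q.natDegree := one_le_pow₀ (by linarith [norm_nonneg u])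
    have hexp : 1 ≤ Real.exp (B * ((1 - t) * ‖u‖)) := by
      refine Real.one_le_exp (mul_nonneg hB.le (mul_nonneg ?_ (norm_nonneg _)))
      linarith [ht.2]
    refine (norm_add_le _ _).trans ?_
    rw [add_mul, add_mul]
    refine add_le_add ((hQb' t ht u).trans ?_) ((hkn t ht u).trans ?_)
    · calc D * (1 + ‖u‖) ^ Q.natDegree = D / c * (c * (1 + ‖u‖) ^ Q.natDegree) * 1 := by
            field_simp
        _ ≤ _ := by gcongr
    · gcongr
      calc M / B = M / B / c * (c * 1) := by field_simp
        _ ≤ M / B / c * ‖leadCoeffFn P α u‖ := by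
          gcongr
          exact le_trans (by gcongr) hpu
  · rw [leadCoeffFn_zero hα, tauExp]
    simp [volterraKernel, borelKernel_zero]
    field_simp

/-! ### Local power series expansions -/

/-- `g` is the sum of the power series `G` near `0`. -/
def HasLocalExpansion (G : ℂ⟦X⟧) (g : ℂ → ℂ) : Prop :=
  ∃ r : ℝ, 0 < r ∧ ∀ u : ℂ, ‖u‖ < r → HasSum (fun n => PowerSeries.coeff n G * u ^ n) (g u)

namespace HasLocalExpansion

variable {G H : ℂ⟦X⟧} {g h : ℂ → ℂ}

theorem add (hG : HasLocalExpansion G g) (hH : HasLocalExpansion H h) :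
    HasLocalExpansion (G + H) (fun u => g u + h u) := by
  obtain ⟨r, hr, h1⟩ := hG
  obtain ⟨r', hr', h2⟩ := hH
  refine ⟨min r r', lt_min hr hr', fun u hu => ?_⟩
  have := (h1 u (hu.trans_le (min_le_left _ _))).add (h2 u (hu.trans_le (min_le_right _ _)))
  exact this.congr_fun fun n => by rw [map_add, add_mul]

theorem mul (hG : HasLocalExpansion G g) (hH : HasLocalExpansion H h) :
    HasLocalExpansion (G * H) (fun u => g u * h u) := by
  obtain ⟨r, hr, h1⟩ := hG
  obtain ⟨r', hr', h2⟩ := hH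
  refine ⟨min r r', lt_min hr hr', fun u hu => ?_⟩
  have s1 := h1 u (hu.trans_le (min_le_left _ _))
  have s2 := h2 u (hu.trans_le (min_le_right _ _))
  have n1 := s1.summable.norm
  have n2 := s2.summable.norm
  have h3 := (summable_norm_sum_mul_antidiagonal_of_summable_norm n1 n2).of_norm.hasSum
  rw [← tsum_mul_tsum_eq_tsum_sum_antidiagonal_of_summable_norm n1 n2, s1.tsum_eq,
    s2.tsum_eq] at h3
  refine h3.congr_fun fun n => ?_
  rw [PowerSeries.coeff_mul, Finset.sum_mul]
  refine Finset.sum_congr rfl fun x hx => ?_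
  rw [← Finset.HasAntidiagonal.mem_antidiagonal.1 hx, pow_add]
  ring

theorem congr (hG : HasLocalExpansion G g) (hgh : g =ᶠ[𝓝 0] h) : HasLocalExpansion G h := by
  obtain ⟨r, hr, h1⟩ := hG
  obtain ⟨ε, hε, h2⟩ := Metric.eventually_nhds_iff.1 hgh
  refine ⟨min r ε, lt_min hr hε, fun u hu => ?_⟩
  rw [← h2 (by simpa using hu.trans_le (min_le_right _ _))]
  exact h1 u (hu.trans_le (min_le_left _ _))

theorem hasFPowerSeriesAt (hG : HasLocalExpansion G g) :
    HasFPowerSeriesAt g (FormalMultilinearSeries.ofScalars ℂ fun n => PowerSeries.coeff n G) 0 := by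
  obtain ⟨r, hr, h1⟩ := hG
  rw [hasFPowerSeriesAt_iff]
  refine Metric.eventually_nhds_iff.2 ⟨r, hr, fun u hu => ?_⟩
  rw [zero_add]
  exact (h1 u (by simpa using hu)).congr_fun fun n => by
    simp [FormalMultilinearSeries.coeff_ofScalars, mul_comm]

theorem eq_zero (hG : HasLocalExpansion G fun _ => 0) : G = 0 := by
  have h := hG.hasFPowerSeriesAt.eq_zero
  ext n
  rw [map_zero, ← FormalMultilinearSeries.coeff_ofScalars (𝕜 := ℂ)
    (p := fun n => PowerSeries.coeff n G), h]
  rfl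

theorem coeff_zero (hG : HasLocalExpansion G g) : PowerSeries.coeff 0 G = g 0 := by
  obtain ⟨r, hr, h1⟩ := hG
  have := (h1 0 (by simpa using hr)).unique (hasSum_single 0 fun n hn => by simp [hn])
  simpa using this.symm

end HasLocalExpansion

theorem hasLocalExpansion_polynomial (q : Polynomial ℂ) :
    HasLocalExpansion (q : ℂ⟦X⟧) fun u => q.eval u := by
  refine ⟨1, one_pos, fun u _ => ?_⟩
  simp only [Polynomial.coeff_coe, Polynomial.eval_eq_sum_range]
  refine hasSum_sum_of_ne_finset_zero fun n hn => ?_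
  rw [Polynomial.coeff_eq_zero_of_natDegree_lt, zero_mul]
  simpa using hn

theorem exists_hasLocalExpansion {g : ℂ → ℂ} (hg : AnalyticAt ℂ g 0) :
    ∃ G, HasLocalExpansion G g := by
  obtain ⟨p, hp⟩ := hg
  obtain ⟨r, hr, h⟩ := Metric.eventually_nhds_iff.1 (hasFPowerSeriesAt_iff.1 hp)
  refine ⟨PowerSeries.mk fun n => p.coeff n, r, hr, fun u hu => ?_⟩
  have := h (y := u) (by simpa using hu)
  rw [zero_add] at this
  exact this.congr_fun fun n => by simp [mul_comm]

/-! ### Beta convolutions -/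

/-- The power series of `∫₀¹ t ^ (τ - 1) k((1 - t) u) h(t u) dt`. -/
noncomputable def betaConv (τ : ℂ) (κ : ℂ⟦X⟧) : ℂ⟦X⟧ →ₗ[ℂ] ℂ⟦X⟧ where
  toFun b := PowerSeries.mk fun n => ∑ x ∈ Finset.HasAntidiagonal.antidiagonal n,
    PowerSeries.coeff x.1 κ * PowerSeries.coeff x.2 b * Complex.betaIntegral (τ + x.2) (x.1 + 1)
  map_add' b b' := by
    ext n
    simp only [map_add, PowerSeries.coeff_mk, ← Finset.sum_add_distrib]
    exact Finset.sum_congr rfl fun x _ => by ring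
  map_smul' c b := by
    ext n
    simp only [PowerSeries.coeff_mk, RingHom.id_apply, map_smul, smul_eq_mul, Finset.mul_sum]
    exact Finset.sum_congr rfl fun x _ => by ring

theorem coeff_betaConv (τ : ℂ) (κ b : ℂ⟦X⟧) (n : ℕ) :
    PowerSeries.coeff n (betaConv τ κ b) = ∑ x ∈ Finset.HasAntidiagonal.antidiagonal n,
      PowerSeries.coeff x.1 κ * PowerSeries.coeff x.2 b *
        Complex.betaIntegral (τ + x.2) (x.1 + 1) := by
  simp [betaConv]

theorem integral_cpow_mul_pow {τ : ℂ} (i m : ℕ) :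
    ∫ t in (0 : ℝ)..1, (t : ℂ) ^ (τ - 1) * ((1 - t : ℝ) ^ i * (t : ℂ) ^ m) =
      Complex.betaIntegral (τ + m) (i + 1) := by
  refine intervalIntegral.integral_congr_ae (Eventually.of_forall fun t ht => ?_)
  rw [uIoc_of_le zero_le_one] at ht
  have ht0 : (t : ℂ) ≠ 0 := Complex.ofReal_ne_zero.2 ht.1.ne'
  have h1 : (t : ℂ) ^ (τ + m - 1) = (t : ℂ) ^ (τ - 1) * (t : ℂ) ^ m := by
    rw [← Complex.cpow_natCast, ← Complex.cpow_add _ _ ht0]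
    congr 1; ring
  rw [h1, add_sub_cancel_right, Complex.cpow_natCast]
  push_cast
  ring

/-- Expand `k((1-t)u) h(tu)` as a Cauchy product, which is dominated uniformly in `t` by its
absolute version at `u`. Integrating term by term gives Beta integrals. -/
theorem HasLocalExpansion.betaConv {τ : ℂ} (hτ : 0 < τ.re) {κ b : ℂ⟦X⟧} {k h : ℂ → ℂ}
    (hκ : HasLocalExpansion κ k) (hb : HasLocalExpansion b h) :
    HasLocalExpansion (betaConv τ κ b)
      (volterraOp (fun t u => k ((1 - t : ℝ) * u)) τ h) := by
  obtain ⟨r, hr, h1⟩ := hκ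
  obtain ⟨r', hr', h2⟩ := hb
  refine ⟨min r r', lt_min hr hr', fun u hu => ?_⟩
  have s1 := h1 u (hu.trans_le (min_le_left _ _))
  have s2 := h2 u (hu.trans_le (min_le_right _ _))
  have hterm : ∀ (G : ℂ⟦X⟧) (c : ℝ), c ∈ Icc (0 : ℝ) 1 → ∀ n,
      ‖PowerSeries.coeff n G * ((c : ℂ) * u) ^ n‖ ≤ ‖PowerSeries.coeff n G * u ^ n‖ := by
    intro G c hc n
    rw [norm_mul, norm_mul, norm_pow, norm_pow, norm_mul, Complex.norm_real,
      Real.norm_of_nonneg hc.1]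
    gcongr
    · exact mul_nonneg hc.1 (norm_nonneg _)
    · exact mul_le_of_le_one_left (norm_nonneg u) hc.2
  have hflip : ∀ {t : ℝ}, t ∈ Icc (0 : ℝ) 1 → 1 - t ∈ Icc (0 : ℝ) 1 := fun ht =>
    ⟨by linarith [ht.2], by linarith [ht.1]⟩
  have key := hasSum_integral_cpow_mul hτ
    (g := fun n t => ∑ x ∈ Finset.HasAntidiagonal.antidiagonal n,
      (PowerSeries.coeff x.1 κ * (((1 - t : ℝ) : ℂ) * u) ^ x.1) *
        (PowerSeries.coeff x.2 b * ((t : ℂ) * u) ^ x.2))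
    (M := fun n => ∑ x ∈ Finset.HasAntidiagonal.antidiagonal n,
      ‖PowerSeries.coeff x.1 κ * u ^ x.1‖ * ‖PowerSeries.coeff x.2 b * u ^ x.2‖)
    (fun n => Continuous.continuousOn (by fun_prop))
    (fun n t ht => ?_)
    (summable_norm_sum_mul_antidiagonal_of_summable_norm s1.summable.norm.norm
      s2.summable.norm.norm).of_norm
  · convert key using 1
    · ext n
      simp only [Finset.mul_sum]
      rw [intervalIntegral.integral_finsetSum, coeff_betaConv, Finset.sum_mul]
      · refine Finset.sum_congr rfl fun x hx => ?_
        rw [← integral_cpow_mul_pow, ← Finset.HasAntidiagonal.mem_antidiagonal.1 hx, mul_right_comm,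
          ← intervalIntegral.integral_const_mul]
        congr 1; ext t
        simp only [mul_pow, pow_add]
        ring
      · exact fun x _ => intervalIntegrable_cpow_mul hτ (Continuous.continuousOn (by fun_prop))
    · unfold volterraOp
      refine intervalIntegral.integral_congr fun t ht => ?_
      rw [uIcc_of_le zero_le_one] at ht
      simp only
      have hle : ∀ {c : ℝ}, c ∈ Icc (0 : ℝ) 1 → ‖(c : ℂ) * u‖ < min r r' := fun {c} hc => by
        rw [norm_mul, Complex.norm_real, Real.norm_of_nonneg hc.1]
        exact (mul_le_of_le_one_left (norm_nonneg _) hc.2).trans_lt hu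
      have e1 := h1 _ ((hle (hflip ht)).trans_le (min_le_left _ _))
      have e2 := h2 _ ((hle ht).trans_le (min_le_right _ _))
      rw [← tsum_mul_tsum_eq_tsum_sum_antidiagonal_of_summable_norm e1.summable.norm
        e2.summable.norm, e1.tsum_eq, e2.tsum_eq]
  · refine (norm_sum_le _ _).trans (Finset.sum_le_sum fun x _ => ?_)
    rw [norm_mul]
    exact mul_le_mul (hterm κ _ (hflip ht) _) (hterm b _ ht _) (norm_nonneg _) (norm_nonneg _)

/-! ### The Borel transform of formal solutions -/

/-- The power series with coefficients `borelCoeff`. -/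
noncomputable def borelPS (τ : ℂ) (F : ℂ⟦X⟧) : ℂ⟦X⟧ := PowerSeries.mk (borelCoeff τ F)

theorem coeff_borelPS (τ : ℂ) (F : ℂ⟦X⟧) (n : ℕ) :
    PowerSeries.coeff n (borelPS τ F) = PowerSeries.coeff n F / Complex.Gamma (τ + n) := by
  simp [borelPS, borelCoeff]

theorem borelPS_add (τ : ℂ) (F G : ℂ⟦X⟧) : borelPS τ (F + G) = borelPS τ F + borelPS τ G := by
  ext n
  simp [coeff_borelPS, add_div]

theorem borelPS_smul (τ c : ℂ) (F : ℂ⟦X⟧) : borelPS τ (c • F) = c • borelPS τ F := by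
  ext n
  simp [coeff_borelPS, mul_div_assoc]

theorem Gamma_add_natCast_ne_zero {τ : ℂ} (hτ : 0 < τ.re) (n : ℕ) : Complex.Gamma (τ + n) ≠ 0 :=
  Complex.Gamma_ne_zero_of_re_pos (by simp only [Complex.add_re, Complex.natCast_re]; positivity)

theorem Gamma_add_natCast_succ {τ : ℂ} (hτ : 0 < τ.re) (n : ℕ) :
    Complex.Gamma (τ + (n + 1 : ℕ)) = (τ + n) * Complex.Gamma (τ + n) := by
  rw [Nat.cast_succ, ← add_assoc, Complex.Gamma_add_one]
  intro h
  have : (τ + n).re = 0 := by rw [h]; rfl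
  simp only [Complex.add_re, Complex.natCast_re] at this
  linarith [n.cast_nonneg (α := ℝ)]

/-- The factor `τ + n` produced by differentiating `z^{-τ-n}` is absorbed by `Γ(τ+n+1) = (τ+n)
Γ(τ+n)`. What remains is multiplication by `-ζ = -α - u`. -/
theorem borelPS_transDeriv {τ : ℂ} (hτ : 0 < τ.re) (α : ℂ) (F : ℂ⟦X⟧) :
    borelPS τ (transDeriv α τ F) =
      ((-Polynomial.C α - Polynomial.X : Polynomial ℂ) : ℂ⟦X⟧) * borelPS τ F := by
  have hcoe : ((-Polynomial.C α - Polynomial.X : Polynomial ℂ) : ℂ⟦X⟧) =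
      -(PowerSeries.C α) - PowerSeries.X := by
    simp
  rw [hcoe, sub_mul, neg_mul]
  ext n
  have hdef : transDeriv α τ F = -(α • F) - τ • (PowerSeries.X * F)
      - PowerSeries.X ^ 2 * PowerSeries.derivative ℂ F := rfl
  rw [coeff_borelPS, hdef]
  cases n with
  | zero =>
    have h0 := coeff_borelPS τ F 0
    simp only [Nat.cast_zero, add_zero, PowerSeries.coeff_zero_eq_constantCoeff] at h0
    simp [pow_two, mul_assoc, h0, neg_div, mul_div_assoc]
  | succ n =>
    have h1 : PowerSeries.coeff (n + 1) (PowerSeries.X ^ 2 * PowerSeries.derivative ℂ F) =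
        n * PowerSeries.coeff n F := by
      rw [pow_two, mul_assoc, PowerSeries.coeff_succ_X_mul]
      cases n with
      | zero => simp
      | succ n =>
        rw [PowerSeries.coeff_succ_X_mul, PowerSeries.coeff_derivative]
        push_cast; ring
    have hG := Gamma_add_natCast_ne_zero hτ n
    have hG1 := Gamma_add_natCast_ne_zero hτ (n + 1)
    have hG2 := hG1
    rw [Gamma_add_natCast_succ hτ] at hG1
    have hn : τ + n ≠ 0 := left_ne_zero_of_mul hG1
    simp only [map_sub, map_neg, PowerSeries.coeff_smul, smul_eq_mul, h1,
      PowerSeries.coeff_succ_X_mul, coeff_borelPS, PowerSeries.coeff_C_mul]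
    have e : PowerSeries.coeff n F / Complex.Gamma (τ + n) =
        (τ + n) * PowerSeries.coeff n F / Complex.Gamma (τ + (n + 1 : ℕ)) := by
      rw [Gamma_add_natCast_succ hτ]
      field_simp
    rw [e]
    field_simp
    ring

theorem borelPS_aeval_transDeriv {τ : ℂ} (hτ : 0 < τ.re) (α : ℂ) (q : Polynomial ℂ) (F : ℂ⟦X⟧) :
    borelPS τ (Polynomial.aeval (transDeriv α τ) q F) =
      ((q.comp (-Polynomial.C α - Polynomial.X) : Polynomial ℂ) : ℂ⟦X⟧) * borelPS τ F := by
  induction q using Polynomial.induction_on' with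
  | add p q hp hq =>
    rw [map_add, LinearMap.add_apply, borelPS_add, hp, hq, Polynomial.add_comp, Polynomial.coe_add,
      add_mul]
  | monomial n a =>
    rw [Polynomial.aeval_monomial, Polynomial.monomial_comp, Polynomial.coe_mul, Polynomial.coe_pow,
      Polynomial.coe_C]
    have h1 : ∀ n : ℕ, borelPS τ ((transDeriv α τ ^ n) F) =
        ((-Polynomial.C α - Polynomial.X : Polynomial ℂ) : ℂ⟦X⟧) ^ n * borelPS τ F := by
      intro n
      induction n with
      | zero => simp
      | succ n ih =>
        rw [pow_succ', Module.End.mul_apply, borelPS_transDeriv hτ, ih]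
        ring
    rw [Module.End.mul_apply, Module.algebraMap_end_apply, borelPS_smul, h1,
      PowerSeries.smul_eq_C_mul]
    ring

/-- Products in `z⁻¹` become convolutions; on coefficients this is `Γ(τ+m) i! = Γ(τ+m+i+1) B(τ+m,
i+1)`. The leading `X` on the right is the power of `u` left over when the convolution over `[0,u]`
is rescaled to `[0,1]`. -/
theorem borelPS_X_mul_mul {τ : ℂ} (hτ : 0 < τ.re) (κ F : ℂ⟦X⟧) :
    borelPS τ (PowerSeries.X * (κ * F)) = PowerSeries.X * betaConv τ
      (PowerSeries.mk fun i => PowerSeries.coeff i κ / (i.factorial : ℂ)) (borelPS τ F) := by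
  ext n
  cases n with
  | zero => simp [coeff_borelPS]
  | succ n =>
    rw [coeff_borelPS, PowerSeries.coeff_succ_X_mul, PowerSeries.coeff_succ_X_mul, coeff_betaConv,
      PowerSeries.coeff_mul, Finset.sum_div]
    refine Finset.sum_congr rfl fun x hx => ?_
    have hm : 0 < (τ + x.2).re := by
      simp only [Complex.add_re, Complex.natCast_re]; positivity
    have hi : 0 < ((x.1 : ℂ) + 1).re := by
      simp only [Complex.add_re, Complex.natCast_re, Complex.one_re]; positivity
    have hbeta := Complex.Gamma_mul_Gamma_eq_betaIntegral hm hi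
    have hn : τ + x.2 + ((x.1 : ℂ) + 1) = τ + (n + 1 : ℕ) := by
      rw [← Finset.HasAntidiagonal.mem_antidiagonal.1 hx]; push_cast; ring
    rw [hn, Complex.Gamma_nat_eq_factorial] at hbeta
    have hG := Gamma_add_natCast_ne_zero hτ x.2
    have hG1 := Gamma_add_natCast_ne_zero hτ (n + 1)
    have hf : (x.1.factorial : ℂ) ≠ 0 := Nat.cast_ne_zero.2 (Nat.factorial_ne_zero _)
    rw [PowerSeries.coeff_mk, coeff_borelPS]
    field_simp
    linear_combination (PowerSeries.coeff x.1 κ * PowerSeries.coeff x.2 F) * hbeta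

/-- The Volterra operator on power series. -/
noncomputable def formalVolterra (P Q : Polynomial ℂ) (α τ : ℂ) (ρ : ℂ⟦X⟧) (b : ℂ⟦X⟧) : ℂ⟦X⟧ :=
  ((-(P /ₘ (Polynomial.X - Polynomial.C (-α))).comp (-Polynomial.C α - Polynomial.X) :
      Polynomial ℂ) : ℂ⟦X⟧) * b
    + betaConv τ 1 (((Q.comp (-Polynomial.C α - Polynomial.X) : Polynomial ℂ) : ℂ⟦X⟧) * b)
    + betaConv τ (PowerSeries.mk fun i =>
        PowerSeries.coeff i (PowerSeries.X * ρ) / (i.factorial : ℂ)) b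

theorem formalVolterra_sub_smul (P Q : Polynomial ℂ) (α τ : ℂ) (ρ b b' : ℂ⟦X⟧) (c : ℂ) :
    formalVolterra P Q α τ ρ (b - c • b') =
      formalVolterra P Q α τ ρ b - c • formalVolterra P Q α τ ρ b' := by
  simp only [formalVolterra, mul_sub, mul_smul_comm, map_sub, map_smul, smul_add]
  abel

theorem borelPS_formalLevelOneOp {P Q : Polynomial ℂ} (R : ℂ → ℂ) {α τ : ℂ} (hτ : 0 < τ.re)
    (hα : P.IsRoot (-α)) (F : ℂ⟦X⟧) :
    borelPS τ (formalLevelOneOp P Q R α τ F) =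
      PowerSeries.X * formalVolterra P Q α τ (taylorPS R) (borelPS τ F) := by
  have hP : (P.comp (-Polynomial.C α - Polynomial.X)) = Polynomial.X *
      (-(P /ₘ (Polynomial.X - Polynomial.C (-α))).comp (-Polynomial.C α - Polynomial.X)) := by
    conv_lhs => rw [← Polynomial.mul_divByMonic_eq_iff_isRoot.2 hα]
    rw [Polynomial.mul_comp, Polynomial.sub_comp, Polynomial.X_comp, Polynomial.C_comp,
      Polynomial.C_neg]
    ring
  have h1 : (PowerSeries.mk fun i => PowerSeries.coeff i (1 : ℂ⟦X⟧) / (i.factorial : ℂ)) =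
      (1 : ℂ⟦X⟧) := by
    ext n
    rw [PowerSeries.coeff_mk, PowerSeries.coeff_one]
    split_ifs with h
    · simp [h]
    · simp
  have hQ := borelPS_X_mul_mul hτ 1 (Polynomial.aeval (transDeriv α τ) Q F)
  rw [one_mul, h1, borelPS_aeval_transDeriv hτ] at hQ
  -- One factor of `X²` is the `X` common to all terms; the other stays in the convolution kernel.
  have hR := borelPS_X_mul_mul hτ (PowerSeries.X * taylorPS R) F
  rw [formalLevelOneOp, borelPS_add, borelPS_add, borelPS_aeval_transDeriv hτ, hP, hQ,
    show PowerSeries.X ^ 2 * taylorPS R * F = PowerSeries.X * (PowerSeries.X * taylorPS R * F) by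
      ring, hR, formalVolterra, Polynomial.coe_mul, Polynomial.coe_X]
  ring

theorem betaIntegral_one_right {s : ℂ} (hs : 0 < s.re) : Complex.betaIntegral s 1 = s⁻¹ := by
  have h := Complex.Gamma_mul_Gamma_eq_betaIntegral hs (t := 1) (by rw [Complex.one_re]; exact one_pos)
  have hs0 : s ≠ 0 := by rintro rfl; simp at hs
  rw [Complex.Gamma_one, mul_one, Complex.Gamma_add_one _ hs0] at h
  have hG := Complex.Gamma_ne_zero_of_re_pos hs
  refine eq_inv_of_mul_eq_one_left ?_
  refine mul_left_cancel₀ hG ?_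
  linear_combination -h

/-- If all coefficients before the `n`-th vanish, order `n` of the equation reads `-P'(-α) · n/(τ+n)
· bₙ = 0`. Only `n = 0` leaves the coefficient free. -/
theorem eq_zero_of_formalVolterra_eq_zero {P Q : Polynomial ℂ} {α : ℂ} (hα : P.IsRoot (-α))
    (hP' : P.derivative.eval (-α) ≠ 0) (hτ : 0 < (tauExp P Q α).re) {ρ b : ℂ⟦X⟧}
    (hb : formalVolterra P Q α (tauExp P Q α) ρ b = 0) (hb0 : PowerSeries.coeff 0 b = 0) :
    b = 0 := by
  set τ := tauExp P Q α with hτdef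
  ext n
  rw [map_zero]
  induction n using Nat.strong_induction_on with
  | _ n ih =>
    rcases Nat.eq_zero_or_pos n with rfl | hn
    · exact hb0
    have hmul : ∀ q : Polynomial ℂ, ∀ m ≤ n, PowerSeries.coeff m ((q : ℂ⟦X⟧) * b) =
        q.coeff 0 * PowerSeries.coeff m b := by
      intro q m hm
      rw [PowerSeries.coeff_mul, Finset.sum_eq_single (0, m)]
      · simp
      · rintro ⟨i, j⟩ hx hne
        have hij := Finset.HasAntidiagonal.mem_antidiagonal.1 hx
        simp only at hij
        rw [ih j (by
          rcases Nat.eq_zero_or_pos i with rfl | hi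
          · exact absurd (by simp at hij; simp [hij]) hne
          · omega), mul_zero]
      · simp
    have hconv : ∀ κ c : ℂ⟦X⟧, (∀ m < n, PowerSeries.coeff m c = 0) →
        PowerSeries.coeff n (betaConv τ κ c) =
          PowerSeries.coeff 0 κ * PowerSeries.coeff n c * (τ + n)⁻¹ := by
      intro κ c hc
      rw [coeff_betaConv, Finset.sum_eq_single (0, n)]
      · simp only [Nat.cast_zero, zero_add]
        rw [betaIntegral_one_right]
        simp only [Complex.add_re, Complex.natCast_re]; positivity
      · rintro ⟨i, j⟩ hx hne
        have hij := Finset.HasAntidiagonal.mem_antidiagonal.1 hx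
        simp only at hij
        rw [hc j (by
          rcases Nat.eq_zero_or_pos i with rfl | hi
          · exact absurd (by simp at hij; simp [hij]) hne
          · omega), mul_zero, zero_mul]
      · simp
    have h := congrArg (PowerSeries.coeff n) hb
    have h0 : ∀ q : Polynomial ℂ, (q.comp (-Polynomial.C α - Polynomial.X)).coeff 0 =
        q.eval (-α) := fun q => by
      rw [Polynomial.coeff_zero_eq_eval_zero, Polynomial.eval_comp]
      simp
    have hlead := leadCoeffFn_zero hα
    rw [leadCoeffFn, sub_zero, neg_inj] at hlead
    rw [formalVolterra, map_add, map_add, hmul _ n le_rfl, hconv, hconv, hmul _ n le_rfl,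
      Polynomial.coeff_neg, h0, h0, hlead, map_zero] at h
    · simp only [PowerSeries.coeff_mk, PowerSeries.coeff_zero_X_mul, zero_div, zero_mul, add_zero,
        PowerSeries.coeff_zero_one, one_mul] at h
      have hτn : τ + n ≠ 0 := by
        intro h0
        have : (τ + n).re = 0 := by rw [h0]; rfl
        simp only [Complex.add_re, Complex.natCast_re] at this
        linarith [n.cast_nonneg (α := ℝ)]
      have hQ : Q.eval (-α) = τ * P.derivative.eval (-α) := by
        rw [hτdef, tauExp]; field_simp
      have h2 : P.derivative.eval (-α) * (n : ℂ) * PowerSeries.coeff n b = 0 := by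
        rw [hQ] at h
        field_simp at h
        linear_combination -h
      have hn0 : (n : ℂ) ≠ 0 := Nat.cast_ne_zero.2 hn.ne'
      simpa [hP', hn0] using h2
    · exact fun m hm => ih m hm
    · intro m hm
      rw [hmul _ m hm.le, ih m hm, mul_zero]

/-- The two summands of the kernel are treated apart: `Q(-α-tu) h(tu)` is the product `Q(-α-v) h(v)`
taken at `v = tu` and convolved with `1`, and the rest is a convolution with `borelKernel`. -/
theorem HasLocalExpansion.formalVolterra {P Q : Polynomial ℂ} {α τ : ℂ} (hτ : 0 < τ.re)
    {ρ : ℂ⟦X⟧} {M B : ℝ} (hB : 0 < B) (hr : ∀ j, ‖PowerSeries.coeff j ρ‖ ≤ M * B ^ j)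
    {b : ℂ⟦X⟧} {h : ℂ → ℂ} (hh : AnalyticAt ℂ h 0) (hb : HasLocalExpansion b h)
    (hk : Continuous (borelKernel fun j => PowerSeries.coeff j ρ)) :
    HasLocalExpansion (formalVolterra P Q α τ ρ b) (fun u => leadCoeffFn P α u * h u +
      volterraOp (volterraKernel Q α fun j => PowerSeries.coeff j ρ) τ h u) := by
  have hp := (hasLocalExpansion_polynomial
    (-(P /ₘ (Polynomial.X - Polynomial.C (-α))).comp (-Polynomial.C α - Polynomial.X))).mul hb
  have hQ := hasLocalExpansion_polynomial (Q.comp (-Polynomial.C α - Polynomial.X))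
  have h1 : HasLocalExpansion 1 (fun _ => (1 : ℂ)) := by
    simpa using hasLocalExpansion_polynomial 1
  have hκ : HasLocalExpansion (PowerSeries.mk fun i =>
      PowerSeries.coeff i (PowerSeries.X * ρ) / (i.factorial : ℂ))
      (borelKernel fun j => PowerSeries.coeff j ρ) := by
    refine ⟨1, one_pos, fun u _ => ?_⟩
    rw [← hasSum_nat_add_iff' 1]
    simp only [Finset.range_one, Finset.sum_singleton, PowerSeries.coeff_mk,
      PowerSeries.coeff_zero_X_mul, zero_div, zero_mul, sub_zero, PowerSeries.coeff_succ_X_mul]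
    exact hasSum_borelKernel hB hr u
  refine ((hp.add (h1.betaConv hτ (hQ.mul hb))).add (hκ.betaConv hτ hb)).congr ?_
  obtain ⟨ε, hε, hcont⟩ := Metric.eventually_nhds_iff_ball.1 hh.eventually_continuousAt
  filter_upwards [Metric.ball_mem_nhds (0 : ℂ) hε] with u hu
  have hseg : ContinuousOn (fun t : ℝ => h (t * u)) (Icc 0 1) := by
    intro t ht
    have hmem : (t : ℂ) * u ∈ Metric.ball (0 : ℂ) ε := by
      rw [mem_ball_zero_iff] at hu ⊢
      rw [norm_mul, Complex.norm_real, Real.norm_of_nonneg ht.1]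
      exact (mul_le_of_le_one_left (norm_nonneg _) ht.2).trans_lt hu
    exact (ContinuousAt.comp (g := h) (f := fun t : ℝ => (t : ℂ) * u) (hcont _ hmem)
      (by fun_prop)).continuousWithinAt
  rw [add_assoc]
  congr 1
  · simp [leadCoeffFn, Polynomial.eval_comp]
  · unfold volterraOp
    rw [← intervalIntegral.integral_add]
    · congr 1; ext t
      simp only [volterraKernel, Polynomial.eval_comp, Polynomial.eval_sub, Polynomial.eval_neg,
        Polynomial.eval_C, Polynomial.eval_X]
      ring
    · exact intervalIntegrable_cpow_mul hτ
        (continuousOn_const.mul (ContinuousOn.mul (Continuous.continuousOn (by fun_prop)) hseg))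
    · exact intervalIntegrable_cpow_mul hτ
        (ContinuousOn.mul (Continuous.continuousOn (by fun_prop)) hseg)

/-- The Borel transform of a formal solution is a multiple of the solution of the Volterra
equation. -/
theorem exists_hasSum_borelCoeff {P Q : Polynomial ℂ} {R : ℂ → ℂ} {α : ℂ}
    (hα : P.IsRoot (-α)) (hP' : P.derivative.eval (-α) ≠ 0) (hτ : 0 < (tauExp P Q α).re)
    {M B : ℝ} (hM : 0 ≤ M) (hB : 0 < B)
    (hr : ∀ j, ‖PowerSeries.coeff j (taylorPS R)‖ ≤ M * B ^ j)
    {h : ℂ → ℂ} (hh : AnalyticAt ℂ h 0) (hh0 : h 0 = 1)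
    (heq : ∀ᶠ u in 𝓝 0, leadCoeffFn P α u * h u + volterraOp
      (volterraKernel Q α fun j => PowerSeries.coeff j (taylorPS R)) (tauExp P Q α) h u = 0)
    {F : ℂ⟦X⟧} (hF : formalLevelOneOp P Q R α (tauExp P Q α) F = 0) :
    ∃ c : ℂ, ∃ r : ℝ, 0 < r ∧ ∀ u : ℂ, ‖u‖ < r →
      HasSum (fun n => borelCoeff (tauExp P Q α) F n * u ^ n) (c * h u) := by
  set τ := tauExp P Q α
  obtain ⟨b, hb⟩ := exists_hasLocalExpansion hh
  have hVb : formalVolterra P Q α τ (taylorPS R) b = 0 :=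
    ((hb.formalVolterra (P := P) (Q := Q) (α := α) hτ hB hr hh
      (differentiable_borelKernel hM hB hr).continuous).congr heq).eq_zero
  have hVF : formalVolterra P Q α τ (taylorPS R) (borelPS τ F) = 0 := by
    have h1 := borelPS_formalLevelOneOp (Q := Q) R hτ hα F
    rw [hF] at h1
    have h2 : borelPS τ 0 = 0 := by ext n; simp [coeff_borelPS]
    rw [h2] at h1
    exact (mul_eq_zero.1 h1.symm).resolve_left PowerSeries.X_ne_zero
  set c := PowerSeries.coeff 0 (borelPS τ F)
  -- Both series solve the formal Volterra equation; `c` is chosen so that their constant terms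
  -- agree.
  have hdiff : borelPS τ F - c • b = 0 := by
    refine eq_zero_of_formalVolterra_eq_zero hα hP' hτ (ρ := taylorPS R) ?_ ?_
    · rw [formalVolterra_sub_smul, hVF, hVb]; simp
    · rw [map_sub, map_smul, hb.coeff_zero, hh0]; simp [c]
  obtain ⟨r, hr, hsum⟩ := hb
  refine ⟨c, r, hr, fun u hu => ((hsum u hu).mul_left c).congr_fun fun n => ?_⟩
  have h3 := congrArg (PowerSeries.coeff n) (sub_eq_zero.1 hdiff)
  rw [borelPS, PowerSeries.coeff_mk, map_smul, smul_eq_mul] at h3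
  rw [h3, mul_assoc]

/-! ### Laplace integrals along a ray -/

/-- The function `b` on the half-line is integrable against `e^{-st}` for all `s > Λ`. -/
def IsLaplaceIntegrable (Λ : ℝ) (b : ℝ → ℂ) : Prop :=
  ∀ s, Λ < s → IntegrableOn (fun t : ℝ => (Real.exp (-(s * t)) : ℂ) * b t) (Ioi 0)

/-- The Laplace integral of a density along the ray that leaves `α` at angle `θ`. -/
noncomputable def rayIntegral (α : ℂ) (θ : ℝ) (b : ℝ → ℂ) (z : ℂ) : ℂ :=
  ∫ t in Ioi (0 : ℝ), Complex.exp (-z * rayPoint α θ t) * b t * Complex.exp (θ * Complex.I)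

theorem continuous_rayPoint (α : ℂ) (θ : ℝ) : Continuous (rayPoint α θ) := by
  unfold rayPoint
  fun_prop

theorem norm_exp_ofReal_mul_I_mul (θ : ℝ) (w : ℂ) :
    ‖Complex.exp (θ * Complex.I) * w‖ = ‖w‖ := by
  rw [norm_mul, Complex.norm_exp_ofReal_mul_I, one_mul]

theorem norm_rayPoint_le (α : ℂ) (θ : ℝ) {t : ℝ} (ht : 0 ≤ t) : ‖rayPoint α θ t‖ ≤ ‖α‖ + t := by
  refine (norm_add_le _ _).trans_eq ?_
  rw [mul_comm, norm_exp_ofReal_mul_I_mul, Complex.norm_real, Real.norm_of_nonneg ht]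

theorem isOpen_freqHalfPlane (θ Λ : ℝ) : IsOpen (freqHalfPlane θ Λ) :=
  isOpen_lt continuous_const (Complex.continuous_re.comp (by fun_prop))

theorem norm_exp_neg_mul_rayPoint (α : ℂ) (θ t : ℝ) (z : ℂ) :
    ‖Complex.exp (-z * rayPoint α θ t)‖ =
      Real.exp (-(z * α).re) * Real.exp (-((Complex.exp (θ * Complex.I) * z).re * t)) := by
  rw [Complex.norm_exp, ← Real.exp_add]
  congr 1
  have : -z * rayPoint α θ t = -(z * α) - (t : ℂ) * (Complex.exp (θ * Complex.I) * z) := by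
    rw [rayPoint]; ring
  rw [this, Complex.sub_re, Complex.neg_re, Complex.re_ofReal_mul]
  ring

/-! ### Laplace calculus: integrability, derivatives, convolutions. -/

namespace IsLaplaceIntegrable

variable {Λ : ℝ} {b c : ℝ → ℂ}

theorem of_norm_le {a C : ℝ} (ha : 0 < a)
    (hm : AEStronglyMeasurable b (volume.restrict (Ioi 0)))
    (hb : ∀ t : ℝ, 0 < t → ‖b t‖ ≤ C * (t ^ (a - 1) * Real.exp (Λ * t))) :
    IsLaplaceIntegrable Λ b := by
  intro s hs
  have h := (integrableOn_rpow_mul_exp_neg_mul_rpow (s := a - 1) (p := 1) (b := s - Λ)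
    (by linarith) one_pos (by linarith)).const_mul C
  refine h.mono' ?_ ?_
  · exact AEStronglyMeasurable.mul (Continuous.aestronglyMeasurable (by fun_prop)) hm
  · refine (ae_restrict_iff' measurableSet_Ioi).2 (Eventually.of_forall fun t ht => ?_)
    rw [norm_mul, Complex.norm_real, Real.norm_of_nonneg (Real.exp_pos _).le, Real.rpow_one]
    calc Real.exp (-(s * t)) * ‖b t‖
        ≤ Real.exp (-(s * t)) * (C * (t ^ (a - 1) * Real.exp (Λ * t))) := by
          gcongr; exact hb t ht
      _ = C * (t ^ (a - 1) * (Real.exp (-(s * t)) * Real.exp (Λ * t))) := by ring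
      _ = _ := by rw [← Real.exp_add]; ring_nf

theorem add (hb : IsLaplaceIntegrable Λ b) (hc : IsLaplaceIntegrable Λ c) :
    IsLaplaceIntegrable Λ (fun t => b t + c t) := fun s hs =>
  ((hb s hs).add (hc s hs)).congr (Eventually.of_forall fun _ => (mul_add _ _ _).symm)

theorem const_mul (hb : IsLaplaceIntegrable Λ b) (k : ℂ) :
    IsLaplaceIntegrable Λ (fun t => k * b t) := fun s hs =>
  ((hb s hs).const_mul k).congr (Eventually.of_forall fun _ => mul_left_comm _ _ _)

theorem aestronglyMeasurable (hb : IsLaplaceIntegrable Λ b) :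
    AEStronglyMeasurable b (volume.restrict (Ioi 0)) := by
  have h1 := (hb (Λ + 1) (by linarith)).1
  have h2 : AEStronglyMeasurable (fun t : ℝ => (Real.exp ((Λ + 1) * t) : ℂ))
      (volume.restrict (Ioi 0)) := Continuous.aestronglyMeasurable (by fun_prop)
  refine (h2.mul h1).congr (Eventually.of_forall fun t => ?_)
  simp only [Pi.mul_apply]
  rw [← mul_assoc, ← Complex.ofReal_mul, ← Real.exp_add]
  simp

theorem rayPoint_mul (hb : IsLaplaceIntegrable Λ b) (α : ℂ) (θ : ℝ) :
    IsLaplaceIntegrable Λ (fun t => -rayPoint α θ t * b t) := by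
  intro s hs
  -- Half of the margin `s - Λ` absorbs the linear growth of the ray point; the other half keeps
  -- integrability.
  set δ := (s - Λ) / 2 with hδ
  have hδ0 : 0 < δ := by rw [hδ]; linarith
  have h1 := hb (Λ + δ) (by linarith)
  have hbd := h1.bdd_mul (f := fun t : ℝ => (Real.exp (-(δ * t)) : ℂ) * (-rayPoint α θ t))
    (c := ‖α‖ + 1 / δ) (Continuous.aestronglyMeasurable (by
      have := continuous_rayPoint α θ; fun_prop)) ?_
  · refine hbd.congr (Eventually.of_forall fun t => ?_)
    have : Real.exp (-(s * t)) = Real.exp (-(δ * t)) * Real.exp (-((Λ + δ) * t)) := by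
      rw [← Real.exp_add]; congr 1; rw [hδ]; ring
    simp only [this, Complex.ofReal_mul]
    ring
  · refine (ae_restrict_iff' measurableSet_Ioi).2 (Eventually.of_forall fun t ht => ?_)
    have ht0 : (0 : ℝ) < t := ht
    rw [norm_mul, Complex.norm_real, Real.norm_of_nonneg (Real.exp_pos _).le, norm_neg]
    refine (mul_le_mul_of_nonneg_left (norm_rayPoint_le α θ ht0.le) (Real.exp_pos _).le).trans ?_
    rw [mul_add]
    refine add_le_add (mul_le_of_le_one_left (norm_nonneg _)
      (Real.exp_le_one_iff.2 (by simp; positivity))) ?_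
    rw [Real.exp_neg, inv_mul_le_iff₀ (Real.exp_pos _), mul_one_div, le_div_iff₀ hδ0]
    linarith [Real.add_one_le_exp (δ * t)]

theorem rayPoint_pow_mul (hb : IsLaplaceIntegrable Λ b) (α : ℂ) (θ : ℝ) (k : ℕ) :
    IsLaplaceIntegrable Λ (fun t => (-rayPoint α θ t) ^ k * b t) := by
  induction k with
  | zero => simpa using hb
  | succ k ih =>
    simp only [pow_succ', mul_assoc]
    exact ih.rayPoint_mul α θ

theorem eval_rayPoint_mul (hb : IsLaplaceIntegrable Λ b) (α : ℂ) (θ : ℝ) (q : Polynomial ℂ) :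
    IsLaplaceIntegrable Λ (fun t => q.eval (-rayPoint α θ t) * b t) := by
  induction q using Polynomial.induction_on' with
  | add p q hp hq => simpa only [Polynomial.eval_add, add_mul] using hp.add hq
  | monomial n a =>
    simpa only [Polynomial.eval_monomial, mul_assoc] using (hb.rayPoint_pow_mul α θ n).const_mul a

theorem integrableOn (hb : IsLaplaceIntegrable Λ b) (α : ℂ) {θ : ℝ} {z : ℂ}
    (hz : z ∈ freqHalfPlane θ Λ) :
    IntegrableOn (fun t => Complex.exp (-z * rayPoint α θ t) * b t * Complex.exp (θ * Complex.I))
      (Ioi 0) := by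
  have h1 := (hb _ hz).norm.const_mul (Real.exp (-(z * α).re))
  refine h1.mono' ?_ (Eventually.of_forall fun t => ?_)
  · refine (AEStronglyMeasurable.mul (Continuous.aestronglyMeasurable ?_)
      hb.aestronglyMeasurable).mul aestronglyMeasurable_const
    have := continuous_rayPoint α θ
    fun_prop
  · rw [mul_comm, norm_exp_ofReal_mul_I_mul, norm_mul, norm_exp_neg_mul_rayPoint, norm_mul,
      Complex.norm_real, Real.norm_of_nonneg (Real.exp_pos _).le, mul_assoc]

theorem hasDerivAt (hb : IsLaplaceIntegrable Λ b) (α : ℂ) {θ : ℝ} {z : ℂ}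
    (hz : z ∈ freqHalfPlane θ Λ) :
    HasDerivAt (rayIntegral α θ b) (rayIntegral α θ (fun t => -rayPoint α θ t * b t) z) z := by
  obtain ⟨s, hs, hsz⟩ := exists_between (show Λ < _ from hz)
  have hderiv : ∀ (t : ℝ) (w : ℂ), HasDerivAt (fun w => Complex.exp (-w * rayPoint α θ t) * b t *
      Complex.exp (θ * Complex.I)) (Complex.exp (-w * rayPoint α θ t) * (-rayPoint α θ t * b t) *
      Complex.exp (θ * Complex.I)) w := by
    intro t w
    have h1 : HasDerivAt (fun w : ℂ => -w * rayPoint α θ t) (-rayPoint α θ t) w := by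
      simpa using ((hasDerivAt_id w).neg.mul_const (rayPoint α θ t))
    have h2 := (h1.cexp.mul_const (b t)).mul_const (Complex.exp (θ * Complex.I))
    simpa only [mul_assoc] using h2
  have hV : IsOpen (freqHalfPlane θ s ∩ Metric.ball 0 (‖z‖ + 1)) :=
    (isOpen_freqHalfPlane θ s).inter Metric.isOpen_ball
  have key := hasDerivAt_integral_of_holomorphic (μ := volume.restrict (Ioi 0)) hV
    (F := fun w t => Complex.exp (-w * rayPoint α θ t) * b t * Complex.exp (θ * Complex.I))
    (bound := fun t => Real.exp ((‖z‖ + 1) * ‖α‖) * ‖(Real.exp (-(s * t)) : ℂ) * b t‖)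
    (fun w hw => (hb.integrableOn α (show Λ < _ from hs.trans hw.1)).1)
    (Eventually.of_forall fun t w _ => (hderiv t w).differentiableAt.differentiableWithinAt)
    ?_ ((hb s hs).norm.const_mul _) (u := z) ⟨hsz, by simp⟩
  · refine key.congr_deriv ?_
    unfold rayIntegral
    congr 1; ext t
    exact (hderiv t z).deriv
  · refine (ae_restrict_iff' measurableSet_Ioi).2 (Eventually.of_forall fun t ht w hw => ?_)
    have ht0 : (0 : ℝ) < t := ht
    rw [mul_comm, norm_exp_ofReal_mul_I_mul, norm_mul, norm_exp_neg_mul_rayPoint, norm_mul,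
      Complex.norm_real, Real.norm_of_nonneg (Real.exp_pos _).le, mul_assoc]
    have hw1 : ‖w‖ ≤ ‖z‖ + 1 := by simpa using (Metric.mem_ball.1 hw.2).le
    have h1 : -(w * α).re ≤ (‖z‖ + 1) * ‖α‖ := by
      refine (neg_le_abs _).trans ((Complex.abs_re_le_norm _).trans ?_)
      rw [norm_mul]
      gcongr
    have h2 : s ≤ (Complex.exp (θ * Complex.I) * w).re := le_of_lt hw.1
    gcongr

theorem iteratedDeriv_rayIntegral (hb : IsLaplaceIntegrable Λ b) (α : ℂ) {θ : ℝ} (k : ℕ) :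
    ∀ z ∈ freqHalfPlane θ Λ, iteratedDeriv k (rayIntegral α θ b) z =
      rayIntegral α θ (fun t => (-rayPoint α θ t) ^ k * b t) z := by
  induction k with
  | zero => simp
  | succ k ih =>
    intro z hz
    have h1 : iteratedDeriv k (rayIntegral α θ b) =ᶠ[𝓝 z]
        rayIntegral α θ (fun t => (-rayPoint α θ t) ^ k * b t) := by
      filter_upwards [(isOpen_freqHalfPlane θ Λ).mem_nhds hz] with w hw using ih w hw
    rw [iteratedDeriv_succ, h1.deriv_eq, ((hb.rayPoint_pow_mul α θ k).hasDerivAt α hz).deriv]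
    congr 1; ext t
    ring

theorem rayIntegral_add (hb : IsLaplaceIntegrable Λ b) (hc : IsLaplaceIntegrable Λ c) (α : ℂ)
    {θ : ℝ} {z : ℂ} (hz : z ∈ freqHalfPlane θ Λ) :
    rayIntegral α θ (fun t => b t + c t) z = rayIntegral α θ b z + rayIntegral α θ c z := by
  unfold rayIntegral
  rw [← integral_add (hb.integrableOn α hz) (hc.integrableOn α hz)]
  congr 1; ext t
  ring

theorem _root_.rayIntegral_const_mul (k : ℂ) (b : ℝ → ℂ) (α : ℂ) (θ : ℝ) (z : ℂ) :
    rayIntegral α θ (fun t => k * b t) z = k * rayIntegral α θ b z := by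
  unfold rayIntegral
  rw [← integral_const_mul]
  congr 1; ext t
  ring

theorem sum_iteratedDeriv_rayIntegral (hb : IsLaplaceIntegrable Λ b) (α : ℂ) {θ : ℝ} {z : ℂ}
    (hz : z ∈ freqHalfPlane θ Λ) (q : Polynomial ℂ) :
    (q.sum fun k a => a * iteratedDeriv k (rayIntegral α θ b) z) =
      rayIntegral α θ (fun t => q.eval (-rayPoint α θ t) * b t) z := by
  induction q using Polynomial.induction_on' with
  | add p q hp hq =>
    rw [Polynomial.sum_add_index _ _ _ (by simp) (by intros; ring), hp, hq,
      ← (hb.eval_rayPoint_mul α θ p).rayIntegral_add (hb.eval_rayPoint_mul α θ q) α hz]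
    simp only [Polynomial.eval_add, add_mul]
  | monomial n a =>
    rw [Polynomial.sum_monomial_index _ _ (by simp), hb.iteratedDeriv_rayIntegral α n z hz,
      ← rayIntegral_const_mul]
    simp only [Polynomial.eval_monomial, mul_assoc]

theorem integrableOn_exp_mul (hb : IsLaplaceIntegrable Λ b) {w : ℂ} (hw : Λ < w.re) :
    IntegrableOn (fun t : ℝ => Complex.exp (-(w * t)) * b t) (Ioi 0) := by
  refine ((hb _ hw).norm).mono' ?_ (Eventually.of_forall fun t => ?_)
  · exact AEStronglyMeasurable.mul (Continuous.aestronglyMeasurable (by fun_prop))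
      hb.aestronglyMeasurable
  · rw [norm_mul, norm_mul, Complex.norm_exp, Complex.norm_real,
      Real.norm_of_nonneg (Real.exp_pos _).le]
    simp

/-- The Laplace transform of a convolution. -/
theorem rayIntegral_convolution {a : ℝ → ℂ} (ha : IsLaplaceIntegrable Λ a)
    (hb : IsLaplaceIntegrable Λ b) (α : ℂ) {θ : ℝ} {z : ℂ} (hz : z ∈ freqHalfPlane θ Λ) :
    IntegrableOn (fun t => Complex.exp (-z * rayPoint α θ t) *
        (∫ s in (0 : ℝ)..t, a (t - s) * b s) * Complex.exp (θ * Complex.I)) (Ioi 0) ∧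
      rayIntegral α θ (fun t => ∫ s in (0 : ℝ)..t, a (t - s) * b s) z =
      (∫ t in Ioi (0 : ℝ), Complex.exp (-(Complex.exp (θ * Complex.I) * z * t)) * a t) *
        rayIntegral α θ b z := by
  have h1 := ha.integrableOn_exp_mul (w := Complex.exp (θ * Complex.I) * z) hz
  have h2 := hb.integrableOn α hz
  -- The exponential at `t` factors through `s` and `t - s`, so the integrand is itself a
  -- convolution. The base point `α` is carried by the factor `b` alone.
  have key : ∀ t : ℝ, Complex.exp (-z * rayPoint α θ t) *
      (∫ s in (0 : ℝ)..t, a (t - s) * b s) * Complex.exp (θ * Complex.I) =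
      ∫ s in (0 : ℝ)..t, ContinuousLinearMap.mul ℝ ℂ
        (Complex.exp (-z * rayPoint α θ s) * b s * Complex.exp (θ * Complex.I))
        (Complex.exp (-(Complex.exp (θ * Complex.I) * z * (t - s : ℝ))) * a (t - s)) := by
    intro t
    rw [← intervalIntegral.integral_const_mul, ← intervalIntegral.integral_mul_const]
    congr 1; ext s
    have : Complex.exp (-z * rayPoint α θ t) = Complex.exp (-z * rayPoint α θ s) *
        Complex.exp (-(Complex.exp (θ * Complex.I) * z * (t - s : ℝ))) := by
      rw [← Complex.exp_add]
      congr 1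
      rw [rayPoint, rayPoint]
      push_cast
      ring
    rw [this, ContinuousLinearMap.mul_apply']
    ring
  constructor
  · have h3 := integrable_posConvolution h2 h1 (ContinuousLinearMap.mul ℝ ℂ)
    rw [posConvolution, integrable_indicator_iff measurableSet_Ioi] at h3
    exact h3.congr (Eventually.of_forall fun t => (key t).symm)
  · have h3 := integral_posConvolution h2 h1 (ContinuousLinearMap.mul ℝ ℂ)
    rw [ContinuousLinearMap.mul_apply'] at h3
    rw [mul_comm, rayIntegral, rayIntegral, ← h3]
    congr 1; ext t
    exact key t

end IsLaplaceIntegrable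

/-! ### The Laplace transform of the kernels -/

theorem isLaplaceIntegrable_one {Λ : ℝ} (hΛ : 0 ≤ Λ) : IsLaplaceIntegrable Λ fun _ => 1 :=
  .of_norm_le (a := 1) (C := 1) one_pos aestronglyMeasurable_const fun t ht => by
    simpa using mul_nonneg hΛ ht.le

theorem integral_exp_neg_mul_one {w : ℂ} (hw : 0 < w.re) :
    ∫ t in Ioi (0 : ℝ), Complex.exp (-(w * t)) * 1 = w⁻¹ := by
  have h := integral_exp_mul_complex_Ioi (a := -w) (by simpa using hw) 0
  simp only [neg_mul] at h
  simp [h]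

theorem isLaplaceIntegrable_cpow {a : ℂ} (ha : 0 < a.re) :
    IsLaplaceIntegrable 0 fun t => (t : ℂ) ^ (a - 1) := by
  refine .of_norm_le (a := a.re) (C := 1) ha ?_ fun t ht => ?_
  · refine ContinuousOn.aestronglyMeasurable (fun t ht => ?_) measurableSet_Ioi
    exact (Complex.continuousAt_ofReal_cpow_const _ _
      (Or.inr (ne_of_gt ht))).continuousWithinAt
  · have := norm_cpow_sub_one_mul (s := a) ht 1
    simp only [mul_one, norm_one] at this
    simp [this]

/-- The Laplace transform of a power. -/
theorem integral_exp_neg_mul_cpow {a w : ℂ} (ha : 0 < a.re) (hw : 0 < w.re) :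
    ∫ t in Ioi (0 : ℝ), Complex.exp (-(w * t)) * (t : ℂ) ^ (a - 1) =
      w ^ (-a) * Complex.Gamma a := by
  have hV : IsOpen {w : ℂ | 0 < w.re} := isOpen_lt continuous_const Complex.continuous_re
  have hdiff : DifferentiableOn ℂ (fun w : ℂ => ∫ t in Ioi (0 : ℝ),
      Complex.exp (-(w * t)) * (t : ℂ) ^ (a - 1)) {w | 0 < w.re} := by
    intro w hw
    have h := ((isLaplaceIntegrable_cpow ha).hasDerivAt 0 (θ := 0) (z := w)
      (by simpa [freqHalfPlane] using hw)).differentiableAt.differentiableWithinAt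
        (s := {w : ℂ | 0 < w.re})
    have heq : (fun w : ℂ => ∫ t in Ioi (0 : ℝ), Complex.exp (-(w * t)) * (t : ℂ) ^ (a - 1)) =
        rayIntegral 0 0 fun t => (t : ℂ) ^ (a - 1) := by
      ext w
      simp [rayIntegral, rayPoint]
    rwa [heq]
  have hdiff2 : DifferentiableOn ℂ (fun w : ℂ => w ^ (-a) * Complex.Gamma a) {w | 0 < w.re} :=
    fun w hw => ((differentiableAt_id.cpow_const (Or.inl hw)).mul_const _).differentiableWithinAt
  -- The formula is known for positive `w`; the points `1 + 1/(n+1)` accumulate at `1`, so it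
  -- extends to the right half-plane.
  refine (hdiff.analyticOnNhd hV).eqOn_of_preconnected_of_frequently_eq (hdiff2.analyticOnNhd hV)
    (convex_halfSpace_re_gt 0).isPreconnected (z₀ := 1) (by simp) ?_ hw
  have hlim : Tendsto (fun n : ℕ => ((1 + 1 / ((n : ℝ) + 1) : ℝ) : ℂ)) atTop (𝓝[≠] 1) := by
    refine tendsto_nhdsWithin_iff.2 ⟨?_, Eventually.of_forall fun n => ?_⟩
    · have := (tendsto_one_div_add_atTop_nhds_zero_nat (𝕜 := ℝ)).const_add 1
      rw [add_zero] at this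
      exact_mod_cast (Complex.continuous_ofReal.tendsto 1).comp this
    · have : (0 : ℝ) < 1 / ((n : ℝ) + 1) := by positivity
      rw [mem_compl_singleton_iff, Ne, Complex.ofReal_eq_one]
      linarith
  refine hlim.frequently (Eventually.of_forall fun n => ?_).frequently
  set x : ℝ := 1 + 1 / ((n : ℝ) + 1)
  have hx : 0 < x := by positivity
  have h := Complex.integral_cpow_mul_exp_neg_mul_Ioi ha hx
  have harg : Complex.arg (x : ℂ) ≠ Real.pi := by
    rw [Complex.arg_ofReal_of_nonneg hx.le]
    exact Real.pi_pos.ne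
  rw [one_div, Complex.inv_cpow _ _ harg, ← Complex.cpow_neg] at h
  rw [← h]
  congr 1; ext t
  ring

theorem integral_pow_mul_exp_neg_mul {w : ℂ} (hw : 0 < w.re) (n : ℕ) :
    ∫ t in Ioi (0 : ℝ), (t : ℂ) ^ n * Complex.exp (-(w * t)) =
      (n.factorial : ℂ) * (w ^ (n + 1))⁻¹ := by
  have h := integral_exp_neg_mul_cpow (a := (n + 1 : ℕ)) (w := w)
    (by rw [Complex.natCast_re]; positivity) hw
  rw [Complex.cpow_neg, Complex.cpow_natCast] at h
  rw [Nat.cast_succ, Complex.Gamma_nat_eq_factorial, add_sub_cancel_right] at h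
  simp only [Complex.cpow_natCast] at h
  rw [mul_comm, ← h]
  congr 1; ext t
  ring

theorem isLaplaceIntegrable_borelKernel {r : ℕ → ℂ} {M B Λ : ℝ} (hM : 0 ≤ M) (hB : 0 < B)
    (hr : ∀ j, ‖r j‖ ≤ M * B ^ j) (hΛ : B ≤ Λ) (θ : ℝ) :
    IsLaplaceIntegrable Λ fun t => borelKernel r (t * Complex.exp (θ * Complex.I)) := by
  refine .of_norm_le (a := 1) (C := M / B) one_pos ?_ fun t ht => ?_
  · have := (differentiable_borelKernel hM hB hr).continuous
    exact Continuous.aestronglyMeasurable (by fun_prop)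
  · refine (norm_borelKernel_le hM hB hr _).trans ?_
    rw [mul_comm (t : ℂ), norm_exp_ofReal_mul_I_mul, Complex.norm_real, Real.norm_of_nonneg ht.le]
    simp only [sub_self, Real.rpow_zero, one_mul]
    gcongr

/-- Termwise, `∫ t^{j+1} e^{-wt} dt = (j+1)!/w^{j+2}` removes the factorial. The prefactor `e^{iθ}`
is that of `dζ = e^{iθ} dt` and supplies the missing power in `e^{i(j+2)θ}/w^{j+2} = z^{-j-2}`.
Domination by `e^{(B - Re w)t}` requires `Re w > B`. -/
theorem hasSum_integral_borelKernel {r : ℕ → ℂ} {M B : ℝ} (hB : 0 < B)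
    (hr : ∀ j, ‖r j‖ ≤ M * B ^ j) {θ : ℝ} {z : ℂ} (hz : z ∈ freqHalfPlane θ B) :
    HasSum (fun j => r j * z⁻¹ ^ (j + 2)) (Complex.exp (θ * Complex.I) *
      ∫ t in Ioi (0 : ℝ), Complex.exp (-(Complex.exp (θ * Complex.I) * z * t)) *
        borelKernel r (t * Complex.exp (θ * Complex.I))) := by
  set e := Complex.exp (θ * Complex.I) with he
  set w := e * z with hw
  have hwB : B < w.re := hz
  have hw0 : 0 < w.re := hB.trans hwB
  have key : HasSum (fun j => ∫ t in Ioi (0 : ℝ), Complex.exp (-(w * t)) *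
      (r j / ((j + 1).factorial : ℂ) * (t * e) ^ (j + 1)))
      (∫ t in Ioi (0 : ℝ), Complex.exp (-(w * t)) * borelKernel r (t * e)) := by
    refine hasSum_integral_of_dominated_convergence
      (fun j t => Real.exp (-(w.re * t)) * (M / B * ((B * t) ^ (j + 1) / ((j + 1).factorial : ℝ))))
      (fun j => Continuous.aestronglyMeasurable (by fun_prop)) (fun j => ?_) ?_ ?_ ?_
    · refine (ae_restrict_iff' measurableSet_Ioi).2 (Eventually.of_forall fun t ht => ?_)
      have ht0 : (0 : ℝ) < t := ht
      have h1 := norm_borelKernel_term_le hB hr j ((t : ℂ) * e)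
      have h2 : ‖(t : ℂ) * e‖ = t := by
        rw [mul_comm, he, norm_exp_ofReal_mul_I_mul, Complex.norm_real, Real.norm_of_nonneg ht0.le]
      rw [h2] at h1
      rw [norm_mul, Complex.norm_exp]
      simp only [Complex.neg_re, Complex.re_mul_ofReal]
      gcongr
    · exact Eventually.of_forall fun t =>
        ((hasSum_pow_succ_div_factorial (B * t)).summable.mul_left _).mul_left _
    · have h1 : ∀ t : ℝ, ∑' j : ℕ, Real.exp (-(w.re * t)) *
          (M / B * ((B * t) ^ (j + 1) / ((j + 1).factorial : ℝ))) =
          M / B * (Real.exp ((B - w.re) * t) - Real.exp (-w.re * t)) := by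
        intro t
        rw [tsum_mul_left, tsum_mul_left, (hasSum_pow_succ_div_factorial (B * t)).tsum_eq, sub_mul,
          sub_eq_add_neg (B * t), Real.exp_add]
        ring_nf
      simp only [h1]
      exact ((integrableOn_exp_mul_Ioi (by linarith) 0).sub
        (integrableOn_exp_mul_Ioi (by linarith) 0)).const_mul _
    · exact Eventually.of_forall fun t => (hasSum_borelKernel hB hr _).mul_left _
  refine (key.mul_left e).congr_fun fun j => ?_
  have h1 : ∀ t : ℝ, Complex.exp (-(w * t)) * (r j / ((j + 1).factorial : ℂ) * (t * e) ^ (j + 1)) =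
      r j / ((j + 1).factorial : ℂ) * e ^ (j + 1) *
        ((t : ℂ) ^ (j + 1) * Complex.exp (-(w * t))) := fun t => by ring
  simp only [h1]
  rw [integral_const_mul, integral_pow_mul_exp_neg_mul hw0, hw]
  have hf : ((j + 1).factorial : ℂ) ≠ 0 := Nat.cast_ne_zero.2 (Nat.factorial_ne_zero _)
  have he0 : e ≠ 0 := Complex.exp_ne_zero _
  have hz0 : z ≠ 0 := by rintro rfl; simp [hw] at hw0
  rw [inv_pow, mul_pow]
  field_simp
  ring

/-! ### The differential equation for the Laplace transform -/

theorem levelOneOp_congr {P Q : Polynomial ℂ} {R Ψ Φ : ℂ → ℂ} {z : ℂ} (h : Ψ =ᶠ[𝓝 z] Φ) :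
    levelOneOp P Q R Ψ z = levelOneOp P Q R Φ z := by
  unfold levelOneOp
  simp only [h.iteratedDeriv_eq, h.eq_of_nhds]

theorem freqHalfPlane_mono {θ Λ Λ' : ℝ} (h : Λ ≤ Λ') : freqHalfPlane θ Λ' ⊆ freqHalfPlane θ Λ :=
  fun _ hz => h.trans_lt hz

/-- The values of `u ^ (τ - 1) h(u)` along the ray at angle `θ`. -/
noncomputable def rayDensity (τ : ℂ) (θ : ℝ) (h : ℂ → ℂ) (t : ℝ) : ℂ :=
  Complex.exp (θ * (τ - 1) * Complex.I) * ((t : ℂ) ^ (τ - 1) * h (t * Complex.exp (θ * Complex.I)))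

theorem ray_mem_openSector {θ θ₁ θ₂ t : ℝ} (hθ : θ ∈ Ioo θ₁ θ₂) (ht : 0 < t) :
    (t : ℂ) * Complex.exp (θ * Complex.I) ∈ openSector 0 θ₁ θ₂ :=
  ⟨t, ht, θ, hθ, by simp⟩

theorem norm_ofReal_mul_exp (θ : ℝ) {t : ℝ} (ht : 0 ≤ t) :
    ‖(t : ℂ) * Complex.exp (θ * Complex.I)‖ = t := by
  rw [mul_comm, norm_exp_ofReal_mul_I_mul, Complex.norm_real, Real.norm_of_nonneg ht]

theorem aestronglyMeasurable_rayDensity {τ : ℂ} {θ θ₁ θ₂ : ℝ} {h : ℂ → ℂ}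
    (hh : ContinuousOn h (openSector 0 θ₁ θ₂)) (hθ : θ ∈ Ioo θ₁ θ₂) :
    AEStronglyMeasurable (rayDensity τ θ h) (volume.restrict (Ioi 0)) := by
  refine ContinuousOn.aestronglyMeasurable (ContinuousOn.mul continuousOn_const ?_)
    measurableSet_Ioi
  refine ContinuousOn.mul (fun t ht => (Complex.continuousAt_ofReal_cpow_const _ _
    (Or.inr (ne_of_gt ht))).continuousWithinAt) ?_
  exact hh.comp (Continuous.continuousOn (by fun_prop)) fun t ht => ray_mem_openSector hθ ht

theorem norm_rayDensity {τ : ℂ} (θ : ℝ) (h : ℂ → ℂ) {t : ℝ} (ht : 0 < t) :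
    ‖rayDensity τ θ h t‖ = Real.exp (-(θ * τ.im)) *
      (t ^ (τ.re - 1) * ‖h (t * Complex.exp (θ * Complex.I))‖) := by
  rw [rayDensity, norm_mul, norm_cpow_sub_one_mul ht, Complex.norm_exp]
  simp

theorem isLaplaceIntegrable_rayDensity {τ : ℂ} {θ θ₁ θ₂ C Λ : ℝ} {h : ℂ → ℂ} (hτ : 0 < τ.re)
    (hh : ContinuousOn h (openSector 0 θ₁ θ₂))
    (hb : ∀ u ∈ openSector 0 θ₁ θ₂, ‖h u‖ ≤ C * Real.exp (Λ * ‖u‖)) (hθ : θ ∈ Ioo θ₁ θ₂) :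
    IsLaplaceIntegrable Λ (rayDensity τ θ h) := by
  refine .of_norm_le (a := τ.re) (C := Real.exp (-(θ * τ.im)) * C) hτ
    (aestronglyMeasurable_rayDensity hh hθ) fun t ht => ?_
  have h1 := hb _ (ray_mem_openSector hθ ht)
  rw [norm_ofReal_mul_exp θ ht.le] at h1
  rw [norm_rayDensity θ h ht]
  calc Real.exp (-(θ * τ.im)) * (t ^ (τ.re - 1) * ‖h (t * Complex.exp (θ * Complex.I))‖)
      ≤ Real.exp (-(θ * τ.im)) * (t ^ (τ.re - 1) * (C * Real.exp (Λ * t))) := by gcongr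
    _ = _ := by ring

theorem IsLaplaceIntegrable.intervalIntegrable {Λ : ℝ} {b : ℝ → ℂ} (hb : IsLaplaceIntegrable Λ b)
    {t : ℝ} (ht : 0 ≤ t) : IntervalIntegrable b volume 0 t := by
  have h1 := (hb (Λ + 1) (by linarith)).mono_set (Ioc_subset_Ioi_self : Ioc 0 t ⊆ Ioi 0)
  rw [← intervalIntegrable_iff_integrableOn_Ioc_of_le ht] at h1
  have h2 := h1.continuousOn_mul (g := fun s : ℝ => (Real.exp ((Λ + 1) * s) : ℂ))
    (Continuous.continuousOn (by fun_prop))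
  refine h2.congr fun s _ => ?_
  rw [← mul_assoc, ← Complex.ofReal_mul, ← Real.exp_add]
  simp

/-- The Volterra equation along a ray. -/
theorem volterra_rayDensity {P Q : Polynomial ℂ} {α τ : ℂ} {r : ℕ → ℂ} {h : ℂ → ℂ} {θ t : ℝ}
    (hα : P.IsRoot (-α)) (ht : 0 < t)
    (heq : leadCoeffFn P α (t * Complex.exp (θ * Complex.I)) * h (t * Complex.exp (θ * Complex.I))
      + volterraOp (volterraKernel Q α r) τ h (t * Complex.exp (θ * Complex.I)) = 0) :
    P.eval (-rayPoint α θ t) * rayDensity τ θ h t + Complex.exp (θ * Complex.I) *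
      ∫ s in (0 : ℝ)..t, (Q.eval (-rayPoint α θ s) +
        borelKernel r ((t - s : ℝ) * Complex.exp (θ * Complex.I))) * rayDensity τ θ h s = 0 := by
  set e := Complex.exp (θ * Complex.I) with he
  set c := Complex.exp (θ * (τ - 1) * Complex.I) with hc
  have hint : ∫ s in (0 : ℝ)..t, (Q.eval (-rayPoint α θ s) +
      borelKernel r ((t - s : ℝ) * e)) * rayDensity τ θ h s =
      t * (c * ((t : ℂ) ^ (τ - 1) * volterraOp (volterraKernel Q α r) τ h (t * e))) := by
    -- The substitution `s = t x` rescales the integral over `[0, t]` to the unit interval.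
    have h1 := intervalIntegral.smul_integral_comp_mul_left (a := 0) (b := 1)
      (fun s : ℝ => (Q.eval (-rayPoint α θ s) +
        borelKernel r ((t - s : ℝ) * e)) * rayDensity τ θ h s) t
    rw [mul_zero, mul_one] at h1
    rw [← h1, volterraOp, ← intervalIntegral.integral_const_mul,
      ← intervalIntegral.integral_const_mul, Complex.real_smul]
    congr 1
    refine intervalIntegral.integral_congr fun x hx => ?_
    rw [uIcc_of_le zero_le_one] at hx
    simp only [rayDensity, volterraKernel, rayPoint]
    rw [Complex.ofReal_mul, Complex.mul_cpow_ofReal_nonneg ht.le hx.1, ← hc, ← he]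
    have e1 : -(α + (t : ℂ) * x * e) = -α - x * (t * e) := by ring
    have e2 : ((t - t * x : ℝ) : ℂ) * e = ((1 - x : ℝ) : ℂ) * (t * e) := by push_cast; ring
    have e3 : (t : ℂ) * x * e = x * (t * e) := by ring
    rw [e1, e2, e3]
    ring
  have hP : P.eval (-rayPoint α θ t) = (t * e) * leadCoeffFn P α (t * e) := by
    rw [mul_leadCoeffFn hα, rayPoint, neg_add']
  rw [hint, hP, rayDensity, ← hc, ← he]
  -- The powers of `u = t e^{iθ}` that were divided out are restored.
  linear_combination ((t : ℂ) * e * c * (t : ℂ) ^ (τ - 1)) * heq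

/-- The three terms of the operator are the Laplace transforms of multiplication by `P(-ζ)`, of `1 *
(Q(-ζ) b)` and of `k * b`, so their sum is the transform of the left side of `heq`. The level lies
above `B` for convergence of the transform of `k`, and above `A` so that the Taylor series of `R`
represents it at `z⁻¹`. -/
theorem levelOneOp_rayIntegral {P Q : Polynomial ℂ} {R : ℂ → ℂ} {A : ℝ} (hA : 0 < A)
    (hR : DifferentiableOn ℂ R (Metric.ball 0 A⁻¹)) {M B Λ : ℝ} (hM : 0 ≤ M) (hB : 0 < B)
    (hr : ∀ j, ‖PowerSeries.coeff j (taylorPS R)‖ ≤ M * B ^ j) (hBΛ : B ≤ Λ) (hAΛ : A ≤ Λ)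
    {α : ℂ} {θ : ℝ} {b : ℝ → ℂ} (hb : IsLaplaceIntegrable Λ b)
    (heq : ∀ t : ℝ, 0 < t → P.eval (-rayPoint α θ t) * b t + Complex.exp (θ * Complex.I) *
      ∫ s in (0 : ℝ)..t, (Q.eval (-rayPoint α θ s) +
        borelKernel (fun j => PowerSeries.coeff j (taylorPS R))
          ((t - s : ℝ) * Complex.exp (θ * Complex.I))) * b s = 0)
    {z : ℂ} (hz : z ∈ freqHalfPlane θ Λ) :
    levelOneOp P Q R (rayIntegral α θ b) z = 0 := by
  set k := borelKernel (fun j => PowerSeries.coeff j (taylorPS R)) with hk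
  set e := Complex.exp (θ * Complex.I) with he
  have hkc : Continuous k := (differentiable_borelKernel hM hB hr).continuous
  have he0 : e ≠ 0 := Complex.exp_ne_zero _
  have hwre : Λ < (e * z).re := hz
  have hw0 : 0 < (e * z).re := by linarith
  have hz0 : z ≠ 0 := by rintro rfl; simp at hw0
  have hzA : A < ‖z‖ := by
    have h1 := Complex.re_le_norm (e * z)
    rw [he, norm_exp_ofReal_mul_I_mul, ← he] at h1
    linarith
  have hkI := isLaplaceIntegrable_borelKernel hM hB hr hBΛ θ
  rw [← hk, ← he] at hkI
  have h1I := isLaplaceIntegrable_one (hB.le.trans hBΛ)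
  have hQb := hb.eval_rayPoint_mul α θ Q
  obtain ⟨i1, c1⟩ := h1I.rayIntegral_convolution hQb α hz
  obtain ⟨i2, c2⟩ := hkI.rayIntegral_convolution hb α hz
  rw [← he] at c1 c2
  rw [integral_exp_neg_mul_one hw0] at c1
  have hRz : e * ∫ t in Ioi (0 : ℝ), Complex.exp (-(e * z * t)) * k (t * e) =
      (z ^ 2)⁻¹ * R z⁻¹ := by
    have s1 := hasSum_integral_borelKernel hB hr (freqHalfPlane_mono hBΛ hz)
    have s2 := (hasSum_coeff_taylorPS hR (w := z⁻¹) (by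
      rw [norm_inv]; exact inv_strictAnti₀ hA hzA)).mul_left ((z ^ 2)⁻¹)
    refine s1.unique (s2.congr_fun fun j => ?_)
    rw [pow_add, inv_pow z 2]
    ring
  have hPint : rayIntegral α θ (fun t => P.eval (-rayPoint α θ t) * b t) z =
      -(e * (rayIntegral α θ (fun t => ∫ s in (0 : ℝ)..t, 1 * (Q.eval (-rayPoint α θ s) * b s)) z
        + rayIntegral α θ (fun t => ∫ s in (0 : ℝ)..t, k ((t - s : ℝ) * e) * b s) z)) := by
    unfold rayIntegral
    rw [← integral_add i1 i2, ← integral_const_mul, ← integral_neg]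
    refine setIntegral_congr_fun measurableSet_Ioi fun t ht => ?_
    have ht0 : (0 : ℝ) < t := ht
    simp only
    have h1 := heq t ht
    have hadd : ∫ s in (0 : ℝ)..t, (Q.eval (-rayPoint α θ s) + k ((t - s : ℝ) * e)) * b s =
        (∫ s in (0 : ℝ)..t, 1 * (Q.eval (-rayPoint α θ s) * b s)) +
          ∫ s in (0 : ℝ)..t, k ((t - s : ℝ) * e) * b s := by
      rw [← intervalIntegral.integral_add]
      · congr 1; ext s; ring
      · simpa only [one_mul] using hQb.intervalIntegrable ht0.le
      · exact (hb.intervalIntegrable ht0.le).continuousOn_mul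
          (Continuous.continuousOn (by fun_prop))
    rw [hadd] at h1
    rw [eq_neg_of_add_eq_zero_left h1]
    ring
  have hsum : ∀ q : Polynomial ℂ, (q.sum fun k a => a * iteratedDeriv k (rayIntegral α θ b) z) =
      rayIntegral α θ (fun t => q.eval (-rayPoint α θ t) * b t) z :=
    hb.sum_iteratedDeriv_rayIntegral α hz
  rw [levelOneOp, hsum, hsum, hPint, c1, c2, ← hRz, mul_inv]
  field_simp
  ring

/-! ### Geometry of half-planes -/

theorem re_exp_mul_I_mul (θ : ℝ) (z : ℂ) :
    (Complex.exp (θ * Complex.I) * z).re = Real.cos θ * z.re - Real.sin θ * z.im := by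
  rw [Complex.mul_re, Complex.exp_ofReal_mul_I_re, Complex.exp_ofReal_mul_I_im]

/-- As a function of `y` the quantity is a sinusoid, hence a combination of its values at `θ` and
`θ'` with weights `sin(θ'-y)/sin(θ'-θ)` and `sin(y-θ)/sin(θ'-θ)`. Their sum is at least `1`, which
suffices because `m ≥ 0`. -/
theorem le_re_exp_mul_I_mul {θ θ' y m : ℝ} {z : ℂ} (hm : 0 ≤ m) (hθ : θ < θ') (hπ : θ' - θ < Real.pi)
    (h : m ≤ (Complex.exp (θ * Complex.I) * z).re) (h' : m ≤ (Complex.exp (θ' * Complex.I) * z).re)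
    (hy : y ∈ Icc θ θ') : m ≤ (Complex.exp (y * Complex.I) * z).re := by
  rw [re_exp_mul_I_mul] at *
  have hs : 0 < Real.sin (θ' - θ) := Real.sin_pos_of_pos_of_lt_pi (by linarith) hπ
  have h1 : 0 ≤ Real.sin (θ' - y) :=
    Real.sin_nonneg_of_nonneg_of_le_pi (by linarith [hy.2]) (by linarith [hy.1])
  have h2 : 0 ≤ Real.sin (y - θ) :=
    Real.sin_nonneg_of_nonneg_of_le_pi (by linarith [hy.1]) (by linarith [hy.2])
  have h3 : Real.sin (θ' - θ) ≤ Real.sin (θ' - y) + Real.sin (y - θ) := by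
    have : θ' - θ = (θ' - y) + (y - θ) := by ring
    rw [this, Real.sin_add]
    nlinarith [Real.cos_le_one (θ' - y), Real.cos_le_one (y - θ)]
  have key : Real.sin (θ' - θ) * (Real.cos y * z.re - Real.sin y * z.im) =
      Real.sin (θ' - y) * (Real.cos θ * z.re - Real.sin θ * z.im) +
        Real.sin (y - θ) * (Real.cos θ' * z.re - Real.sin θ' * z.im) := by
    simp only [Real.sin_sub]
    ring
  have h4 : Real.sin (θ' - θ) * m ≤ Real.sin (θ' - θ) * (Real.cos y * z.re - Real.sin y * z.im) := by
    rw [key]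
    nlinarith [mul_le_mul_of_nonneg_left h h1, mul_le_mul_of_nonneg_left h' h2]
  exact le_of_mul_le_mul_left h4 hs

theorem isOpen_dualSector (θ₁ θ₂ Λ : ℝ) : IsOpen (dualSector θ₁ θ₂ Λ) := by
  have : dualSector θ₁ θ₂ Λ = ⋃ θ ∈ Ioo θ₁ θ₂, freqHalfPlane θ Λ := by
    ext z; simp [dualSector]
  rw [this]
  exact isOpen_biUnion fun θ _ => isOpen_freqHalfPlane θ Λ

theorem zero_notMem_dualSector {θ₁ θ₂ Λ : ℝ} (hΛ : 0 ≤ Λ) : (0 : ℂ) ∉ dualSector θ₁ θ₂ Λ := by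
  rintro ⟨θ, _, h⟩
  simp only [freqHalfPlane, mul_zero, Complex.zero_re, mem_ofPred_eq] at h
  linarith

theorem frontier_dualSector_nonempty {θ₁ θ₂ Λ : ℝ} (hΛ : 0 ≤ Λ) {z : ℂ}
    (hz : z ∈ dualSector θ₁ θ₂ Λ) : (frontier (dualSector θ₁ θ₂ Λ)).Nonempty := by
  rw [nonempty_iff_ne_empty, Ne, ← isClopen_iff_frontier_eq_empty, isClopen_iff]
  rintro (h | h)
  · rw [h] at hz; exact hz
  · exact zero_notMem_dualSector hΛ (h ▸ mem_univ (0 : ℂ))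

theorem sub_le_infDist_frontier_dualSector {θ₁ θ₂ Λ θ : ℝ} (hΛ : 0 ≤ Λ) (hθ : θ ∈ Ioo θ₁ θ₂) {z : ℂ}
    (hz : z ∈ freqHalfPlane θ Λ) : (Complex.exp (θ * Complex.I) * z).re - Λ ≤
      Metric.infDist z (frontier (dualSector θ₁ θ₂ Λ)) := by
  have hzS : z ∈ dualSector θ₁ θ₂ Λ := ⟨θ, hθ, hz⟩
  refine (Metric.le_infDist (frontier_dualSector_nonempty hΛ hzS)).2 fun y hy => ?_
  by_contra hlt
  rw [not_le] at hlt
  have hyS : y ∈ dualSector θ₁ θ₂ Λ := by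
    refine ⟨θ, hθ, ?_⟩
    have h1 : (Complex.exp (θ * Complex.I) * (z - y)).re ≤ dist z y := by
      refine (Complex.re_le_norm _).trans_eq ?_
      rw [norm_exp_ofReal_mul_I_mul, dist_eq_norm]
    rw [mul_sub, Complex.sub_re] at h1
    rw [freqHalfPlane, mem_ofPred_eq]
    linarith
  rw [(isOpen_dualSector θ₁ θ₂ Λ).frontier_eq] at hy
  exact hy.2 hyS

theorem IsPreconnected.exists_mem_frontier {X : Type*} [TopologicalSpace X] {s t : Set X}
    (ht : IsPreconnected t) (hs : IsOpen s) {x y : X} (hx : x ∈ t) (hxs : x ∈ s) (hy : y ∈ t)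
    (hys : y ∉ s) : ∃ p ∈ t, p ∈ frontier s := by
  by_contra! hcon
  have hcover : ∀ p ∈ t, p ∉ s → p ∉ closure s := fun p hp hps hpc =>
    hcon p hp (by rw [hs.frontier_eq]; exact ⟨hpc, hps⟩)
  obtain ⟨p, _, hp, hp'⟩ := ht s (closure s)ᶜ hs isClosed_closure.isOpen_compl
    (fun p hp => or_iff_not_imp_left.2 fun hps => hcover p hp hps) ⟨x, hx, hxs⟩
    ⟨y, hy, hcover y hy hys⟩
  exact hp' (subset_closure hp)

/-- Move `z` perpendicularly to the line `Re(e^{iθ}z) = Λ` of the optimal angle. At angle `θ + δ`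
the endpoint has projection `Λ cos δ + g sin δ`, where `g` is the derivative of the projection of
`z` at `θ`. Maximality gives `g δ ≤ 0`, and `|δ| ≤ π` gives `sin δ` the sign of `δ`, so this is at
most `Λ`. The endpoint is outside the union, and the segment to it crosses the frontier. -/
theorem exists_frontier_dist_le {θ₁ θ₂ Λ θ : ℝ} (hπ : θ₂ - θ₁ ≤ Real.pi) (hΛ : 0 ≤ Λ)
    {z : ℂ} (hz : z ∈ dualSector θ₁ θ₂ Λ) (hθ : θ ∈ Icc θ₁ θ₂)
    (hmax : ∀ y ∈ Icc θ₁ θ₂,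
      (Complex.exp (y * Complex.I) * z).re ≤ (Complex.exp (θ * Complex.I) * z).re) :
    Metric.infDist z (frontier (dualSector θ₁ θ₂ Λ)) ≤
      (Complex.exp (θ * Complex.I) * z).re - Λ := by
  set f : ℝ → ℝ := fun y => Real.cos y * z.re - Real.sin y * z.im with hf
  simp only [re_exp_mul_I_mul] at hmax ⊢
  set m := f θ - Λ with hm
  have hm0 : 0 < m := by
    obtain ⟨y, hy, hzy⟩ := hz
    rw [freqHalfPlane, mem_ofPred_eq, re_exp_mul_I_mul] at hzy
    have := hmax y ⟨hy.1.le, hy.2.le⟩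
    simp only [hm, hf]
    linarith
  set y₀ : ℂ := z - m * Complex.exp ((-θ : ℝ) * Complex.I) with hy₀
  set g : ℝ := -Real.sin θ * z.re - Real.cos θ * z.im with hg
  have hy₀S : y₀ ∉ dualSector θ₁ θ₂ Λ := by
    rintro ⟨y, hy, hyy⟩
    rw [freqHalfPlane, mem_ofPred_eq, hy₀, mul_sub, Complex.sub_re, re_exp_mul_I_mul,
      mul_left_comm, Complex.re_ofReal_mul, ← Complex.exp_add, ← add_mul, ← Complex.ofReal_add,
      Complex.exp_ofReal_mul_I_re] at hyy
    obtain ⟨δ, hδ⟩ : ∃ δ, δ = y + -θ := ⟨_, rfl⟩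
    rw [← hδ] at hyy
    have hyθ : y = θ + δ := by rw [hδ]; ring
    have hexp : Real.cos y * z.re - Real.sin y * z.im = f θ * Real.cos δ + g * Real.sin δ := by
      rw [hyθ, Real.cos_add, Real.sin_add]
      simp only [hf, hg]
      ring
    have hgδ : g * δ ≤ 0 := by
      have hd : HasDerivAt (fun s : ℝ => f (θ + s * δ)) (g * δ) 0 := by
        have h1 : HasDerivAt (fun s : ℝ => θ + s * δ) δ 0 := by
          simpa using ((hasDerivAt_id (0 : ℝ)).mul_const δ).const_add θ
        have h2 := (h1.cos.mul_const z.re).sub (h1.sin.mul_const z.im)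
        refine h2.congr_deriv ?_
        simp only [hg, zero_mul, add_zero]
        ring
      refine le_of_tendsto hd.tendsto_slope_zero_right ?_
      filter_upwards [Ioc_mem_nhdsGT (zero_lt_one' ℝ)] with s hs
      have hmem : θ + s * δ ∈ Icc θ₁ θ₂ := by
        have := (convex_Icc θ₁ θ₂).add_smul_sub_mem hθ ⟨hy.1.le, hy.2.le⟩ ⟨hs.1.le, hs.2⟩
        rwa [smul_eq_mul, sub_eq_add_neg, ← hδ] at this
      have h1 := hmax _ hmem
      simp only [zero_add, zero_mul, add_zero, smul_eq_mul]
      exact mul_nonpos_of_nonneg_of_nonpos (inv_nonneg.2 hs.1.le) (sub_nonpos.2 h1)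
    have hgs : g * Real.sin δ ≤ 0 := by
      have hδ1 : δ ≤ Real.pi := by linarith [hy.2, hθ.1]
      have hδ2 : -Real.pi ≤ δ := by linarith [hy.1, hθ.2]
      rcases lt_trichotomy δ 0 with h | h | h
      · have h1 : 0 ≤ g := nonneg_of_mul_nonpos_left hgδ h
        exact mul_nonpos_of_nonneg_of_nonpos h1
          (Real.sin_nonpos_of_nonpos_of_neg_pi_le h.le hδ2)
      · simp [h]
      · have h1 : g ≤ 0 := nonpos_of_mul_nonpos_left hgδ h
        exact mul_nonpos_of_nonpos_of_nonneg h1 (Real.sin_nonneg_of_nonneg_of_le_pi h.le hδ1)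
    rw [hexp] at hyy
    have : f θ * Real.cos δ - m * Real.cos δ = Λ * Real.cos δ := by rw [hm]; ring
    nlinarith [Real.cos_le_one δ]
  obtain ⟨p, hp, hpf⟩ := (convex_segment z y₀).isPreconnected.exists_mem_frontier
    (isOpen_dualSector θ₁ θ₂ Λ) (left_mem_segment ℝ z y₀) hz (right_mem_segment ℝ z y₀) hy₀S
  refine (Metric.infDist_le_dist_of_mem hpf).trans ?_
  rw [dist_comm, dist_eq_norm]
  refine (norm_sub_le_of_mem_segment hp).trans_eq ?_
  rw [hy₀, sub_sub_cancel_left, norm_neg, norm_ofReal_mul_exp _ hm0.le]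

theorem infDist_frontier_dualSector_pos {θ₁ θ₂ Λ : ℝ} (hΛ : 0 ≤ Λ) {z : ℂ}
    (hz : z ∈ dualSector θ₁ θ₂ Λ) : 0 < Metric.infDist z (frontier (dualSector θ₁ θ₂ Λ)) := by
  obtain ⟨θ, hθ, hzθ⟩ := hz
  have h : Λ < (Complex.exp (θ * Complex.I) * z).re := hzθ
  linarith [sub_le_infDist_frontier_dualSector hΛ hθ hzθ]

/-- Bounds by powers of the distances to the boundaries of the half-planes are bounds by powers of
the distance to the boundary of their union. -/
theorem le_infDist_rpow_of_forall {θ₁ θ₂ Λ σ C e : ℝ} (hθ : θ₁ < θ₂) (hπ : θ₂ - θ₁ ≤ Real.pi)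
    (hΛ : 0 ≤ Λ) (hσ : σ ≤ 0) (hC : 0 ≤ C) {z : ℂ} (hz : z ∈ dualSector θ₁ θ₂ Λ)
    (h : ∀ θ ∈ Ioo θ₁ θ₂, z ∈ freqHalfPlane θ Λ →
      e ≤ C * ((Complex.exp (θ * Complex.I) * z).re - Λ) ^ σ) :
    e ≤ C * Metric.infDist z (frontier (dualSector θ₁ θ₂ Λ)) ^ σ := by
  set f : ℝ → ℝ := fun y => (Complex.exp (y * Complex.I) * z).re with hf
  have hfc : Continuous f := Complex.continuous_re.comp (by fun_prop)
  obtain ⟨θ, hθmem, hmax⟩ := isCompact_Icc.exists_isMaxOn (nonempty_Icc.2 hθ.le) hfc.continuousOn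
  have hdist := exists_frontier_dist_le hπ hΛ hz hθmem fun y hy => hmax hy
  have hpos := infDist_frontier_dualSector_pos hΛ hz
  have hm : 0 < f θ - Λ := hpos.trans_le hdist
  have hstep : e ≤ C * (f θ - Λ) ^ σ := by
    -- The maximising angle may be an endpoint of the closed interval, where `h` is not available;
    -- the bound there is a limit from inside.
    have hne : (𝓝[Ioo θ₁ θ₂] θ).NeBot := by
      rw [← mem_closure_iff_nhdsWithin_neBot, closure_Ioo hθ.ne]
      exact hθmem
    have hcont : ContinuousAt (fun y => C * (f y - Λ) ^ σ) θ :=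
      continuousAt_const.mul ((hfc.continuousAt.sub continuousAt_const).rpow_const (Or.inl hm.ne'))
    refine ge_of_tendsto (hcont.mono_left (nhdsWithin_le_nhds (s := Ioo θ₁ θ₂))) ?_
    filter_upwards [self_mem_nhdsWithin,
      nhdsWithin_le_nhds (hfc.continuousAt.eventually_const_lt (sub_pos.1 hm))] with y hy hy2
    exact h y hy hy2
  refine hstep.trans (mul_le_mul_of_nonneg_left ?_ hC)
  exact Real.rpow_le_rpow_of_nonpos hpos hdist hσ

/-! ### Independence of the direction -/

section Rotation

variable {τ α z : ℂ} {h : ℂ → ℂ} {θ θ' θ₁ θ₂ C Λ : ℝ}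

/-- The Laplace integrand in the logarithmic coordinate. -/
noncomputable def logIntegrand (τ : ℂ) (h : ℂ → ℂ) (z w : ℂ) : ℂ :=
  Complex.exp (-z * Complex.exp w) * Complex.exp (τ * w) * h (Complex.exp w)

/-- With `t = e^x` the ray becomes the horizontal line of height `θ`, and `u^{τ-1} du` becomes
`e^{τw} dw`, which is entire: no branch of the power has to be followed between rays. -/
theorem exp_smul_rayIntegrand (x : ℝ) :
    |Real.exp x| • (Complex.exp (-z * rayPoint α θ (Real.exp x)) * rayDensity τ θ h (Real.exp x) *
      Complex.exp (θ * Complex.I)) =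
      Complex.exp (-z * α) * logIntegrand τ h z (x + θ * Complex.I) := by
  have h1 : Complex.exp (x + θ * Complex.I) = (Real.exp x : ℂ) * Complex.exp (θ * Complex.I) := by
    rw [Complex.exp_add, Complex.ofReal_exp]
  have h2 : (Real.exp x : ℂ) ^ (τ - 1) = Complex.exp (x * (τ - 1)) := by
    rw [Complex.cpow_def_of_ne_zero (Complex.ofReal_ne_zero.2 (Real.exp_pos x).ne'),
      ← Complex.ofReal_log (Real.exp_pos x).le, Real.log_exp]
  rw [logIntegrand, h1, abs_of_pos (Real.exp_pos x), Complex.real_smul, rayDensity, h2, rayPoint,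
    mul_add, Complex.exp_add]
  have h3 : Complex.exp (τ * (x + θ * Complex.I)) = (Real.exp x : ℂ) *
      (Complex.exp (θ * (τ - 1) * Complex.I) * Complex.exp (x * (τ - 1)) *
        Complex.exp (θ * Complex.I)) := by
    rw [Complex.ofReal_exp, ← Complex.exp_add, ← Complex.exp_add, ← Complex.exp_add]
    congr 1; ring
  rw [h3]
  ring

theorem rayIntegral_eq_integral_logIntegrand (hb : IsLaplaceIntegrable Λ (rayDensity τ θ h))
    (hz : z ∈ freqHalfPlane θ Λ) :
    Integrable (fun x : ℝ => logIntegrand τ h z (x + θ * Complex.I)) ∧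
      rayIntegral α θ (rayDensity τ θ h) z =
        Complex.exp (-z * α) * ∫ x : ℝ, logIntegrand τ h z (x + θ * Complex.I) := by
  have himg : Real.exp '' univ = Ioi 0 := by rw [image_univ, Real.range_exp]
  have hd : ∀ x ∈ (univ : Set ℝ), HasDerivWithinAt Real.exp (Real.exp x) univ x :=
    fun x _ => (Real.hasDerivAt_exp x).hasDerivWithinAt
  have hinj : InjOn Real.exp univ := Real.exp_injective.injOn
  constructor
  · have h1 := hb.integrableOn α hz
    rw [← himg, integrableOn_image_iff_integrableOn_abs_deriv_smul MeasurableSet.univ hd hinj,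
      integrableOn_univ] at h1
    simp only [exp_smul_rayIntegrand] at h1
    exact (integrable_const_mul_iff (isUnit_iff_ne_zero.2 (Complex.exp_ne_zero _)) _).1 h1
  · rw [rayIntegral, ← himg, integral_image_eq_integral_abs_deriv_smul MeasurableSet.univ hd hinj,
      setIntegral_univ]
    simp only [exp_smul_rayIntegrand]
    rw [integral_const_mul]

theorem norm_logIntegrand_le (hb : ∀ u ∈ openSector 0 θ₁ θ₂, ‖h u‖ ≤ C * Real.exp (Λ * ‖u‖))
    {x y m Y : ℝ} (hy : y ∈ Ioo θ₁ θ₂) (hY : |y| ≤ Y)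
    (hm : m ≤ (Complex.exp (y * Complex.I) * z).re) :
    ‖logIntegrand τ h z (x + y * Complex.I)‖ ≤ Real.exp (|τ.im| * Y) * C *
      (Real.exp x ^ τ.re * Real.exp (-(m - Λ) * Real.exp x)) := by
  have h1 : Complex.exp (x + y * Complex.I) = (Real.exp x : ℂ) * Complex.exp (y * Complex.I) := by
    rw [Complex.exp_add, Complex.ofReal_exp]
  have hx := Real.exp_pos x
  have h2 := hb _ (ray_mem_openSector hy hx)
  rw [norm_ofReal_mul_exp y hx.le] at h2
  have h3 : ‖Complex.exp (-z * Complex.exp (x + y * Complex.I))‖ ≤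
      Real.exp (-(m * Real.exp x)) := by
    rw [Complex.norm_exp, Real.exp_le_exp, h1]
    have : -z * ((Real.exp x : ℂ) * Complex.exp (y * Complex.I)) =
        -((Real.exp x : ℂ) * (Complex.exp (y * Complex.I) * z)) := by ring
    rw [this, Complex.neg_re, Complex.re_ofReal_mul]
    nlinarith
  have h4 : ‖Complex.exp (τ * (x + y * Complex.I))‖ ≤
      Real.exp x ^ τ.re * Real.exp (|τ.im| * Y) := by
    rw [Complex.norm_exp, ← Real.exp_mul, ← Real.exp_add, Real.exp_le_exp]
    have h5 : (τ * (x + y * Complex.I)).re = x * τ.re - τ.im * y := by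
      simp [Complex.mul_re]; ring
    rw [h5]
    have h6 : -(τ.im * y) ≤ |τ.im| * Y := by
      refine (neg_le_abs _).trans ?_
      rw [abs_mul]
      gcongr
    linarith
  rw [logIntegrand, norm_mul, norm_mul]
  calc ‖Complex.exp (-z * Complex.exp (x + y * Complex.I))‖ *
        ‖Complex.exp (τ * (x + y * Complex.I))‖ * ‖h (Complex.exp (x + y * Complex.I))‖
      ≤ Real.exp (-(m * Real.exp x)) * (Real.exp x ^ τ.re * Real.exp (|τ.im| * Y)) *
        (C * Real.exp (Λ * Real.exp x)) := by
        rw [h1] at *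
        refine mul_le_mul (mul_le_mul h3 h4 (norm_nonneg _) (Real.exp_pos _).le) h2
          (norm_nonneg _) (by positivity)
    _ = Real.exp (|τ.im| * Y) * C * (Real.exp x ^ τ.re *
        (Real.exp (-(m * Real.exp x)) * Real.exp (Λ * Real.exp x))) := by ring
    _ = _ := by rw [← Real.exp_add]; ring_nf

/-- Cauchy's theorem on the rectangles `[-N, N] × [θ, θ']` in the logarithmic coordinate. The right
side tends to `0` because `Re(e^{iy}z)` exceeds `Λ` uniformly between the two angles
(`le_re_exp_mul_I_mul`). The left side tends to `0` because of the factor `e^{x Re τ}`. -/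
theorem rayIntegral_eq_of_lt (hτ : 0 < τ.re) (hh : DifferentiableOn ℂ h (openSector 0 θ₁ θ₂))
    (hb : ∀ u ∈ openSector 0 θ₁ θ₂, ‖h u‖ ≤ C * Real.exp (Λ * ‖u‖)) (hΛ : 0 ≤ Λ)
    (hθ : θ ∈ Ioo θ₁ θ₂) (hθ' : θ' ∈ Ioo θ₁ θ₂) (hlt : θ < θ') (hπ : θ' - θ < Real.pi)
    (hz : z ∈ freqHalfPlane θ Λ) (hz' : z ∈ freqHalfPlane θ' Λ) :
    rayIntegral α θ (rayDensity τ θ h) z = rayIntegral α θ' (rayDensity τ θ' h) z := by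
  obtain ⟨i1, e1⟩ := rayIntegral_eq_integral_logIntegrand (α := α)
    (isLaplaceIntegrable_rayDensity hτ hh.continuousOn hb hθ) hz
  obtain ⟨i2, e2⟩ := rayIntegral_eq_integral_logIntegrand (α := α)
    (isLaplaceIntegrable_rayDensity hτ hh.continuousOn hb hθ') hz'
  rw [e1, e2]
  congr 1
  set G := logIntegrand τ h z with hG
  set m := min (Complex.exp (θ * Complex.I) * z).re (Complex.exp (θ' * Complex.I) * z).re with hm
  have hmΛ : Λ < m := lt_min hz hz'
  set Y := max |θ| |θ'| with hY
  have hIcc : Icc θ θ' ⊆ Ioo θ₁ θ₂ := fun y hy => ⟨hθ.1.trans_le hy.1, hy.2.trans_lt hθ'.2⟩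
  have hbound : ∀ x : ℝ, ∀ y ∈ Icc θ θ', ‖G (x + y * Complex.I)‖ ≤ Real.exp (|τ.im| * Y) * C *
      (Real.exp x ^ τ.re * Real.exp (-(m - Λ) * Real.exp x)) := fun x y hy =>
    norm_logIntegrand_le hb (hIcc hy) (abs_le_max_abs_abs hy.1 hy.2)
      (le_re_exp_mul_I_mul (hΛ.trans hmΛ.le) hlt hπ (min_le_left _ _) (min_le_right _ _) hy)
  have hGd : ∀ w : ℂ, w.im ∈ Icc θ θ' → DifferentiableAt ℂ G w := by
    intro w hw
    have hmem : Complex.exp w ∈ openSector 0 θ₁ θ₂ := by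
      rw [openSector_zero_eq]
      exact ⟨w, hIcc hw, rfl⟩
    have h1 : DifferentiableAt ℂ (fun w => h (Complex.exp w)) w :=
      DifferentiableAt.comp w (hh.differentiableAt
        ((isOpen_openSector_zero _ _).mem_nhds hmem)) Complex.differentiableAt_exp
    have h2 : DifferentiableAt ℂ (fun w => Complex.exp (-z * Complex.exp w) *
      Complex.exp (τ * w)) w := by fun_prop
    exact h2.mul h1
  have hside : ∀ x : ℝ, ‖∫ y in θ..θ', G (x + y * Complex.I)‖ ≤ Real.exp (|τ.im| * Y) * C *
      (Real.exp x ^ τ.re * Real.exp (-(m - Λ) * Real.exp x)) * |θ' - θ| := fun x => by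
    refine intervalIntegral.norm_integral_le_of_norm_le_const fun y hy => hbound x y ?_
    rw [uIoc_of_le hlt.le] at hy
    exact ⟨hy.1.le, hy.2⟩
  have htop : Tendsto (fun x : ℝ => Real.exp x ^ τ.re * Real.exp (-(m - Λ) * Real.exp x)) atTop
      (𝓝 0) :=
    (tendsto_rpow_mul_exp_neg_mul_atTop_nhds_zero _ _ (sub_pos.2 hmΛ)).comp Real.tendsto_exp_atTop
  have hbot : Tendsto (fun x : ℝ => Real.exp x ^ τ.re * Real.exp (-(m - Λ) * Real.exp x)) atBot
      (𝓝 0) := by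
    have h1 : ContinuousAt (fun t : ℝ => t ^ τ.re * Real.exp (-(m - Λ) * t)) 0 :=
      (Real.continuousAt_rpow_const _ _ (Or.inr hτ.le)).mul (by fun_prop)
    have h2 := h1.tendsto.comp Real.tendsto_exp_atBot
    simpa [Function.comp_def, Real.zero_rpow hτ.ne'] using h2
  have hvanish : ∀ {l : Filter ℝ}, Tendsto (fun x : ℝ => Real.exp x ^ τ.re *
      Real.exp (-(m - Λ) * Real.exp x)) l (𝓝 0) →
      Tendsto (fun x : ℝ => ∫ y in θ..θ', G (x + y * Complex.I)) l (𝓝 0) := by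
    intro l hl
    refine squeeze_zero_norm hside ?_
    simpa using (hl.const_mul (Real.exp (|τ.im| * Y) * C)).mul_const |θ' - θ|
  have hrect : ∀ N : ℝ, (∫ x in (-N)..N, G (x + θ * Complex.I)) -
      (∫ x in (-N)..N, G (x + θ' * Complex.I)) =
      Complex.I * (∫ y in θ..θ', G ((-N : ℝ) + y * Complex.I)) -
        Complex.I * ∫ y in θ..θ', G (N + y * Complex.I) := by
    intro N
    have h1 := Complex.integral_boundary_rect_eq_zero_of_differentiableOn G
      ((-N : ℝ) + θ * Complex.I) (N + θ' * Complex.I) (fun w hw => by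
        refine (hGd w ?_).differentiableWithinAt
        have := hw.2
        simpa [uIcc_of_le hlt.le] using this)
    simp only [Complex.add_re, Complex.ofReal_re, Complex.mul_re, Complex.I_re, mul_zero,
      Complex.ofReal_im, Complex.I_im, mul_one, sub_self, add_zero, Complex.add_im,
      Complex.mul_im, zero_add, smul_eq_mul] at h1
    linear_combination h1
  have hlim : Tendsto (fun N : ℝ => (∫ x in (-N)..N, G (x + θ * Complex.I)) -
      (∫ x in (-N)..N, G (x + θ' * Complex.I))) atTop
      (𝓝 ((∫ x : ℝ, G (x + θ * Complex.I)) - ∫ x : ℝ, G (x + θ' * Complex.I))) :=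
    (intervalIntegral_tendsto_integral i1 tendsto_neg_atTop_atBot tendsto_id).sub
      (intervalIntegral_tendsto_integral i2 tendsto_neg_atTop_atBot tendsto_id)
  have hlim0 : Tendsto (fun N : ℝ => (∫ x in (-N)..N, G (x + θ * Complex.I)) -
      (∫ x in (-N)..N, G (x + θ' * Complex.I))) atTop (𝓝 0) := by
    simp only [hrect]
    have h1 := ((hvanish hbot).comp tendsto_neg_atTop_atBot).const_mul Complex.I
    have h2 := (hvanish htop).const_mul Complex.I
    simpa [Function.comp_def] using h1.sub h2
  exact sub_eq_zero.1 (tendsto_nhds_unique hlim hlim0)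

theorem rayIntegral_eq (hτ : 0 < τ.re) (hh : DifferentiableOn ℂ h (openSector 0 θ₁ θ₂))
    (hb : ∀ u ∈ openSector 0 θ₁ θ₂, ‖h u‖ ≤ C * Real.exp (Λ * ‖u‖)) (hΛ : 0 ≤ Λ)
    (hπ : θ₂ - θ₁ ≤ Real.pi) (hθ : θ ∈ Ioo θ₁ θ₂) (hθ' : θ' ∈ Ioo θ₁ θ₂)
    (hz : z ∈ freqHalfPlane θ Λ) (hz' : z ∈ freqHalfPlane θ' Λ) :
    rayIntegral α θ (rayDensity τ θ h) z = rayIntegral α θ' (rayDensity τ θ' h) z := by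
  rcases lt_trichotomy θ θ' with hlt | rfl | hlt
  · exact rayIntegral_eq_of_lt hτ hh hb hΛ hθ hθ' hlt (by linarith [hθ.1, hθ'.2]) hz hz'
  · rfl
  · exact (rayIntegral_eq_of_lt hτ hh hb hΛ hθ' hθ hlt (by linarith [hθ'.1, hθ.2]) hz' hz).symm

end Rotation

/-! ### The branch of the power -/

/-- A number of positive real part has argument in `(-π/2, π/2)`, so a rotation by at most `π/2`
does not cross the cut. An opening of at most `π` keeps every admissible angle this close to the
middle one. -/
theorem log_rotate {θ φ : ℝ} {z : ℂ} (hz : 0 < (Complex.exp (θ * Complex.I) * z).re)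
    (h : |θ - φ| ≤ Real.pi / 2) :
    Complex.log (z * Complex.exp (φ * Complex.I)) =
      Complex.log (Complex.exp (θ * Complex.I) * z) - (θ - φ : ℝ) * Complex.I := by
  set w := Complex.exp (θ * Complex.I) * z with hw
  have hw0 : w ≠ 0 := by intro h0; rw [h0] at hz; simp at hz
  have harg : |w.arg| < Real.pi / 2 := Complex.abs_arg_lt_pi_div_two_iff.2 (Or.inl hz)
  rw [abs_lt] at harg
  rw [abs_le] at h
  have him : (Complex.log w - (θ - φ : ℝ) * Complex.I).im = w.arg - (θ - φ) := by
    rw [Complex.sub_im, Complex.log_im, Complex.mul_im]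
    simp
  rw [← Complex.log_exp (x := Complex.log w - (θ - φ : ℝ) * Complex.I)
    (by rw [him]; linarith) (by rw [him]; linarith), Complex.exp_sub, Complex.exp_log hw0, hw]
  congr 1
  rw [eq_div_iff (Complex.exp_ne_zero _), mul_assoc, ← Complex.exp_add, mul_comm]
  congr 2
  push_cast
  ring

theorem branchPow_eq {θ θ₁ θ₂ : ℝ} (hπ : θ₂ - θ₁ ≤ Real.pi) (hθ : θ ∈ Ioo θ₁ θ₂) (s : ℂ) {z : ℂ}
    (hz : 0 < (Complex.exp (θ * Complex.I) * z).re) :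
    branchPow (-((θ₁ + θ₂) / 2)) s z =
      Complex.exp (s * (Complex.log (Complex.exp (θ * Complex.I) * z) - θ * Complex.I)) := by
  have h := log_rotate (φ := (θ₁ + θ₂) / 2) hz (by
    rw [abs_le]; constructor <;> linarith [hθ.1, hθ.2])
  have e : -(((-((θ₁ + θ₂) / 2) : ℝ) : ℂ) * Complex.I) = (((θ₁ + θ₂) / 2 : ℝ) : ℂ) * Complex.I := by
    push_cast; ring
  rw [branchPow, e, h]
  congr 2
  push_cast
  ring

theorem differentiableAt_branchPow {θ θ₁ θ₂ Λ : ℝ} (hπ : θ₂ - θ₁ ≤ Real.pi) (hΛ : 0 ≤ Λ)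
    (hθ : θ ∈ Ioo θ₁ θ₂) (s : ℂ) {z : ℂ} (hz : z ∈ freqHalfPlane θ Λ) :
    DifferentiableAt ℂ (branchPow (-((θ₁ + θ₂) / 2)) s) z := by
  have h : branchPow (-((θ₁ + θ₂) / 2)) s =ᶠ[𝓝 z] fun z =>
      Complex.exp (s * (Complex.log (Complex.exp (θ * Complex.I) * z) - θ * Complex.I)) := by
    filter_upwards [(isOpen_freqHalfPlane θ Λ).mem_nhds hz] with w hw
    exact branchPow_eq hπ hθ s (hΛ.trans_lt hw)
  have hz' : Λ < (Complex.exp (θ * Complex.I) * z).re := hz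
  refine DifferentiableAt.congr_of_eventuallyEq ?_ h
  have h1 : DifferentiableAt ℂ (fun z => Complex.log (Complex.exp (θ * Complex.I) * z)) z :=
    DifferentiableAt.clog (by fun_prop) (Or.inl (hΛ.trans_lt hz'))
  exact (((h1.sub_const _).const_mul _).cexp)

theorem branchPow_ray (θ : ℝ) (s : ℂ) {t : ℝ} (ht : 0 < t) :
    branchPow θ s (t * Complex.exp (θ * Complex.I)) =
      Complex.exp (θ * s * Complex.I) * (t : ℂ) ^ s := by
  have e : (t : ℂ) * Complex.exp (θ * Complex.I) * Complex.exp (-(θ * Complex.I)) = t := by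
    rw [mul_assoc, ← Complex.exp_add, add_neg_cancel, Complex.exp_zero, mul_one]
  rw [branchPow, e, Complex.cpow_def_of_ne_zero (Complex.ofReal_ne_zero.2 ht.ne'),
    ← Complex.exp_add]
  congr 1
  ring

/-! ### The error term -/

theorem exists_norm_sub_one_le {U : Set ℂ} {h : ℂ → ℂ} (hU : U ∈ 𝓝 (0 : ℂ))
    (hh : DifferentiableOn ℂ h U) (hh0 : h 0 = 1) {C Λ : ℝ} (hC : 0 ≤ C) (hΛ : 0 ≤ Λ)
    (hb : ∀ u ∈ U, ‖h u‖ ≤ C * Real.exp (Λ * ‖u‖)) :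
    ∃ D : ℝ, 0 ≤ D ∧ ∀ u ∈ U, ‖h u - 1‖ ≤ D * (‖u‖ * Real.exp (Λ * ‖u‖)) := by
  have hO := (hh.differentiableAt hU).isBigO_sub
  obtain ⟨k, hk⟩ := hO.bound
  obtain ⟨ε, hε, hball⟩ := Metric.eventually_nhds_iff_ball.1 hk
  refine ⟨max k ((C + 1) / ε), le_max_of_le_right (by positivity), fun u hu => ?_⟩
  have hexp : 1 ≤ Real.exp (Λ * ‖u‖) := Real.one_le_exp (by positivity)
  by_cases hue : u ∈ Metric.ball (0 : ℂ) ε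
  · have h1 := hball u hue
    rw [hh0, sub_zero] at h1
    refine h1.trans ?_
    have h2 : ‖u‖ ≤ ‖u‖ * Real.exp (Λ * ‖u‖) := le_mul_of_one_le_right (norm_nonneg _) hexp
    calc k * ‖u‖ ≤ max k ((C + 1) / ε) * ‖u‖ := by gcongr; exact le_max_left _ _
      _ ≤ _ := mul_le_mul_of_nonneg_left h2 (le_max_of_le_right (by positivity))
  · rw [mem_ball_zero_iff, not_lt] at hue
    have h1 : ‖h u - 1‖ ≤ (C + 1) * Real.exp (Λ * ‖u‖) := by
      refine (norm_sub_le _ _).trans ?_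
      rw [norm_one]
      linarith [hb u hu]
    refine h1.trans ?_
    calc (C + 1) * Real.exp (Λ * ‖u‖) = (C + 1) / ε * (ε * Real.exp (Λ * ‖u‖)) := by field_simp
      _ ≤ max k ((C + 1) / ε) * (‖u‖ * Real.exp (Λ * ‖u‖)) := by
        refine mul_le_mul (le_max_right _ _) ?_ (by positivity)
          (le_max_of_le_right (by positivity))
        gcongr

/-- `Γ(τ) z^{-τ}` is the same Laplace integral with `h` replaced by `1`. The zero of `h - 1` at the
tip raises the exponent from `Re τ` to `Re τ + 1`. The angle enters the constant only through `Y`,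
so the bounds from all directions can be combined. -/
theorem norm_exp_mul_rayIntegral_sub_le {τ α z : ℂ} {h : ℂ → ℂ} {θ θ₁ θ₂ D Λ Y : ℝ}
    (hτ : 0 < τ.re) (hπ : θ₂ - θ₁ ≤ Real.pi) (hΛ : 0 ≤ Λ)
    (hb : IsLaplaceIntegrable Λ (rayDensity τ θ h))
    (hh1 : ∀ u ∈ openSector 0 θ₁ θ₂, ‖h u - 1‖ ≤ D * (‖u‖ * Real.exp (Λ * ‖u‖)))
    (hθ : θ ∈ Ioo θ₁ θ₂) (hY : |θ| ≤ Y) (hz : z ∈ freqHalfPlane θ Λ) :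
    ‖Complex.exp (α * z) * rayIntegral α θ (rayDensity τ θ h) z -
        Complex.Gamma τ * branchPow (-((θ₁ + θ₂) / 2)) (-τ) z‖ ≤
      Real.exp (Y * |τ.im|) * D * Real.Gamma (τ.re + 1) *
        ((Complex.exp (θ * Complex.I) * z).re - Λ) ^ (-τ.re - 1) := by
  set w := Complex.exp (θ * Complex.I) * z with hw
  have hwΛ : Λ < w.re := hz
  have hw0 : 0 < w.re := hΛ.trans_lt hwΛ
  have hwne : w ≠ 0 := by intro h0; rw [h0] at hw0; simp at hw0
  have e1 : Complex.exp (α * z) * rayIntegral α θ (rayDensity τ θ h) z =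
      ∫ t in Ioi (0 : ℝ), Complex.exp (-(w * t)) * (Complex.exp (θ * Complex.I) *
        rayDensity τ θ h t) := by
    rw [rayIntegral, ← integral_const_mul]
    congr 1; ext t
    have : Complex.exp (-(w * t)) = Complex.exp (α * z) * Complex.exp (-z * rayPoint α θ t) := by
      rw [← Complex.exp_add]; congr 1; rw [rayPoint, hw]; ring
    rw [this]; ring
  have e2 : Complex.Gamma τ * branchPow (-((θ₁ + θ₂) / 2)) (-τ) z =
      ∫ t in Ioi (0 : ℝ), Complex.exp (-(w * t)) * (Complex.exp (θ * τ * Complex.I) *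
        (t : ℂ) ^ (τ - 1)) := by
    have h1 := integral_exp_neg_mul_cpow hτ hw0
    have h2 : ∀ t : ℝ, Complex.exp (-(w * t)) * (Complex.exp (θ * τ * Complex.I) *
        (t : ℂ) ^ (τ - 1)) = Complex.exp (θ * τ * Complex.I) *
        (Complex.exp (-(w * t)) * (t : ℂ) ^ (τ - 1)) := fun t => by ring
    simp only [h2]
    rw [integral_const_mul, h1, branchPow_eq hπ hθ _ hw0, ← hw,
      Complex.cpow_def_of_ne_zero hwne, ← mul_assoc, ← Complex.exp_add, mul_comm]
    congr 2; ring
  have i1 : IntegrableOn (fun t : ℝ => Complex.exp (-(w * t)) * (Complex.exp (θ * Complex.I) *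
      rayDensity τ θ h t)) (Ioi 0) := (hb.const_mul _).integrableOn_exp_mul hwΛ
  have i2 : IntegrableOn (fun t : ℝ => Complex.exp (-(w * t)) * (Complex.exp (θ * τ * Complex.I) *
      (t : ℂ) ^ (τ - 1))) (Ioi 0) :=
    ((isLaplaceIntegrable_cpow hτ).const_mul _).integrableOn_exp_mul hw0
  rw [e1, e2, ← integral_sub i1 i2]
  have hd : 0 < w.re - Λ := by linarith
  have hint : IntegrableOn (fun t : ℝ => Real.exp (Y * |τ.im|) * D *
      (t ^ ((τ.re + 1) - 1) * Real.exp (-((w.re - Λ) * t)))) (Ioi 0) := by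
    have := (integrableOn_rpow_mul_exp_neg_mul_rpow (s := (τ.re + 1) - 1) (p := 1)
      (b := w.re - Λ) (by linarith) one_pos hd).const_mul (Real.exp (Y * |τ.im|) * D)
    simp only [Real.rpow_one, neg_mul] at this
    exact this
  refine (norm_integral_le_of_norm_le hint ((ae_restrict_iff' measurableSet_Ioi).2
    (Eventually.of_forall fun t ht => ?_))).trans_eq ?_
  · have ht0 : (0 : ℝ) < t := ht
    have hu := hh1 _ (ray_mem_openSector hθ ht0)
    rw [norm_ofReal_mul_exp θ ht0.le] at hu
    have h3 : Complex.exp (θ * Complex.I) * rayDensity τ θ h t =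
        Complex.exp (θ * τ * Complex.I) * ((t : ℂ) ^ (τ - 1) *
          h (t * Complex.exp (θ * Complex.I))) := by
      rw [rayDensity, ← mul_assoc, ← Complex.exp_add]
      congr 2; ring
    have h4 : Complex.exp (-(w * t)) * (Complex.exp (θ * Complex.I) * rayDensity τ θ h t) -
        Complex.exp (-(w * t)) * (Complex.exp (θ * τ * Complex.I) * (t : ℂ) ^ (τ - 1)) =
        Complex.exp (-(w * t)) * (Complex.exp (θ * τ * Complex.I) * ((t : ℂ) ^ (τ - 1) *
          (h (t * Complex.exp (θ * Complex.I)) - 1))) := by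
      rw [h3]; ring
    have h5 : ‖Complex.exp (θ * τ * Complex.I)‖ ≤ Real.exp (Y * |τ.im|) := by
      rw [Complex.norm_exp, Real.exp_le_exp]
      have : ((θ : ℂ) * τ * Complex.I).re = -(θ * τ.im) := by simp
      rw [this]
      refine (neg_le_abs _).trans ?_
      rw [abs_mul]
      gcongr
    have h6 : ‖Complex.exp (-(w * t))‖ = Real.exp (-(w.re * t)) := by
      rw [Complex.norm_exp]; simp
    have h7 : t ^ ((τ.re + 1) - 1) = t ^ (τ.re - 1) * t := by
      rw [← Real.rpow_add_one ht0.ne']; congr 1; ring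
    have h8 : Real.exp (-((w.re - Λ) * t)) = Real.exp (-(w.re * t)) * Real.exp (Λ * t) := by
      rw [← Real.exp_add]; congr 1; ring
    rw [h4, norm_mul, norm_mul, norm_cpow_sub_one_mul ht0, h6, h7, h8]
    calc Real.exp (-(w.re * t)) * (‖Complex.exp (θ * τ * Complex.I)‖ *
          (t ^ (τ.re - 1) * ‖h (t * Complex.exp (θ * Complex.I)) - 1‖))
        ≤ Real.exp (-(w.re * t)) * (Real.exp (Y * |τ.im|) *
          (t ^ (τ.re - 1) * (D * (t * Real.exp (Λ * t))))) := by gcongr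
      _ = _ := by ring
  · rw [integral_const_mul, Real.integral_rpow_mul_exp_neg_mul_Ioi (by linarith) hd, one_div,
      Real.inv_rpow hd.le, ← Real.rpow_neg hd.le]
    have : -(τ.re + 1) = -τ.re - 1 := by ring
    rw [this]; ring

/-! ### The distinguished solution -/

/-- The Borel transform `h`, normalised by `h(0) = 1`, of the distinguished solution, with the
power `u ^ (τ - 1)` factored out. -/
structure IsBorelProfile (P Q : Polynomial ℂ) (R : ℂ → ℂ) (α : ℂ) (θ₁ θ₂ Λ : ℝ) (U : Set ℂ)
    (h : ℂ → ℂ) : Prop where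
  isOpen : IsOpen U
  zero_mem : (0 : ℂ) ∈ U
  sector_subset : openSector 0 θ₁ θ₂ ⊆ U
  differentiableOn : DifferentiableOn ℂ h U
  apply_zero : h 0 = 1
  bound : ∃ C : ℝ, 0 ≤ C ∧ ∀ u ∈ U, ‖h u‖ ≤ C * Real.exp (Λ * ‖u‖)
  eq_zero : ∀ u ∈ U, leadCoeffFn P α u * h u + volterraOp
    (volterraKernel Q α fun j => PowerSeries.coeff j (taylorPS R)) (tauExp P Q α) h u = 0

theorem exists_isBorelProfile {P Q : Polynomial ℂ} {R : ℂ → ℂ} (hP : P.Monic)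
    (hProots : P.roots.Nodup) (hQdeg : Q.natDegree + 1 = P.natDegree) {α : ℂ}
    (hα : P.IsRoot (-α)) (hτ : 0 < (tauExp P Q α).re) {θ₁ θ₂ : ℝ}
    (hsector : ∀ β ∈ closure (openSector α θ₁ θ₂), P.IsRoot (-β) → β = α)
    {M B : ℝ} (hM : 0 ≤ M) (hB : 0 < B)
    (hr : ∀ j, ‖PowerSeries.coeff j (taylorPS R)‖ ≤ M * B ^ j) (L : ℝ) :
    ∃ (Λ : ℝ) (U : Set ℂ) (h : ℂ → ℂ), L ≤ Λ ∧ IsBorelProfile P Q R α θ₁ θ₂ Λ U h := by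
  obtain ⟨U, hUsub, hU⟩ := exists_isRegularSingular hP hProots hQdeg hα hτ hsector hM hB hr
  obtain ⟨h, hd, he, h0, heq⟩ := hU.exists_solution
  obtain ⟨C, Λ, hC, hΛ, hb⟩ := he.exists_nonneg
  refine ⟨max L Λ, U, h, le_max_left _ _, hU.isOpen, hU.zero_mem, hUsub, hd, h0,
    ⟨C, hC, fun u hu => (hb u hu).trans ?_⟩, heq⟩
  gcongr
  exact le_max_right _ _

open Classical in
/-- The Laplace integral of a density, in any direction in which it converges. -/
noncomputable def sectorLaplace (α τ : ℂ) (θ₁ θ₂ Λ : ℝ) (h : ℂ → ℂ) (z : ℂ) : ℂ :=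
  if hz : z ∈ dualSector θ₁ θ₂ Λ then
    (Complex.Gamma τ)⁻¹ * rayIntegral α hz.choose (rayDensity τ hz.choose h) z
  else 0

/-! ### From a Borel profile to the distinguished solution and to Borel sums. -/

namespace IsBorelProfile

variable {P Q : Polynomial ℂ} {R : ℂ → ℂ} {α : ℂ} {θ₁ θ₂ Λ : ℝ} {U : Set ℂ} {h : ℂ → ℂ}

theorem isLaplaceIntegrable (hp : IsBorelProfile P Q R α θ₁ θ₂ Λ U h)
    (hτ : 0 < (tauExp P Q α).re) {θ : ℝ} (hθ : θ ∈ Ioo θ₁ θ₂) :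
    IsLaplaceIntegrable Λ (rayDensity (tauExp P Q α) θ h) := by
  obtain ⟨C, hC, hb⟩ := hp.bound
  exact isLaplaceIntegrable_rayDensity hτ (hp.differentiableOn.mono hp.sector_subset).continuousOn
    (fun u hu => hb u (hp.sector_subset hu)) hθ

theorem sectorLaplace_eq (hp : IsBorelProfile P Q R α θ₁ θ₂ Λ U h)
    (hτ : 0 < (tauExp P Q α).re) (hπ : θ₂ - θ₁ ≤ Real.pi) (hΛ : 0 ≤ Λ) {θ : ℝ}
    (hθ : θ ∈ Ioo θ₁ θ₂) {z : ℂ} (hz : z ∈ freqHalfPlane θ Λ) :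
    sectorLaplace α (tauExp P Q α) θ₁ θ₂ Λ h z =
      (Complex.Gamma (tauExp P Q α))⁻¹ * rayIntegral α θ (rayDensity (tauExp P Q α) θ h) z := by
  obtain ⟨C, hC, hb⟩ := hp.bound
  have hzS : z ∈ dualSector θ₁ θ₂ Λ := ⟨θ, hθ, hz⟩
  rw [sectorLaplace, dif_pos hzS]
  congr 1
  exact rayIntegral_eq hτ (hp.differentiableOn.mono hp.sector_subset)
    (fun u hu => hb u (hp.sector_subset hu)) hΛ hπ hzS.choose_spec.1 hθ hzS.choose_spec.2 hz

/-- Near each point the function is the Laplace integral in one fixed direction, where holomorphy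
and the equation can be checked. Dividing by `Γ(τ)` gives the leading term `z^{-τ}`. -/
theorem isDistinguishedSolution (hp : IsBorelProfile P Q R α θ₁ θ₂ Λ U h)
    (hα : P.IsRoot (-α)) (hτ : 0 < (tauExp P Q α).re) (hθ : θ₁ < θ₂) (hπ : θ₂ - θ₁ ≤ Real.pi)
    {A : ℝ} (hA : 0 < A) (hR : DifferentiableOn ℂ R (Metric.ball 0 A⁻¹)) {M B : ℝ} (hM : 0 ≤ M)
    (hB : 0 < B) (hr : ∀ j, ‖PowerSeries.coeff j (taylorPS R)‖ ≤ M * B ^ j) (hBΛ : B ≤ Λ)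
    (hAΛ : A ≤ Λ) :
    IsDistinguishedSolution P Q R A α θ₁ θ₂ Λ
      (sectorLaplace α (tauExp P Q α) θ₁ θ₂ Λ h) := by
  have hΛ : 0 ≤ Λ := hA.le.trans hAΛ
  set τ := tauExp P Q α with hτdef
  have hG : Complex.Gamma τ ≠ 0 := Complex.Gamma_ne_zero_of_re_pos hτ
  have hev : ∀ θ ∈ Ioo θ₁ θ₂, ∀ z ∈ freqHalfPlane θ Λ, sectorLaplace α τ θ₁ θ₂ Λ h =ᶠ[𝓝 z]
      rayIntegral α θ (fun t => (Complex.Gamma τ)⁻¹ * rayDensity τ θ h t) := by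
    intro θ hθ z hz
    filter_upwards [(isOpen_freqHalfPlane θ Λ).mem_nhds hz] with w hw
    rw [rayIntegral_const_mul]
    exact hp.sectorLaplace_eq hτ hπ hΛ hθ hw
  refine ⟨hAΛ, ⟨fun z => Complex.exp (α * z) * sectorLaplace α τ θ₁ θ₂ Λ h z -
    branchPow (-((θ₁ + θ₂) / 2)) (-τ) z, ⟨?_, ?_⟩, fun z _ => ?_⟩, ?_⟩
  · rintro z ⟨θ, hθ, hz⟩
    have h1 : DifferentiableAt ℂ (sectorLaplace α τ θ₁ θ₂ Λ h) z :=
      (((hp.isLaplaceIntegrable hτ hθ).const_mul _).hasDerivAt α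
        hz).differentiableAt.congr_of_eventuallyEq (hev θ hθ z hz)
    have h2 : DifferentiableAt ℂ (fun z => Complex.exp (α * z)) z := by fun_prop
    exact ((h2.mul h1).sub (differentiableAt_branchPow hπ hΛ hθ (-τ) hz)).differentiableWithinAt
  · obtain ⟨C, hC, hb⟩ := hp.bound
    obtain ⟨D, hD, hD1⟩ := exists_norm_sub_one_le (hp.isOpen.mem_nhds hp.zero_mem)
      hp.differentiableOn hp.apply_zero hC hΛ hb
    refine ⟨‖(Complex.Gamma τ)⁻¹‖ * (Real.exp (max |θ₁| |θ₂| * |τ.im|) * D *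
      Real.Gamma (τ.re + 1)), fun z hz => ?_⟩
    have hGr : 0 < Real.Gamma (τ.re + 1) := Real.Gamma_pos_of_pos (by linarith)
    refine le_infDist_rpow_of_forall hθ hπ hΛ (by linarith) (by positivity) hz
      fun θ hθ hzθ => ?_
    have h1 := norm_exp_mul_rayIntegral_sub_le (α := α) hτ hπ hΛ (hp.isLaplaceIntegrable hτ hθ)
      (fun u hu => hD1 u (hp.sector_subset hu)) hθ (abs_le_max_abs_abs hθ.1.le hθ.2.le) hzθ
    have h3 := hp.sectorLaplace_eq hτ hπ hΛ hθ hzθ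
    rw [← hτdef] at h3
    beta_reduce
    rw [h3]
    have h2 : Complex.exp (α * z) * ((Complex.Gamma τ)⁻¹ *
        rayIntegral α θ (rayDensity τ θ h) z) - branchPow (-((θ₁ + θ₂) / 2)) (-τ) z =
        (Complex.Gamma τ)⁻¹ * (Complex.exp (α * z) * rayIntegral α θ (rayDensity τ θ h) z -
          Complex.Gamma τ * branchPow (-((θ₁ + θ₂) / 2)) (-τ) z) := by
      field_simp
    rw [h2, norm_mul, mul_assoc]
    gcongr
  · rw [add_sub_cancel, ← mul_assoc, ← Complex.exp_add]
    simp
  · rintro z ⟨θ, hθ, hz⟩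
    rw [levelOneOp_congr (hev θ hθ z hz)]
    refine levelOneOp_rayIntegral hA hR hM hB hr hBΛ hAΛ
      ((hp.isLaplaceIntegrable hτ hθ).const_mul _) (fun t ht => ?_) hz
    have h1 := volterra_rayDensity hα ht
      (hp.eq_zero _ (hp.sector_subset (ray_mem_openSector hθ ht)))
    simp only [mul_left_comm _ (Complex.Gamma τ)⁻¹]
    rw [intervalIntegral.integral_const_mul, mul_left_comm _ (Complex.Gamma τ)⁻¹, ← mul_add, h1,
      mul_zero]

/-- Borel summability of formal solutions. -/
theorem isBorelSum (hp : IsBorelProfile P Q R α θ₁ θ₂ Λ U h)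
    (hτ : 0 < (tauExp P Q α).re) {F : ℂ⟦X⟧} {k : ℂ} {ρ : ℝ} (hρ : 0 < ρ)
    (hF : ∀ u : ℂ, ‖u‖ < ρ → HasSum (fun n => borelCoeff (tauExp P Q α) F n * u ^ n) (k * h u))
    {θ Λ' : ℝ} (hΛ' : Λ + (tauExp P Q α).re ≤ Λ') (hθ : θ ∈ Ioo θ₁ θ₂) {Φ : ℂ → ℂ}
    (hΦ : ∀ z ∈ freqHalfPlane θ Λ', Φ z =
      k * rayIntegral α θ (rayDensity (tauExp P Q α) θ h) z) :
    IsBorelSum α (tauExp P Q α) F θ Λ' Φ := by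
  set τ := tauExp P Q α with hτdef
  -- The branch with `arg (ζ - α) = θ` on the ray is centred there, so its cut is the opposite ray.
  set φ : ℂ → ℂ := fun ζ => branchPow θ (τ - 1) (ζ - α) * (k * h (ζ - α)) with hφ
  have hsub : ∀ t : ℝ, rayPoint α θ t - α = t * Complex.exp (θ * Complex.I) := fun t => by
    rw [rayPoint]; ring
  have hφray : ∀ t : ℝ, 0 < t → φ (rayPoint α θ t) = k * rayDensity τ θ h t := fun t ht => by
    simp only [hφ]
    rw [hsub, branchPow_ray θ _ ht, rayDensity]
    ring
  refine ⟨φ, ⟨⟨ρ, hρ, fun w hw => (hF w hw).summable⟩, ?_, ?_⟩, ⟨?_, ?_⟩, fun z hz => ?_⟩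
  · rintro _ ⟨t, ht, rfl⟩
    have ht0 : (0 : ℝ) < t := ht
    set V : Set ℂ := {ζ | ζ - α ∈ U} ∩
      {ζ | (ζ - α) * Complex.exp (-(θ * Complex.I)) ∈ Complex.slitPlane} with hV
    have hVo : IsOpen V := (hp.isOpen.preimage (by fun_prop)).inter
      (Complex.isOpen_slitPlane.preimage (by fun_prop))
    have hmem : rayPoint α θ t ∈ V := by
      refine ⟨?_, ?_⟩
      · rw [mem_ofPred_eq, hsub]
        exact hp.sector_subset (ray_mem_openSector hθ ht0)
      · rw [mem_ofPred_eq, hsub, mul_assoc, ← Complex.exp_add, add_neg_cancel, Complex.exp_zero,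
          mul_one]
        exact Complex.ofReal_mem_slitPlane.2 ht0
    have hd : DifferentiableOn ℂ φ V := by
      intro ζ hζ
      have h1 : DifferentiableAt ℂ h (ζ - α) :=
        hp.differentiableOn.differentiableAt (hp.isOpen.mem_nhds hζ.1)
      have h2 : DifferentiableAt ℂ (fun ζ => h (ζ - α)) ζ :=
        DifferentiableAt.comp ζ h1 (by fun_prop)
      have h3 : DifferentiableAt ℂ
          (fun ζ => Complex.log ((ζ - α) * Complex.exp (-(θ * Complex.I)))) ζ :=
        DifferentiableAt.clog (by fun_prop) hζ.2
      have h4 : DifferentiableAt ℂ (fun ζ => branchPow θ (τ - 1) (ζ - α)) ζ :=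
        ((h3.add_const _).const_mul _).cexp
      exact (h4.mul (h2.const_mul k)).differentiableWithinAt
    exact hd.analyticAt (hVo.mem_nhds hmem)
  · filter_upwards [Ioo_mem_nhdsGT hρ] with t ht
    have hn : ‖rayPoint α θ t - α‖ < ρ := by
      rw [hsub, norm_ofReal_mul_exp θ ht.1.le]
      exact ht.2
    rw [(hF _ hn).tsum_eq]
  · have hint : ∀ T : ℝ, 0 ≤ T → IntegrableOn (fun t : ℝ => φ (rayPoint α θ t)) (Icc 0 T) := by
      intro T hT
      rw [integrableOn_Icc_iff_integrableOn_Ioc]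
      have h1 := ((hp.isLaplaceIntegrable hτ hθ).const_mul k).intervalIntegrable hT
      rw [intervalIntegrable_iff_integrableOn_Ioc_of_le hT] at h1
      exact h1.congr_fun (fun t ht => (hφray t ht.1).symm) measurableSet_Ioc
    intro t ht
    have ht0 : (0 : ℝ) ≤ t := ht
    refine ⟨Icc 0 (t + 1), ?_, hint _ (by linarith)⟩
    have h1 : Icc 0 (t + 1) = Ici 0 ∩ Iic (t + 1) := rfl
    rw [h1]
    exact inter_mem_nhdsWithin _ (Iic_mem_nhds (by linarith))
  · obtain ⟨C, hC, hb⟩ := hp.bound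
    refine ⟨‖k‖ * (Real.exp (-(θ * τ.im)) * C), fun t ht => ?_⟩
    have ht0 : 0 < t := by linarith
    have h1 := hb _ (hp.sector_subset (ray_mem_openSector hθ ht0))
    rw [norm_ofReal_mul_exp θ ht0.le] at h1
    -- The power is bounded by an exponential of type `τ.re`, which is why `Λ'` exceeds `Λ` by that
    -- amount.
    have h2 : t ^ (τ.re - 1) ≤ Real.exp (τ.re * t) := by
      calc t ^ (τ.re - 1) ≤ t ^ τ.re := Real.rpow_le_rpow_of_exponent_le ht (by linarith)
        _ = Real.exp (Real.log t * τ.re) := Real.rpow_def_of_pos ht0 _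
        _ ≤ Real.exp (τ.re * t) := by
          rw [mul_comm]
          gcongr
          linarith [Real.log_le_sub_one_of_pos ht0]
    rw [hφray t ht0, norm_mul, norm_rayDensity θ h ht0, mul_assoc, mul_assoc]
    refine mul_le_mul_of_nonneg_left ?_ (norm_nonneg _)
    refine mul_le_mul_of_nonneg_left ?_ (Real.exp_pos _).le
    calc t ^ (τ.re - 1) * ‖h (t * Complex.exp (θ * Complex.I))‖
        ≤ Real.exp (τ.re * t) * (C * Real.exp (Λ * t)) := by gcongr
      _ = C * Real.exp ((Λ + τ.re) * t) := by
        rw [add_mul, Real.exp_add]; ring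
      _ ≤ C * Real.exp (Λ' * t) := by gcongr
  · rw [hΦ z hz, ← rayIntegral_const_mul]
    refine setIntegral_congr_fun measurableSet_Ioi fun t ht => ?_
    simp only
    rw [hφray t ht]

end IsBorelProfile

/-! ### Differential operators with constant coefficients -/

/-- The action of the polynomial `q(∂/∂z)` on a function. -/
noncomputable def polyDeriv (q : Polynomial ℂ) (f : ℂ → ℂ) (z : ℂ) : ℂ :=
  q.sum fun k a => a * iteratedDeriv k f z

section polyDeriv

variable {f g : ℂ → ℂ} {z : ℂ}

theorem polyDeriv_monomial (n : ℕ) (a : ℂ) :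
    polyDeriv (Polynomial.monomial n a) f z = a * iteratedDeriv n f z :=
  Polynomial.sum_monomial_index _ _ (zero_mul _)

theorem polyDeriv_add (p q : Polynomial ℂ) :
    polyDeriv (p + q) f z = polyDeriv p f z + polyDeriv q f z :=
  Polynomial.sum_add_index _ _ _ (fun _ => zero_mul _) fun _ _ _ => add_mul _ _ _

theorem polyDeriv_C_mul (c : ℂ) (q : Polynomial ℂ) :
    polyDeriv (Polynomial.C c * q) f z = c * polyDeriv q f z := by
  induction q using Polynomial.induction_on' with
  | add p q hp hq => rw [mul_add, polyDeriv_add, polyDeriv_add, hp, hq, mul_add]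
  | monomial n a =>
    rw [Polynomial.C_mul_monomial, polyDeriv_monomial, polyDeriv_monomial, mul_assoc]

theorem polyDeriv_one : polyDeriv 1 f z = f z := by
  rw [← Polynomial.monomial_zero_one, polyDeriv_monomial, iteratedDeriv_zero, one_mul]

theorem hasDerivAt_polyDeriv (hf : AnalyticAt ℂ f z) (q : Polynomial ℂ) :
    HasDerivAt (polyDeriv q f) (polyDeriv (Polynomial.X * q) f z) z := by
  induction q using Polynomial.induction_on' with
  | add p q hp hq =>
    rw [mul_add, polyDeriv_add]
    have : polyDeriv (p + q) f = polyDeriv p f + polyDeriv q f := by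
      ext w; exact polyDeriv_add p q
    rw [this]
    exact hp.add hq
  | monomial n a =>
    have h1 : polyDeriv (Polynomial.monomial n a) f = fun w => a * iteratedDeriv n f w := by
      ext w; exact polyDeriv_monomial n a
    rw [Polynomial.X_mul_monomial, polyDeriv_monomial, h1, iteratedDeriv_succ]
    rw [iteratedDeriv_eq_iterate]
    exact ((hf.iterated_deriv n).differentiableAt.hasDerivAt).const_mul a

theorem polyDeriv_sub (hf : AnalyticAt ℂ f z) (hg : AnalyticAt ℂ g z) (q : Polynomial ℂ) :
    polyDeriv q (f - g) z = polyDeriv q f z - polyDeriv q g z := by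
  induction q using Polynomial.induction_on' with
  | add p q hp hq => rw [polyDeriv_add, polyDeriv_add, polyDeriv_add, hp, hq]; ring
  | monomial n a =>
    rw [polyDeriv_monomial, polyDeriv_monomial, polyDeriv_monomial,
      iteratedDeriv_sub hf.contDiffAt hg.contDiffAt, mul_sub]

/-- Conjugation by `e^{-αz}` replaces `∂` by `∂ - α`. -/
theorem polyDeriv_exp_mul (α : ℂ) (q : Polynomial ℂ) (hf : AnalyticAt ℂ f z) :
    polyDeriv q (fun z => Complex.exp (-α * z) * f z) z =
      Complex.exp (-α * z) * polyDeriv (q.comp (Polynomial.X - Polynomial.C α)) f z := by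
  have key : ∀ n : ℕ, ∀ w, AnalyticAt ℂ f w →
      polyDeriv (Polynomial.X ^ n) (fun z => Complex.exp (-α * z) * f z) w =
      Complex.exp (-α * w) * polyDeriv ((Polynomial.X - Polynomial.C α) ^ n) f w := by
    intro n
    induction n with
    | zero => intro w _; rw [pow_zero, pow_zero, polyDeriv_one, polyDeriv_one]
    | succ n ih =>
      intro w hw
      have hE : AnalyticAt ℂ (fun z => Complex.exp (-α * z)) w := by fun_prop
      have h1 := hasDerivAt_polyDeriv (hE.mul hw) (Polynomial.X ^ n)
      have h2 : polyDeriv (Polynomial.X ^ n) (fun z => Complex.exp (-α * z) * f z) =ᶠ[𝓝 w]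
          fun w => Complex.exp (-α * w) * polyDeriv ((Polynomial.X - Polynomial.C α) ^ n) f w := by
        filter_upwards [hw.eventually_analyticAt] with v hv using ih v hv
      have h3 : HasDerivAt (fun w : ℂ => Complex.exp (-α * w)) (Complex.exp (-α * w) * (-α)) w := by
        simpa using ((hasDerivAt_id w).const_mul (-α)).cexp
      have h4 := h3.mul (hasDerivAt_polyDeriv hw ((Polynomial.X - Polynomial.C α) ^ n))
      have h5 := (h1.congr_of_eventuallyEq h2.symm).unique h4
      rw [pow_succ', pow_succ']
      refine h5.trans ?_
      have : (Polynomial.X - Polynomial.C α) * (Polynomial.X - Polynomial.C α) ^ n =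
          Polynomial.X * (Polynomial.X - Polynomial.C α) ^ n +
            Polynomial.C (-α) * (Polynomial.X - Polynomial.C α) ^ n := by
        rw [Polynomial.C_neg]; ring
      rw [this, polyDeriv_add, polyDeriv_C_mul]
      ring
  induction q using Polynomial.induction_on' with
  | add p q hp hq => rw [Polynomial.add_comp, polyDeriv_add, polyDeriv_add, hp, hq]; ring
  | monomial n a =>
    rw [← Polynomial.C_mul_X_pow_eq_monomial, Polynomial.mul_comp, Polynomial.C_comp,
      Polynomial.X_pow_comp, polyDeriv_C_mul, polyDeriv_C_mul, key n z hf]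
    ring

end polyDeriv

/-! ### Integration from infinity in a half-plane -/

/-- Integration from infinity by comparison: the increment of `φ` over `[0, T]` is at most `b 0 - b
T`, and `φ T → 0`. -/
theorem norm_le_of_norm_deriv_le {φ φ' : ℝ → ℂ} {b b' : ℝ → ℝ}
    (hφ : ∀ t, 0 ≤ t → HasDerivAt φ (φ' t) t) (hb : ∀ t, 0 ≤ t → HasDerivAt b (-b' t) t)
    (hb0 : ∀ t, 0 ≤ t → 0 ≤ b t) (h : ∀ t, 0 ≤ t → ‖φ' t‖ ≤ b' t)
    (hlim : Tendsto φ atTop (𝓝 0)) : ‖φ 0‖ ≤ b 0 := by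
  have key : ∀ T, 0 ≤ T → ‖φ T - φ 0‖ ≤ b 0 := by
    intro T hT
    have h1 := image_norm_le_of_norm_deriv_right_le_deriv_boundary' (f := fun t => φ t - φ 0)
      (f' := φ') (a := 0) (b := T) (B := fun t => b 0 - b t) (B' := b')
      (fun t ht => ((hφ t ht.1).sub_const _).continuousAt.continuousWithinAt)
      (fun t ht => ((hφ t ht.1).sub_const _).hasDerivWithinAt) (by simp)
      (fun t ht => ((hb t ht.1).const_sub _).continuousAt.continuousWithinAt)
      (fun t ht => by simpa using ((hb t ht.1).const_sub (b 0)).hasDerivWithinAt)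
      (fun t ht => h t ht.1) ⟨hT, le_rfl⟩
    linarith [hb0 T hT]
  have h2 : Tendsto (fun T => ‖φ T - φ 0‖) atTop (𝓝 ‖(0 : ℂ) - φ 0‖) :=
    (hlim.sub_const _).norm
  rw [zero_sub, norm_neg] at h2
  exact le_of_tendsto h2 ((eventually_ge_atTop 0).mono key)

/-- Along a path entering the right half-plane the modulus never drops below a fixed fraction of its
initial value, so bounds by `|z|^{-s}` persist along the path. -/
theorem re_mul_norm_le_norm_add {w u : ℂ} {t : ℝ} (hw : 0 ≤ w.re) (hu : 0 ≤ u.re)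
    (hu1 : ‖u‖ = 1) (ht : 0 ≤ t) : u.re * ‖w‖ ≤ ‖w + t * u‖ := by
  have h1 : u.re ^ 2 + u.im ^ 2 = 1 := by
    have := Complex.sq_norm u
    rw [hu1, Complex.normSq_apply] at this
    linarith
  have h2 : ‖w‖ ^ 2 = w.re ^ 2 + w.im ^ 2 := by
    rw [Complex.sq_norm, Complex.normSq_apply]; ring
  have h3 : ‖w + t * u‖ ^ 2 = (w.re + t * u.re) ^ 2 + (w.im + t * u.im) ^ 2 := by
    rw [Complex.sq_norm, Complex.normSq_apply]; simp; ring
  refine le_of_sq_le_sq ?_ (norm_nonneg _)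
  rw [mul_pow, h2, h3]
  have h4 : 0 ≤ t * (w.re * u.re) := by positivity
  nlinarith [sq_nonneg (t + w.im * u.im), sq_nonneg (w.re * u.im), h4, sq_nonneg t,
    mul_nonneg hw hu]

/-- `u` bisects the directions of `1` and of the conjugate of `m`; these are opposite exactly when
`m` lies on the negative real axis. -/
theorem exists_direction {m : ℂ} (hm : m ∈ Complex.slitPlane) :
    ∃ u : ℂ, ‖u‖ = 1 ∧ 0 < u.re ∧ 0 < (m * u).re := by
  have hpos : 0 < m.re + ‖m‖ := by
    rcases hm with h | h
    · positivity
    · have := Complex.abs_re_lt_norm.2 h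
      linarith [neg_abs_le m.re]
  set v : ℂ := (starRingEnd ℂ) m + ‖m‖ with hv
  have hvre : v.re = m.re + ‖m‖ := by simp [hv]
  have hv0 : v ≠ 0 := by intro h; rw [h] at hvre; simp at hvre; linarith
  have hvn : 0 < ‖v‖ := norm_pos_iff.2 hv0
  have hm0 : 0 < ‖m‖ := norm_pos_iff.2 (Complex.slitPlane_ne_zero hm)
  have hmv : (m * v).re = ‖m‖ * (m.re + ‖m‖) := by
    rw [hv, mul_add, Complex.mul_conj, Complex.add_re, Complex.ofReal_re, Complex.re_mul_ofReal,
      Complex.normSq_eq_norm_sq]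
    ring
  have e : ∀ x : ℂ, (x * (((‖v‖⁻¹ : ℝ) : ℂ))).re = x.re * ‖v‖⁻¹ := fun x =>
    Complex.re_mul_ofReal _ _
  refine ⟨v * ((‖v‖⁻¹ : ℝ) : ℂ), ?_, ?_, ?_⟩
  · rw [norm_mul, Complex.norm_real, norm_inv, norm_norm, mul_inv_cancel₀ hvn.ne']
  · rw [e, hvre]; positivity
  · rw [← mul_assoc, e, hmv]; positivity

/-- Integrate `e^{-μz} f` from infinity along a direction that stays in the half-plane and in which
`e^{-μz}` decays; it exists even if `e^{-iθ}μ` has negative real part. Boundedness of `f` removes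
the contribution at infinity. The constant depends on neither `L` nor `f`. -/
theorem exists_norm_le_of_deriv_sub {θ : ℝ} {μ : ℂ}
    (hμ : Complex.exp (-(θ * Complex.I)) * μ ∈ Complex.slitPlane) {s : ℝ} (hs : 0 ≤ s) :
    ∃ C : ℝ, 0 ≤ C ∧ ∀ (L : ℝ) (f f' : ℂ → ℂ) (K : ℝ), 0 ≤ L →
      (∀ z ∈ freqHalfPlane θ L, HasDerivAt f (f' z) z) →
      (∃ M, ∀ z ∈ freqHalfPlane θ L, ‖f z‖ ≤ M) →
      (∀ z ∈ freqHalfPlane θ L, ‖f' z - μ * f z‖ ≤ K * ‖z‖ ^ (-s)) →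
      ∀ z ∈ freqHalfPlane θ L, ‖f z‖ ≤ C * K * ‖z‖ ^ (-s) := by
  obtain ⟨u, hu1, hu0, hmu⟩ := exists_direction hμ
  set v : ℂ := Complex.exp (-(θ * Complex.I)) * u with hv
  set κ : ℝ := (μ * v).re with hκ
  have hκ0 : 0 < κ := by
    rw [hκ, hv, ← mul_assoc, mul_comm μ]; exact hmu
  have hv1 : ‖v‖ = 1 := by
    rw [hv, norm_mul, hu1, mul_one, Complex.norm_exp]; simp
  have hev : Complex.exp (θ * Complex.I) * v = u := by
    rw [hv, ← mul_assoc, ← Complex.exp_add, add_neg_cancel, Complex.exp_zero, one_mul]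
  refine ⟨u.re ^ (-s) / κ, by positivity, fun L f f' K hL hf ⟨M, hM⟩ hK z hz => ?_⟩
  have hzL : L < (Complex.exp (θ * Complex.I) * z).re := hz
  have hrot : ∀ t : ℝ, Complex.exp (θ * Complex.I) * (z + t * v) =
      Complex.exp (θ * Complex.I) * z + t * u := fun t => by rw [← hev]; ring
  have hmem : ∀ t : ℝ, 0 ≤ t → z + t * v ∈ freqHalfPlane θ L := fun t ht => by
    change L < _
    rw [hrot, Complex.add_re, Complex.re_ofReal_mul]
    have := mul_nonneg ht hu0.le
    linarith
  have hz0 : 0 < ‖z‖ := by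
    rw [norm_pos_iff]; rintro rfl; simp at hzL; linarith
  have hK0 : 0 ≤ K := by
    have := (norm_nonneg _).trans (hK z hz)
    exact nonneg_of_mul_nonneg_left this (Real.rpow_pos_of_pos hz0 _)
  have hlow : ∀ t : ℝ, 0 ≤ t → u.re * ‖z‖ ≤ ‖z + t * v‖ := fun t ht => by
    have := re_mul_norm_le_norm_add (hL.trans hzL.le) hu0.le hu1 ht
    rwa [← hrot, norm_exp_ofReal_mul_I_mul, norm_exp_ofReal_mul_I_mul] at this
  set B : ℝ := K * (u.re ^ (-s) * ‖z‖ ^ (-s)) with hB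
  have hB0 : 0 ≤ B := by positivity
  have hexp : ∀ t : ℝ, ‖Complex.exp (-(μ * v) * t)‖ = Real.exp (-(κ * t)) := fun t => by
    rw [Complex.norm_exp, Complex.re_mul_ofReal, Complex.neg_re, neg_mul]
  have hmain := norm_le_of_norm_deriv_le
    (φ := fun t => Complex.exp (-(μ * v) * t) * f (z + t * v))
    (φ' := fun t => Complex.exp (-(μ * v) * t) * (v * (f' (z + t * v) - μ * f (z + t * v))))
    (b := fun t => Real.exp (-(κ * t)) * (B / κ)) (b' := fun t => Real.exp (-(κ * t)) * B)
    (fun t ht => ?_) (fun t ht => ?_) (fun t ht => by positivity) (fun t ht => ?_) ?_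
  · simp only [Complex.ofReal_zero, mul_zero, Complex.exp_zero, one_mul, zero_mul, add_zero,
      neg_zero, Real.exp_zero] at hmain
    refine hmain.trans_eq ?_
    rw [hB]; ring
  · have h1 : HasDerivAt (fun t : ℝ => Complex.exp (-(μ * v) * t))
        (Complex.exp (-(μ * v) * t) * (-(μ * v) * 1)) t :=
      ((Complex.ofRealCLM.hasDerivAt (x := t)).const_mul (-(μ * v))).cexp
    have h2 : HasDerivAt (fun t : ℝ => z + (t : ℂ) * v) (1 * v) t :=
      ((Complex.ofRealCLM.hasDerivAt (x := t)).mul_const v).const_add z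
    have h3 : HasDerivAt (fun t : ℝ => f (z + (t : ℂ) * v)) (f' (z + t * v) * (1 * v)) t :=
      HasDerivAt.comp t (hf _ (hmem t ht)) h2
    refine (h1.mul h3).congr_deriv ?_
    ring
  · have h1 : HasDerivAt (fun t : ℝ => -(κ * t)) (-(κ * 1)) t :=
      ((hasDerivAt_id t).const_mul κ).neg
    refine (h1.exp.mul_const (B / κ)).congr_deriv ?_
    field_simp
  · rw [norm_mul, norm_mul, hv1, one_mul, hexp]
    gcongr
    refine (hK _ (hmem t ht)).trans ?_
    rw [hB, ← Real.mul_rpow hu0.le hz0.le]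
    refine mul_le_mul_of_nonneg_left ?_ hK0
    exact Real.rpow_le_rpow_of_nonpos (by positivity) (hlow t ht) (by linarith)
  · rw [tendsto_zero_iff_norm_tendsto_zero]
    have h1 : Tendsto (fun t : ℝ => Real.exp (-(κ * t)) * M) atTop (𝓝 (0 * M)) :=
      (Real.tendsto_exp_neg_atTop_nhds_zero.comp
        (tendsto_id.const_mul_atTop hκ0)).mul_const M
    rw [zero_mul] at h1
    refine squeeze_zero' (Eventually.of_forall fun t => norm_nonneg _) ?_ h1
    filter_upwards [eventually_ge_atTop 0] with t ht
    rw [norm_mul, hexp]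
    gcongr
    exact hM _ (hmem t ht)

/-- The integrating factor is `z^τ`, taken as a principal power of `w = e^{iθ}z`. The assumed decay
of order `Re τ + 1` makes `z^τ f` vanish at infinity, and integrating a bound of order `-3` yields
order `-2`. The constant does not involve `N`, which enters only through the limit. -/
theorem norm_le_of_deriv_add_div {θ L K N : ℝ} {τ : ℂ} {f f' : ℂ → ℂ} (hL : 0 ≤ L)
    (hf : ∀ z ∈ freqHalfPlane θ L, HasDerivAt f (f' z) z)
    (hN : ∀ z ∈ freqHalfPlane θ L, ‖f z‖ ≤ N * ‖z‖ ^ (-(τ.re + 1)))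
    (hK : ∀ z ∈ freqHalfPlane θ L, ‖f' z + τ * z⁻¹ * f z‖ ≤ K * ‖z‖ ^ (-(τ.re + 3)))
    {z : ℂ} (hz : z ∈ freqHalfPlane θ L) :
    ‖f z‖ ≤ 4 * Real.exp (Real.pi * |τ.im|) ^ 2 * K * ‖z‖ ^ (-(τ.re + 2)) := by
  set v : ℂ := Complex.exp (-(θ * Complex.I)) with hv
  set w : ℂ := Complex.exp (θ * Complex.I) * z with hw
  set c : ℝ := Real.exp (Real.pi * |τ.im|) with hc
  have hc0 : 0 < c := Real.exp_pos _
  have hwL : L < w.re := hz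
  have hw0 : 0 < w.re := hL.trans_lt hwL
  have hv1 : ‖v‖ = 1 := by rw [hv, Complex.norm_exp]; simp
  have hev : Complex.exp (θ * Complex.I) * v = 1 := by
    rw [hv, ← Complex.exp_add, add_neg_cancel, Complex.exp_zero]
  have hrot : ∀ t : ℝ, Complex.exp (θ * Complex.I) * (z + t * v) = w + t := fun t => by
    rw [mul_add, ← hw, mul_left_comm, hev, mul_one]
  have hrot' : ∀ t : ℝ, z + t * v = v * (w + t) := fun t => by
    rw [← hrot, ← mul_assoc, mul_comm v, hev, one_mul]
  have hmem : ∀ t : ℝ, 0 ≤ t → z + t * v ∈ freqHalfPlane θ L := fun t ht => by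
    change L < _
    rw [hrot, Complex.add_re, Complex.ofReal_re]
    linarith
  have hnorm : ∀ t : ℝ, ‖z + t * v‖ = ‖w + t‖ := fun t => by
    rw [hrot', norm_mul, hv1, one_mul]
  have hre : ∀ t : ℝ, 0 ≤ t → 0 < (w + t).re := fun t ht => by
    rw [Complex.add_re, Complex.ofReal_re]; linarith
  have hne : ∀ t : ℝ, 0 ≤ t → w + t ≠ 0 := fun t ht h0 => by
    have := hre t ht; rw [h0] at this; simp at this
  have hwn : 0 < ‖w‖ := by simpa using norm_pos_iff.2 (hne 0 le_rfl)
  have hzw : ‖z‖ = ‖w‖ := by simpa using hnorm 0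
  have hlow : ∀ t : ℝ, 0 ≤ t → (‖w‖ + t) / 2 ≤ ‖w + t‖ := fun t ht => by
    have h1 := re_mul_norm_le_norm_add (u := 1) hw0.le (by simp) (by simp) ht
    have h2 : t ≤ ‖w + t‖ := by
      refine le_trans ?_ (Complex.re_le_norm _)
      rw [Complex.add_re, Complex.ofReal_re]; linarith
    simp only [Complex.one_re, one_mul, mul_one] at h1
    linarith
  have hpow : ∀ x : ℂ, x ≠ 0 → ‖x ^ τ‖ ≤ ‖x‖ ^ τ.re * c ∧ ‖x‖ ^ τ.re ≤ c * ‖x ^ τ‖ := by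
    intro x hx
    have h1 : |x.arg * τ.im| ≤ Real.pi * |τ.im| := by
      rw [abs_mul]; gcongr; exact Complex.abs_arg_le_pi x
    rw [abs_le] at h1
    rw [Complex.norm_cpow_of_ne_zero hx, div_eq_mul_inv, ← Real.exp_neg]
    have hx0 : 0 < ‖x‖ ^ τ.re := Real.rpow_pos_of_pos (norm_pos_iff.2 hx) _
    constructor
    · gcongr; rw [hc]; gcongr; linarith
    · have : 1 ≤ c * Real.exp (-(x.arg * τ.im)) := by
        rw [hc, ← Real.exp_add]; exact Real.one_le_exp (by linarith)
      nlinarith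
  have hK0 : 0 ≤ K := by
    have := (norm_nonneg _).trans (hK z hz)
    exact nonneg_of_mul_nonneg_left this (Real.rpow_pos_of_pos (hzw ▸ hwn) _)
  have hmain := norm_le_of_norm_deriv_le
    (φ := fun t => (w + t) ^ τ * f (z + t * v))
    (φ' := fun t => (w + t) ^ τ * (v * (f' (z + t * v) + τ * (z + t * v)⁻¹ * f (z + t * v))))
    -- From `|w + t| ≥ (|w| + t)/2` the cube contributes `8`, and integration leaves `4`.
    (b := fun t => 4 * c * K * ((‖w‖ + t) ^ 2)⁻¹) (b' := fun t => 8 * c * K * ((‖w‖ + t) ^ 3)⁻¹)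
    (fun t ht => ?_) (fun t ht => ?_) (fun t ht => by positivity) (fun t ht => ?_) ?_
  · simp only [Complex.ofReal_zero, zero_mul, add_zero, norm_mul] at hmain
    have h1 := (hpow w (by simpa using hne 0 le_rfl)).2
    have h2 : ‖w‖ ^ (-(τ.re + 2)) = (‖w‖ ^ τ.re)⁻¹ * (‖w‖ ^ 2)⁻¹ := by
      rw [neg_add, Real.rpow_add hwn, Real.rpow_neg hwn.le, Real.rpow_neg hwn.le, Real.rpow_two]
    have h3 : 0 < ‖w‖ ^ τ.re := Real.rpow_pos_of_pos hwn _
    rw [hzw, h2]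
    have h4 : ‖w‖ ^ τ.re * ‖f z‖ ≤ c * (4 * c * K * (‖w‖ ^ 2)⁻¹) :=
      calc ‖w‖ ^ τ.re * ‖f z‖ ≤ c * ‖w ^ τ‖ * ‖f z‖ := by gcongr
        _ = c * (‖w ^ τ‖ * ‖f z‖) := by ring
        _ ≤ _ := by gcongr
    rw [← le_div_iff₀' h3] at h4
    refine h4.trans_eq ?_
    rw [div_eq_mul_inv]; ring
  · have h1 : HasDerivAt (fun t : ℝ => (w + (t : ℂ)) ^ τ) (τ * (w + t) ^ (τ - 1) * 1) t :=
      HasDerivAt.comp_ofReal (e := fun x => (w + x) ^ τ)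
        (((hasDerivAt_id (t : ℂ)).const_add w).cpow_const (Or.inl (hre t ht)))
    have h2 : HasDerivAt (fun t : ℝ => z + (t : ℂ) * v) (1 * v) t :=
      ((Complex.ofRealCLM.hasDerivAt (x := t)).mul_const v).const_add z
    have h3 : HasDerivAt (fun t : ℝ => f (z + (t : ℂ) * v)) (f' (z + t * v) * (1 * v)) t :=
      HasDerivAt.comp t (hf _ (hmem t ht)) h2
    refine (h1.mul h3).congr_deriv ?_
    have hv0 : v ≠ 0 := Complex.exp_ne_zero _
    have := hne t ht
    rw [Complex.cpow_sub _ _ this, Complex.cpow_one, hrot']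
    field_simp
    ring
  · have h1 : HasDerivAt (fun t : ℝ => (‖w‖ + t) ^ 2) (2 * (‖w‖ + t) ^ (2 - 1) * 1) t :=
      ((hasDerivAt_id t).const_add ‖w‖).pow 2
    have h0 : ‖w‖ + t ≠ 0 := by positivity
    refine ((h1.inv (by positivity)).const_mul (4 * c * K)).congr_deriv ?_
    field_simp
    ring
  · have hn := norm_pos_iff.2 (hne t ht)
    rw [norm_mul, norm_mul, hv1, one_mul]
    have h1 := hK _ (hmem t ht)
    rw [hnorm] at h1
    have h2 : ‖w + t‖ ^ τ.re * ‖w + t‖ ^ (-(τ.re + 3)) = (‖w + t‖ ^ 3)⁻¹ := by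
      rw [← Real.rpow_add hn, ← Real.rpow_natCast, ← Real.rpow_neg hn.le]
      congr 1; push_cast; ring
    have hp : 0 < (‖w‖ + t) / 2 := by positivity
    calc ‖(w + t) ^ τ‖ * ‖f' (z + t * v) + τ * (z + t * v)⁻¹ * f (z + t * v)‖
        ≤ (‖w + t‖ ^ τ.re * c) * (K * ‖w + t‖ ^ (-(τ.re + 3))) :=
          mul_le_mul (hpow _ (hne t ht)).1 h1 (norm_nonneg _) (by positivity)
      _ = c * K * (‖w + t‖ ^ 3)⁻¹ := by rw [← h2]; ring
      _ ≤ c * K * (((‖w‖ + t) / 2) ^ 3)⁻¹ := by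
        gcongr
        exact hlow t ht
      _ = 8 * c * K * ((‖w‖ + t) ^ 3)⁻¹ := by
        field_simp
        ring
  · rw [tendsto_zero_iff_norm_tendsto_zero]
    have h1 : Tendsto (fun t : ℝ => c * N * t⁻¹) atTop (𝓝 (c * N * 0)) :=
      tendsto_inv_atTop_zero.const_mul _
    rw [mul_zero] at h1
    have hN0 : 0 ≤ N := by
      have := (norm_nonneg _).trans (hN z hz)
      exact nonneg_of_mul_nonneg_left this (Real.rpow_pos_of_pos (hzw ▸ hwn) _)
    refine squeeze_zero' (Eventually.of_forall fun t => norm_nonneg _) ?_ h1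
    filter_upwards [eventually_gt_atTop 0] with t ht
    have hn := norm_pos_iff.2 (hne t ht.le)
    have h2 : ‖w + t‖ ^ τ.re * ‖w + t‖ ^ (-(τ.re + 1)) = ‖w + t‖⁻¹ := by
      rw [← Real.rpow_add hn, ← Real.rpow_neg_one]
      congr 1; ring
    have h3 := hN _ (hmem t ht.le)
    rw [hnorm] at h3
    have h4 : t ≤ ‖w + t‖ := by
      refine le_trans ?_ (Complex.re_le_norm _)
      rw [Complex.add_re, Complex.ofReal_re]; linarith
    rw [norm_mul]
    calc ‖(w + t) ^ τ‖ * ‖f (z + t * v)‖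
        ≤ (‖w + t‖ ^ τ.re * c) * (N * ‖w + t‖ ^ (-(τ.re + 1))) :=
          mul_le_mul (hpow _ (hne t ht.le)).1 h3 (norm_nonneg _) (by positivity)
      _ = c * N * ‖w + t‖⁻¹ := by rw [← h2]; ring
      _ ≤ c * N * t⁻¹ := by gcongr

/-! ### Uniqueness of decaying solutions -/

/-- Induction on `deg p`. Write `q = c p + r` with `deg r < deg p`, and `p = (X - μ) p₁`; inverting
`∂ - μ` by `exists_norm_le_of_deriv_sub` bounds `p₁(∂) m(∂) f`, and the induction hypothesis then
bounds `r(∂) m(∂) f`. The extra factor `m` lets the same constant apply to derivatives of `f`. -/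
theorem exists_norm_polyDeriv_le {θ s : ℝ} (hs : 0 ≤ s) {p : Polynomial ℂ} (hp : p.Monic)
    (hroots : ∀ μ, p.IsRoot μ → Complex.exp (-(θ * Complex.I)) * μ ∈ Complex.slitPlane)
    {q : Polynomial ℂ} (hq : q.natDegree ≤ p.natDegree) :
    ∃ C : ℝ, 0 ≤ C ∧ ∀ (L : ℝ) (f : ℂ → ℂ) (m : Polynomial ℂ) (K : ℝ), 0 ≤ L →
      (∀ z ∈ freqHalfPlane θ L, AnalyticAt ℂ f z) →
      (∀ q, ∃ M, ∀ z ∈ freqHalfPlane θ L, ‖polyDeriv q f z‖ ≤ M) →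
      (∀ z ∈ freqHalfPlane θ L, ‖polyDeriv (p * m) f z‖ ≤ K * ‖z‖ ^ (-s)) →
      ∀ z ∈ freqHalfPlane θ L, ‖polyDeriv (q * m) f z‖ ≤ C * K * ‖z‖ ^ (-s) := by
  induction hn : p.natDegree generalizing p q with
  | zero =>
    rw [hp.natDegree_eq_zero.1 hn]
    rw [hn, Nat.le_zero] at hq
    rw [Polynomial.eq_C_of_natDegree_eq_zero hq]
    refine ⟨‖q.coeff 0‖, norm_nonneg _, fun L f m K _ _ _ hK z hz => ?_⟩
    have := hK z hz
    rw [one_mul] at this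
    rw [polyDeriv_C_mul, norm_mul, mul_assoc]
    gcongr
  | succ n ih =>
    obtain ⟨μ, hμ⟩ := IsAlgClosed.exists_root p (by
      rw [Polynomial.degree_eq_natDegree hp.ne_zero, hn]; exact_mod_cast n.succ_ne_zero)
    obtain ⟨p₁, hp₁⟩ := Polynomial.dvd_iff_isRoot.2 hμ
    have hp₁m : p₁.Monic := (Polynomial.monic_X_sub_C μ).of_mul_monic_left (hp₁ ▸ hp)
    have hp₁n : p₁.natDegree = n := by
      have := congrArg Polynomial.natDegree hp₁
      rw [(Polynomial.monic_X_sub_C μ).natDegree_mul hp₁m, Polynomial.natDegree_X_sub_C, hn] at this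
      omega
    set c := q.coeff (n + 1) with hc
    set r := q - Polynomial.C c * p with hr
    have hrn : r.natDegree ≤ n := by
      rw [Polynomial.natDegree_le_iff_coeff_eq_zero]
      intro N hN
      rw [hr, Polynomial.coeff_sub, Polynomial.coeff_C_mul]
      rcases Nat.eq_or_lt_of_le (Nat.succ_le_of_lt hN) with h | h
      · rw [← h, Nat.succ_eq_add_one, ← hc, ← hn, hp.coeff_natDegree, mul_one, sub_self]
      · rw [Polynomial.coeff_eq_zero_of_natDegree_lt (by omega),
          Polynomial.coeff_eq_zero_of_natDegree_lt (p := p) (by omega), mul_zero, sub_zero]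
    obtain ⟨C₁, hC₁, h₁⟩ := ih hp₁m (fun ν hν => hroots ν (by
      rw [hp₁]; exact Polynomial.root_mul_left_of_isRoot _ hν)) (hrn.trans_eq hp₁n.symm) hp₁n
    obtain ⟨C₂, hC₂, h₂⟩ := exists_norm_le_of_deriv_sub (hroots μ hμ) hs
    refine ⟨‖c‖ + C₁ * C₂, by positivity, fun L f m K hL hf hb hK z hz => ?_⟩
    have h3 := h₁ L f m (C₂ * K) hL hf hb (h₂ L (polyDeriv (p₁ * m) f)
      (polyDeriv (Polynomial.X * (p₁ * m)) f) K hL (fun z hz => hasDerivAt_polyDeriv (hf z hz) _)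
      (hb _) fun z hz => ?_) z hz
    · have e : q * m = Polynomial.C c * (p * m) + r * m := by rw [hr]; ring
      rw [e, polyDeriv_add, polyDeriv_C_mul]
      refine (norm_add_le _ _).trans ?_
      rw [norm_mul]
      have h4 : ‖c‖ * ‖polyDeriv (p * m) f z‖ ≤ ‖c‖ * (K * ‖z‖ ^ (-s)) := by
        gcongr; exact hK z hz
      calc _ ≤ ‖c‖ * (K * ‖z‖ ^ (-s)) + C₁ * (C₂ * K) * ‖z‖ ^ (-s) := add_le_add h4 h3
        _ = _ := by ring
    · have e : p * m = Polynomial.X * (p₁ * m) + Polynomial.C (-μ) * (p₁ * m) := by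
        rw [hp₁, Polynomial.C_neg]; ring
      have h4 := hK z hz
      rw [e, polyDeriv_add, polyDeriv_C_mul] at h4
      rwa [neg_mul, ← sub_eq_add_neg] at h4

theorem lt_norm_of_mem_freqHalfPlane {θ L : ℝ} {z : ℂ} (hz : z ∈ freqHalfPlane θ L) :
    L < ‖z‖ := by
  have h : L < (Complex.exp (θ * Complex.I) * z).re := hz
  have := h.trans_le (Complex.re_le_norm _)
  rwa [norm_exp_ofReal_mul_I_mul] at this

/-- A bound `N |z|^{-Re τ-1}` on `g = p(∂)f` bounds `f` and `(τ p + X Q)(∂) f` in the same way. The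
equation then gives `g'` one more power of decay, hence also `Q(∂)f'`. Thus `g' + τ g/z` gains two
powers, and integration gives `|g| ≤ D N |z|^{-Re τ-2}` with `D` independent of `L`. For `|z| ≥ 2D`
this halves `N`, and iteration gives `g = 0`. -/
theorem exists_eq_zero_of_forall {θ L₀ M : ℝ} {p Q : Polynomial ℂ} (hp : p.Monic)
    (hroots : ∀ μ, p.IsRoot μ → Complex.exp (-(θ * Complex.I)) * μ ∈ Complex.slitPlane)
    (hQ : (Polynomial.X * Q).natDegree ≤ p.natDegree) {τ : ℂ} (hτ : 0 < τ.re) {ρ : ℂ → ℂ}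
    (hM : 0 ≤ M) (hρ : ∀ z ∈ freqHalfPlane θ L₀, ‖ρ z‖ ≤ M) :
    ∃ L₁ : ℝ, ∀ (L : ℝ) (f : ℂ → ℂ), L₁ ≤ L →
      (∀ z ∈ freqHalfPlane θ L, AnalyticAt ℂ f z) →
      (∀ q, ∃ N, ∀ z ∈ freqHalfPlane θ L, ‖polyDeriv q f z‖ ≤ N * ‖z‖ ^ (-(τ.re + 1))) →
      (∀ z ∈ freqHalfPlane θ L, polyDeriv (Polynomial.X * p) f z +
        z⁻¹ * polyDeriv (Polynomial.C τ * p + Polynomial.X * Q) f z +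
        (z ^ 2)⁻¹ * ρ z * f z = 0) →
      ∀ z ∈ freqHalfPlane θ L, f z = 0 := by
  have hs1 : 0 ≤ τ.re + 1 := by linarith
  have hs2 : 0 ≤ τ.re + 2 := by linarith
  have hQ' : Q.natDegree ≤ p.natDegree := by
    rcases eq_or_ne Q 0 with h | h
    · simp [h]
    · rw [Polynomial.natDegree_X_mul h] at hQ; omega
  have hq : (Polynomial.C τ * p + Polynomial.X * Q).natDegree ≤ p.natDegree :=
    Polynomial.natDegree_add_le_of_degree_le (Polynomial.natDegree_C_mul_le _ _) hQ
  obtain ⟨C₂, hC₂, h₂⟩ := exists_norm_polyDeriv_le hs1 hp hroots (q := 1) (by simp)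
  obtain ⟨C₁, hC₁, h₁⟩ := exists_norm_polyDeriv_le hs1 hp hroots hq
  obtain ⟨C₃, hC₃, h₃⟩ := exists_norm_polyDeriv_le hs2 hp hroots hQ'
  set D : ℝ := 4 * Real.exp (Real.pi * |τ.im|) ^ 2 * (C₃ * (C₁ + M * C₂) + M * C₂) with hD
  have hD0 : 0 ≤ D := by positivity
  refine ⟨max (max L₀ 1) (2 * D), fun L f hL hf hb hode z hz => ?_⟩
  have hLL₀ : L₀ ≤ L := (le_max_left _ _).trans ((le_max_left _ _).trans hL)
  have hL1 : 1 ≤ L := (le_max_right _ _).trans ((le_max_left _ _).trans hL)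
  have hLD : 2 * D ≤ L := (le_max_right _ _).trans hL
  have hL0 : 0 ≤ L := by linarith
  have hzL : ∀ z ∈ freqHalfPlane θ L, L < ‖z‖ := fun z hz => lt_norm_of_mem_freqHalfPlane hz
  have hz1 : ∀ z ∈ freqHalfPlane θ L, 1 ≤ ‖z‖ := fun z hz => hL1.trans (hzL z hz).le
  have hz0 : ∀ z ∈ freqHalfPlane θ L, 0 < ‖z‖ := fun z hz => one_pos.trans_le (hz1 z hz)
  have hbd : ∀ q, ∃ N, ∀ z ∈ freqHalfPlane θ L, ‖polyDeriv q f z‖ ≤ N := fun q => by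
    obtain ⟨N, hN⟩ := hb q
    refine ⟨|N|, fun z hz => (hN z hz).trans ?_⟩
    calc N * ‖z‖ ^ (-(τ.re + 1)) ≤ |N| * ‖z‖ ^ (-(τ.re + 1)) := by gcongr; exact le_abs_self N
      _ ≤ |N| * 1 := by
        gcongr; exact Real.rpow_le_one_of_one_le_of_nonpos (hz1 z hz) (by linarith)
      _ = |N| := mul_one _
  have hinv : ∀ z ∈ freqHalfPlane θ L, ∀ s : ℝ, ‖z‖⁻¹ * ‖z‖ ^ (-s) = ‖z‖ ^ (-(s + 1)) :=
    fun z hz s => by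
      rw [← Real.rpow_neg_one, ← Real.rpow_add (hz0 z hz)]; congr 1; ring
  have step : ∀ N : ℝ, (∀ z ∈ freqHalfPlane θ L, ‖polyDeriv p f z‖ ≤ N * ‖z‖ ^ (-(τ.re + 1))) →
      ∀ z ∈ freqHalfPlane θ L, ‖polyDeriv p f z‖ ≤ N / 2 * ‖z‖ ^ (-(τ.re + 1)) := by
    intro N hN z hz
    have hN0 : 0 ≤ N := by
      have := (norm_nonneg _).trans (hN z hz)
      exact nonneg_of_mul_nonneg_left this (Real.rpow_pos_of_pos (hz0 z hz) _)
    have hN' : ∀ z ∈ freqHalfPlane θ L, ‖polyDeriv (p * 1) f z‖ ≤ N * ‖z‖ ^ (-(τ.re + 1)) := by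
      rwa [mul_one]
    have b₁ := h₁ L f 1 N hL0 hf hbd hN'
    have b₂ := h₂ L f 1 N hL0 hf hbd hN'
    simp only [mul_one, polyDeriv_one] at b₁ b₂
    have bR : ∀ z ∈ freqHalfPlane θ L, ‖(z ^ 2)⁻¹ * ρ z * f z‖ ≤
        M * C₂ * N * ‖z‖ ^ (-(τ.re + 3)) := fun z hz => by
      have h1 := hρ z (freqHalfPlane_mono hLL₀ hz)
      have h2 := hinv z hz (τ.re + 1)
      have h3 := hinv z hz (τ.re + 1 + 1)
      have e : τ.re + 3 = τ.re + 1 + 1 + 1 := by ring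
      rw [norm_mul, norm_mul, norm_inv, norm_pow, e, ← h3, ← h2]
      calc (‖z‖ ^ 2)⁻¹ * ‖ρ z‖ * ‖f z‖
          ≤ (‖z‖ ^ 2)⁻¹ * M * (C₂ * N * ‖z‖ ^ (-(τ.re + 1))) := by
            gcongr; exact b₂ z hz
        _ = _ := by rw [pow_two, mul_inv]; ring
    have b₃ : ∀ z ∈ freqHalfPlane θ L, ‖polyDeriv (p * Polynomial.X) f z‖ ≤
        (C₁ + M * C₂) * N * ‖z‖ ^ (-(τ.re + 2)) := fun z hz => by
      have h1 : polyDeriv (p * Polynomial.X) f z =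
          -(z⁻¹ * polyDeriv (Polynomial.C τ * p + Polynomial.X * Q) f z +
            (z ^ 2)⁻¹ * ρ z * f z) := by
        rw [mul_comm p, eq_neg_iff_add_eq_zero, ← add_assoc]; exact hode z hz
      have h2 := hinv z hz (τ.re + 1)
      have e : τ.re + 1 + 1 = τ.re + 2 := by ring
      rw [e] at h2
      have h3 : ‖z‖ ^ (-(τ.re + 3)) ≤ ‖z‖ ^ (-(τ.re + 2)) :=
        Real.rpow_le_rpow_of_exponent_le (hz1 z hz) (by linarith)
      rw [h1, norm_neg]
      refine (norm_add_le _ _).trans ?_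
      rw [norm_mul, norm_inv]
      calc ‖z‖⁻¹ * ‖polyDeriv (Polynomial.C τ * p + Polynomial.X * Q) f z‖ +
            ‖(z ^ 2)⁻¹ * ρ z * f z‖
          ≤ ‖z‖⁻¹ * (C₁ * N * ‖z‖ ^ (-(τ.re + 1))) + M * C₂ * N * ‖z‖ ^ (-(τ.re + 2)) := by
            refine add_le_add (mul_le_mul_of_nonneg_left (b₁ z hz) (by positivity))
              ((bR z hz).trans (mul_le_mul_of_nonneg_left h3 (by positivity)))
        _ = _ := by rw [← h2]; ring
    -- Taking `m = X` applies the inversion of `p(∂)` to `f'`, so the better decay of `p(∂) f'`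
    -- passes to `Q(∂) f'`.
    have b₄ := h₃ L f Polynomial.X _ hL0 hf hbd b₃
    have b₅ := norm_le_of_deriv_add_div (K := (C₃ * (C₁ + M * C₂) + M * C₂) * N) hL0
      (fun z hz => hasDerivAt_polyDeriv (hf z hz) p) hN (fun z hz => ?_) hz
    · have e : τ.re + 2 = τ.re + 1 + 1 := by ring
      rw [e, ← hinv z hz] at b₅
      refine b₅.trans ?_
      have h1 : D * ‖z‖⁻¹ ≤ 1 / 2 := by
        rw [← div_eq_mul_inv, div_le_iff₀ (hz0 z hz)]
        linarith [hzL z hz]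
      calc _ = D * ‖z‖⁻¹ * (N * ‖z‖ ^ (-(τ.re + 1))) := by rw [hD]; ring
        _ ≤ 1 / 2 * (N * ‖z‖ ^ (-(τ.re + 1))) := by gcongr
        _ = _ := by ring
    · have h1 := hode z hz
      rw [polyDeriv_add, polyDeriv_C_mul, mul_comm _ Q] at h1
      have h2 : polyDeriv (Polynomial.X * p) f z + τ * z⁻¹ * polyDeriv p f z =
          -(z⁻¹ * polyDeriv (Q * Polynomial.X) f z + (z ^ 2)⁻¹ * ρ z * f z) := by
        linear_combination h1
      have h3 := hinv z hz (τ.re + 2)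
      have e : τ.re + 2 + 1 = τ.re + 3 := by ring
      rw [e] at h3
      rw [h2, norm_neg]
      refine (norm_add_le _ _).trans ?_
      rw [norm_mul, norm_inv]
      calc ‖z‖⁻¹ * ‖polyDeriv (Q * Polynomial.X) f z‖ + ‖(z ^ 2)⁻¹ * ρ z * f z‖
          ≤ ‖z‖⁻¹ * (C₃ * ((C₁ + M * C₂) * N) * ‖z‖ ^ (-(τ.re + 2))) +
            M * C₂ * N * ‖z‖ ^ (-(τ.re + 3)) :=
            add_le_add (mul_le_mul_of_nonneg_left (b₄ z hz) (by positivity)) (bR z hz)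
        _ = _ := by rw [← h3]; ring
  obtain ⟨N, hN⟩ := hb p
  have iter : ∀ k : ℕ, ∀ z ∈ freqHalfPlane θ L,
      ‖polyDeriv p f z‖ ≤ N * (1 / 2) ^ k * ‖z‖ ^ (-(τ.re + 1)) := by
    intro k
    induction k with
    | zero => simpa using hN
    | succ k ih =>
      have := step _ ih
      rw [pow_succ, ← mul_assoc]
      simpa only [div_eq_mul_inv, one_mul] using this
  have hzero : ∀ z ∈ freqHalfPlane θ L, ‖polyDeriv (p * 1) f z‖ ≤ 0 * ‖z‖ ^ (-(τ.re + 1)) := by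
    intro z hz
    rw [mul_one, zero_mul]
    have h1 : Tendsto (fun k : ℕ => N * (1 / 2 : ℝ) ^ k * ‖z‖ ^ (-(τ.re + 1))) atTop
        (𝓝 (N * 0 * ‖z‖ ^ (-(τ.re + 1)))) :=
      ((tendsto_pow_atTop_nhds_zero_of_lt_one (by norm_num) (by norm_num)).const_mul N).mul_const _
    rw [mul_zero, zero_mul] at h1
    exact ge_of_tendsto' h1 fun k => iter k z hz
  have := h₂ L f 1 0 hL0 hf hbd hzero z hz
  rw [mul_one, polyDeriv_one, mul_zero, zero_mul] at this
  exact norm_le_zero_iff.1 this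

/-- Cauchy estimates on unit discs, which fit inside the half-plane after raising the level by `1`;
the modulus varies by a factor of at most `2` on them. -/
theorem exists_norm_polyDeriv_le_of_norm_le {θ L s C : ℝ} {f : ℂ → ℂ} (hs : 0 ≤ s) (hL : 1 ≤ L)
    (hf : DifferentiableOn ℂ f (freqHalfPlane θ L))
    (hC : ∀ z ∈ freqHalfPlane θ L, ‖f z‖ ≤ C * ‖z‖ ^ (-s)) (q : Polynomial ℂ) :
    ∃ N, ∀ z ∈ freqHalfPlane θ (L + 1), ‖polyDeriv q f z‖ ≤ N * ‖z‖ ^ (-s) := by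
  have hiter : ∀ n : ℕ, ∀ z ∈ freqHalfPlane θ (L + 1),
      ‖iteratedDeriv n f z‖ ≤ n.factorial * (|C| * 2 ^ s) * ‖z‖ ^ (-s) := by
    intro n z hz
    have hzL : L + 1 < ‖z‖ := lt_norm_of_mem_freqHalfPlane hz
    have hz0 : 0 < ‖z‖ := by linarith
    have hball : Metric.closedBall z 1 ⊆ freqHalfPlane θ L := by
      intro w hw
      have h1 : L + 1 < (Complex.exp (θ * Complex.I) * z).re := hz
      have h2 : ‖Complex.exp (θ * Complex.I) * (z - w)‖ ≤ 1 := by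
        rw [norm_exp_ofReal_mul_I_mul, ← dist_eq_norm, dist_comm]; exact hw
      have h3 := (Complex.re_le_norm _).trans h2
      rw [mul_sub, Complex.sub_re] at h3
      change L < _
      linarith
    have hd : DiffContOnCl ℂ f (Metric.ball z 1) :=
      (hf.mono (by rwa [closure_ball z one_ne_zero])).diffContOnCl
    have h := Complex.norm_iteratedDeriv_le_of_forall_mem_sphere_norm_le n one_pos hd
      (C := |C| * 2 ^ s * ‖z‖ ^ (-s)) fun w hw => ?_
    · refine h.trans_eq ?_
      rw [one_pow, div_one]; ring
    · have hw' := Metric.sphere_subset_closedBall hw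
      have h1 : ‖z‖ / 2 ≤ ‖w‖ := by
        have h2 : ‖z - w‖ ≤ 1 := by rw [← dist_eq_norm, dist_comm]; exact hw'
        linarith [norm_sub_norm_le z w]
      calc ‖f w‖ ≤ C * ‖w‖ ^ (-s) := hC w (hball hw')
        _ ≤ |C| * ‖w‖ ^ (-s) := by gcongr; exact le_abs_self C
        _ ≤ |C| * (‖z‖ / 2) ^ (-s) := by
          gcongr |C| * ?_
          exact Real.rpow_le_rpow_of_nonpos (by positivity) h1 (by linarith)
        _ = |C| * 2 ^ s * ‖z‖ ^ (-s) := by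
          rw [Real.div_rpow hz0.le (by norm_num), Real.rpow_neg (by norm_num : (0 : ℝ) ≤ 2)]
          field_simp
  refine ⟨∑ n ∈ q.support, ‖q.coeff n‖ * (n.factorial * (|C| * 2 ^ s)), fun z hz => ?_⟩
  rw [polyDeriv, Polynomial.sum_def, Finset.sum_mul]
  refine (norm_sum_le _ _).trans (Finset.sum_le_sum fun n _ => ?_)
  rw [norm_mul, mul_assoc]
  gcongr
  exact hiter n z hz

/-- As `θ` is interior, it can be turned by `±ε`, with the sign given by that of `Im (e^{iθ}z)`, to
an angle whose projection of `z` is at least `c|z|`. The distance to the boundary is thus at least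
`c|z|/2` far out, and bounds in it become bounds in `|z|`. -/
theorem MemDecaySpace.exists_norm_le {θ₁ θ₂ Λ σ θ : ℝ} {E : ℂ → ℂ} (hΛ : 0 ≤ Λ)
    (hθ : θ ∈ Ioo θ₁ θ₂) (hσ : σ ≤ 0) (hE : MemDecaySpace σ (dualSector θ₁ θ₂ Λ) E) :
    ∃ C L : ℝ, Λ ≤ L ∧ ∀ z ∈ freqHalfPlane θ L, ‖E z‖ ≤ C * ‖z‖ ^ σ := by
  obtain ⟨-, C, hC⟩ := hE
  obtain ⟨ε, hε0, hε⟩ : ∃ ε : ℝ, 0 < ε ∧ ε < θ - θ₁ ∧ ε < θ₂ - θ ∧ ε < Real.pi / 2 := by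
    have h : 0 < min (min (θ - θ₁) (θ₂ - θ)) (Real.pi / 2) :=
      lt_min (lt_min (sub_pos.2 hθ.1) (sub_pos.2 hθ.2)) (by positivity)
    refine ⟨_, half_pos h, ?_, ?_, ?_⟩
    · exact (half_lt_self h).trans_le ((min_le_left _ _).trans (min_le_left _ _))
    · exact (half_lt_self h).trans_le ((min_le_left _ _).trans (min_le_right _ _))
    · exact (half_lt_self h).trans_le (min_le_right _ _)
  have hcos : 0 < Real.cos ε := Real.cos_pos_of_mem_Ioo ⟨by linarith, hε.2.2⟩
  have hsin : 0 < Real.sin ε := Real.sin_pos_of_pos_of_lt_pi hε0 (by linarith [Real.pi_pos])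
  set c := min (Real.cos ε) (Real.sin ε) with hc
  have hc0 : 0 < c := lt_min hcos hsin
  refine ⟨|C| * (c / 2) ^ σ, max Λ (2 * Λ / c), le_max_left _ _, fun z hz => ?_⟩
  set w := Complex.exp (θ * Complex.I) * z with hw
  have hzn : 2 * Λ / c < ‖z‖ := (le_max_right _ _).trans_lt (lt_norm_of_mem_freqHalfPlane hz)
  have hz0 : 0 < ‖z‖ := (by positivity : 0 ≤ 2 * Λ / c).trans_lt hzn
  have hwre : 0 < w.re := hΛ.trans_lt ((le_max_left _ _).trans_lt hz)
  rw [div_lt_iff₀ hc0] at hzn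
  have hrot : ∀ δ : ℝ, (Complex.exp ((θ + δ : ℝ) * Complex.I) * z).re =
      w.re * Real.cos δ - w.im * Real.sin δ := fun δ => by
    have : Complex.exp ((θ + δ : ℝ) * Complex.I) * z = Complex.exp (δ * Complex.I) * w := by
      rw [hw, ← mul_assoc, ← Complex.exp_add]
      congr 2; push_cast; ring
    rw [this, Complex.mul_re, Complex.exp_ofReal_mul_I_re, Complex.exp_ofReal_mul_I_im]
    ring
  have hlow : c * ‖z‖ ≤ w.re * Real.cos ε + |w.im| * Real.sin ε := by
    have h1 := Complex.norm_le_abs_re_add_abs_im w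
    rw [hw, norm_exp_ofReal_mul_I_mul, ← hw, abs_of_pos hwre] at h1
    calc c * ‖z‖ ≤ c * (w.re + |w.im|) := by gcongr
      _ = w.re * c + |w.im| * c := by ring
      _ ≤ _ := by
        gcongr
        · exact min_le_left _ _
        · exact min_le_right _ _
  obtain ⟨φ, hφ, hφz⟩ : ∃ φ ∈ Ioo θ₁ θ₂, c * ‖z‖ ≤ (Complex.exp (φ * Complex.I) * z).re := by
    rcases le_total w.im 0 with h | h
    · refine ⟨θ + ε, ⟨by linarith [hθ.1], by linarith⟩, ?_⟩
      rw [abs_of_nonpos h] at hlow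
      rw [hrot]; linarith
    · refine ⟨θ + -ε, ⟨by linarith, by linarith [hθ.2]⟩, ?_⟩
      rw [abs_of_nonneg h] at hlow
      rw [hrot, Real.cos_neg, Real.sin_neg]; linarith
  have hmem : z ∈ freqHalfPlane φ Λ := by
    change Λ < _
    linarith
  have h1 := sub_le_infDist_frontier_dualSector hΛ hφ hmem
  have h2 : c / 2 * ‖z‖ ≤ Metric.infDist z (frontier (dualSector θ₁ θ₂ Λ)) := by linarith
  calc ‖E z‖ ≤ C * Metric.infDist z (frontier (dualSector θ₁ θ₂ Λ)) ^ σ := hC z ⟨φ, hφ, hmem⟩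
    _ ≤ |C| * Metric.infDist z (frontier (dualSector θ₁ θ₂ Λ)) ^ σ := by
      gcongr
      · exact Real.rpow_nonneg Metric.infDist_nonneg _
      · exact le_abs_self C
    _ ≤ |C| * (c / 2 * ‖z‖) ^ σ := by
      gcongr |C| * ?_
      exact Real.rpow_le_rpow_of_nonpos (by positivity) h2 hσ
    _ = _ := by rw [Real.mul_rpow (by positivity) hz0.le]; ring

/-! ### Uniqueness of the distinguished solution and the main theorem. -/

theorem levelOneOp_eq (P Q : Polynomial ℂ) (R Ψ : ℂ → ℂ) (z : ℂ) :
    levelOneOp P Q R Ψ z =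
      polyDeriv P Ψ z + z⁻¹ * polyDeriv Q Ψ z + (z ^ 2)⁻¹ * R z⁻¹ * Ψ z := rfl

/-- The shifted symbols `P(X - α)` and `Q(X - α)` of the equation for `e^{αz} Ψ`. -/
theorem exists_comp_sub_eq {P Q : Polynomial ℂ} (hP : P.Monic) (hProots : P.roots.Nodup)
    (hQdeg : Q.natDegree + 1 = P.natDegree) {α : ℂ} (hα : P.IsRoot (-α)) {θ θ₁ θ₂ : ℝ}
    (hθ : θ ∈ Ioo θ₁ θ₂)
    (hsector : ∀ β ∈ closure (openSector α θ₁ θ₂), P.IsRoot (-β) → β = α) :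
    ∃ p Q₁ : Polynomial ℂ, p.Monic ∧
      (∀ μ, p.IsRoot μ → Complex.exp (-(θ * Complex.I)) * μ ∈ Complex.slitPlane) ∧
      (Polynomial.X * Q₁).natDegree ≤ p.natDegree ∧
      P.comp (Polynomial.X - Polynomial.C α) = Polynomial.X * p ∧
      Q.comp (Polynomial.X - Polynomial.C α) =
        Polynomial.C (tauExp P Q α) * p + Polynomial.X * Q₁ := by
  obtain ⟨p, hp⟩ : Polynomial.X ∣ P.comp (Polynomial.X - Polynomial.C α) := by
    rw [Polynomial.X_dvd_iff, Polynomial.coeff_zero_eq_eval_zero, Polynomial.eval_comp]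
    simpa using hα
  have hPm : (P.comp (Polynomial.X - Polynomial.C α)).Monic :=
    hP.comp (Polynomial.monic_X_sub_C α) (by rw [Polynomial.natDegree_X_sub_C]; exact one_ne_zero)
  have hpm : p.Monic := Polynomial.monic_X.of_mul_monic_left (hp ▸ hPm)
  have hpn : p.natDegree = Q.natDegree := by
    have := congrArg Polynomial.natDegree hp
    rw [Polynomial.natDegree_comp, Polynomial.natDegree_X_sub_C, mul_one,
      Polynomial.natDegree_X_mul hpm.ne_zero] at this
    omega
  have hp0 : p.eval 0 = P.derivative.eval (-α) := by
    have := congrArg (fun q => (Polynomial.derivative q).eval 0) hp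
    simpa [Polynomial.derivative_comp] using this.symm
  have hP' : P.derivative.eval (-α) ≠ 0 := derivative_eval_ne_zero hP.ne_zero hProots hα
  -- The constant term is `Q(-α) - τ P'(-α)`, which vanishes by the choice of `τ`.
  obtain ⟨Q₁, hQ₁⟩ : Polynomial.X ∣ Q.comp (Polynomial.X - Polynomial.C α) -
      Polynomial.C (tauExp P Q α) * p := by
    rw [Polynomial.X_dvd_iff, Polynomial.coeff_zero_eq_eval_zero, Polynomial.eval_sub,
      Polynomial.eval_comp, Polynomial.eval_mul, hp0, tauExp]
    simp [div_mul_cancel₀ _ hP']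
  refine ⟨p, Q₁, hpm, fun μ hμ => ?_, ?_, hp, by rw [← hQ₁]; ring⟩
  · have hμ0 : μ ≠ 0 := by
      rintro rfl
      exact hP' (hp0 ▸ hμ)
    -- If `e^{-iθ}μ` were a negative real, `α - μ` would be a root of `P(-ζ)` on the open ray at
    -- angle `θ`.
    by_contra hm
    rw [Complex.mem_slitPlane_iff, not_or, not_lt, not_ne_iff] at hm
    set m := Complex.exp (-(θ * Complex.I)) * μ with hmdef
    have hmμ : μ = m.re * Complex.exp (θ * Complex.I) := by
      have h1 : (m.re : ℂ) = m := Complex.ext (by simp) (by simp [hm.2])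
      rw [h1, hmdef, mul_right_comm, ← Complex.exp_add, neg_add_cancel, Complex.exp_zero, one_mul]
    have hm0 : m.re < 0 := by
      refine lt_of_le_of_ne hm.1 fun h0 => hμ0 ?_
      rw [hmμ, h0]; simp
    have hroot : P.IsRoot (-(α - μ)) := by
      have h1 : (P.comp (Polynomial.X - Polynomial.C α)).eval μ = 0 := by
        rw [hp, Polynomial.eval_mul, hμ.eq_zero, mul_zero]
      rw [Polynomial.eval_comp] at h1
      rw [Polynomial.IsRoot, neg_sub]
      simpa using h1
    have := hsector (α - μ) (subset_closure ⟨-m.re, by linarith, θ, hθ, by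
      rw [hmμ]; push_cast; ring⟩) hroot
    exact hμ0 (by simpa using this)
  · rw [← hQ₁]
    refine (Polynomial.natDegree_sub_le _ _).trans (max_le ?_ (Polynomial.natDegree_C_mul_le _ _))
    rw [Polynomial.natDegree_comp, Polynomial.natDegree_X_sub_C, mul_one, hpn]

theorem exists_norm_comp_inv_le {R : ℂ → ℂ} {A : ℝ} (hA : 0 < A)
    (hR : DifferentiableOn ℂ R (Metric.ball 0 A⁻¹)) (θ : ℝ) :
    ∃ M : ℝ, 0 ≤ M ∧ ∀ z ∈ freqHalfPlane θ (2 * A), ‖R z⁻¹‖ ≤ M := by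
  have hsub : Metric.closedBall (0 : ℂ) (2 * A)⁻¹ ⊆ Metric.ball 0 A⁻¹ :=
    Metric.closedBall_subset_ball (by gcongr; linarith)
  obtain ⟨M, hM⟩ := (isCompact_closedBall (0 : ℂ) (2 * A)⁻¹).exists_bound_of_continuousOn
    (hR.continuousOn.mono hsub)
  refine ⟨|M|, abs_nonneg M, fun z hz => (hM _ ?_).trans (le_abs_self M)⟩
  rw [mem_closedBall_zero_iff, norm_inv]
  have := (lt_norm_of_mem_freqHalfPlane hz).le
  gcongr

theorem convex_freqHalfPlane (θ Λ : ℝ) : Convex ℝ (freqHalfPlane θ Λ) :=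
  convex_halfSpace_gt (f := fun z : ℂ => (Complex.exp (θ * Complex.I) * z).re)
    ⟨fun z w => by rw [mul_add, Complex.add_re], fun c z => by
      rw [Complex.real_smul, mul_left_comm, Complex.re_ofReal_mul, smul_eq_mul]⟩ Λ

theorem freqHalfPlane_nonempty (θ Λ : ℝ) : (freqHalfPlane θ Λ).Nonempty := by
  refine ⟨Complex.exp (-(θ * Complex.I)) * (Λ + 1 : ℝ), ?_⟩
  change Λ < _
  rw [← mul_assoc, ← Complex.exp_add, add_neg_cancel, Complex.exp_zero, one_mul, Complex.ofReal_re]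
  linarith

/-- The distinguished solution is unique. -/
theorem IsDistinguishedSolution.eqOn {P Q : Polynomial ℂ} {R : ℂ → ℂ} {A : ℝ} (hP : P.Monic)
    (hProots : P.roots.Nodup) (hQdeg : Q.natDegree + 1 = P.natDegree) (hA : 0 < A)
    (hR : DifferentiableOn ℂ R (Metric.ball 0 A⁻¹)) {α : ℂ} (hα : P.IsRoot (-α))
    (hτ : 0 < (tauExp P Q α).re) {θ₁ θ₂ : ℝ} (hπ : θ₂ - θ₁ ≤ Real.pi)
    (hsector : ∀ β ∈ closure (openSector α θ₁ θ₂), P.IsRoot (-β) → β = α)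
    {Λ Λ' : ℝ} {Ψ Ψ' : ℂ → ℂ} (h : IsDistinguishedSolution P Q R A α θ₁ θ₂ Λ Ψ)
    (h' : IsDistinguishedSolution P Q R A α θ₁ θ₂ Λ' Ψ') :
    EqOn Ψ Ψ' (dualSector θ₁ θ₂ (max Λ Λ')) := by
  rintro z₀ ⟨θ, hθ, hz₀⟩
  obtain ⟨hAΛ, ⟨E, hE, hΨ⟩, hode⟩ := h
  obtain ⟨hAΛ', ⟨E', hE', hΨ'⟩, hode'⟩ := h'
  set τ := tauExp P Q α with hτdef
  have hΛ : 0 ≤ Λ := hA.le.trans hAΛ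
  have hΛ' : 0 ≤ Λ' := hA.le.trans hAΛ'
  set H := freqHalfPlane θ (max Λ Λ') with hH
  have hHo : IsOpen H := isOpen_freqHalfPlane _ _
  have hHS : H ⊆ dualSector θ₁ θ₂ Λ := fun z hz =>
    ⟨θ, hθ, freqHalfPlane_mono (le_max_left _ _) hz⟩
  have hHS' : H ⊆ dualSector θ₁ θ₂ Λ' := fun z hz =>
    ⟨θ, hθ, freqHalfPlane_mono (le_max_right _ _) hz⟩
  have hy : DifferentiableOn ℂ (E - E') H := (hE.1.mono hHS).sub (hE'.1.mono hHS')
  have hyan : ∀ z ∈ H, AnalyticAt ℂ (E - E') z := fun z hz => hy.analyticAt (hHo.mem_nhds hz)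
  have hbp : DifferentiableOn ℂ (branchPow (-((θ₁ + θ₂) / 2)) (-τ)) H := fun z hz =>
    (differentiableAt_branchPow hπ (hΛ.trans (le_max_left _ _)) hθ _ hz).differentiableWithinAt
  have hexp : Differentiable ℂ fun z : ℂ => Complex.exp (-α * z) := by fun_prop
  have hΨan : ∀ z ∈ H, AnalyticAt ℂ Ψ z := fun z hz =>
    ((hexp.differentiableOn.mul (hbp.add (hE.1.mono hHS))).congr
      fun z hz => hΨ z (hHS hz)).analyticAt (hHo.mem_nhds hz)
  have hΨan' : ∀ z ∈ H, AnalyticAt ℂ Ψ' z := fun z hz =>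
    ((hexp.differentiableOn.mul (hbp.add (hE'.1.mono hHS'))).congr
      fun z hz => hΨ' z (hHS' hz)).analyticAt (hHo.mem_nhds hz)
  have hdiff : ∀ z ∈ H, (Ψ - Ψ') z = Complex.exp (-α * z) * (E - E') z := fun z hz => by
    rw [Pi.sub_apply, Pi.sub_apply, hΨ z (hHS hz), hΨ' z (hHS' hz)]; ring
  -- The terms `z^{-τ}` cancel in `Ψ - Ψ'`; conjugation by `e^{-αz}` leaves an equation for `E - E'`
  -- with the shifted symbols.
  obtain ⟨p, Q₁, hpm, hroots, hQ₁, hPc, hQc⟩ :=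
    exists_comp_sub_eq hP hProots hQdeg hα hθ hsector
  have hyode : ∀ z ∈ H, polyDeriv (Polynomial.X * p) (E - E') z +
      z⁻¹ * polyDeriv (Polynomial.C τ * p + Polynomial.X * Q₁) (E - E') z +
      (z ^ 2)⁻¹ * R z⁻¹ * (E - E') z = 0 := by
    intro z hz
    have hev : Ψ - Ψ' =ᶠ[𝓝 z] fun z => Complex.exp (-α * z) * (E - E') z := by
      filter_upwards [hHo.mem_nhds hz] with w hw using hdiff w hw
    have h1 : levelOneOp P Q R (Ψ - Ψ') z = 0 := by
      have e1 := hode z (hHS hz)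
      have e2 := hode' z (hHS' hz)
      rw [levelOneOp_eq] at e1 e2 ⊢
      rw [polyDeriv_sub (hΨan z hz) (hΨan' z hz), polyDeriv_sub (hΨan z hz) (hΨan' z hz),
        Pi.sub_apply]
      linear_combination e1 - e2
    rw [levelOneOp_congr hev, levelOneOp_eq, polyDeriv_exp_mul α P (hyan z hz),
      polyDeriv_exp_mul α Q (hyan z hz), hPc, hQc] at h1
    refine (mul_eq_zero.1 (?_ : Complex.exp (-α * z) * _ = 0)).resolve_left
      (Complex.exp_ne_zero (-α * z))
    linear_combination h1
  obtain ⟨M, hM, hρ⟩ := exists_norm_comp_inv_le hA hR θ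
  obtain ⟨L₁, hL₁⟩ := exists_eq_zero_of_forall hpm hroots hQ₁ hτ (ρ := fun z => R z⁻¹) hM hρ
  have hσ : -τ.re - 1 ≤ 0 := by linarith
  obtain ⟨C, L₂, hL₂, hC⟩ := hE.exists_norm_le hΛ hθ hσ
  obtain ⟨C', L₃, hL₃, hC'⟩ := hE'.exists_norm_le hΛ' hθ hσ
  set L := max (max L₂ L₃) (max L₁ 1) with hL
  have hL2 : L₂ ≤ L := (le_max_left _ _).trans (le_max_left _ _)
  have hL3 : L₃ ≤ L := (le_max_right _ _).trans (le_max_left _ _)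
  have hL1 : L₁ ≤ L := (le_max_left _ _).trans (le_max_right _ _)
  have hLone : 1 ≤ L := (le_max_right _ _).trans (le_max_right _ _)
  have hLH : freqHalfPlane θ L ⊆ H :=
    freqHalfPlane_mono (max_le (hL₂.trans hL2) (hL₃.trans hL3))
  have hLH1 : freqHalfPlane θ (L + 1) ⊆ H := (freqHalfPlane_mono (by linarith)).trans hLH
  have hbound : ∀ z ∈ freqHalfPlane θ L, ‖(E - E') z‖ ≤ (C + C') * ‖z‖ ^ (-(τ.re + 1)) := by
    intro z hz
    have e : -(τ.re + 1) = -τ.re - 1 := by ring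
    rw [e, add_mul]
    exact (norm_sub_le _ _).trans (add_le_add (hC z (freqHalfPlane_mono hL2 hz))
      (hC' z (freqHalfPlane_mono hL3 hz)))
  have hzero := hL₁ (L + 1) (E - E') (by linarith) (fun z hz => hyan z (hLH1 hz))
    (fun q => exists_norm_polyDeriv_le_of_norm_le (by linarith) hLone (hy.mono hLH) hbound q)
    (fun z hz => hyode z (hLH1 hz))
  obtain ⟨z₁, hz₁⟩ := freqHalfPlane_nonempty θ (L + 1)
  -- Vanishing is known only far out; the identity theorem on the convex half-plane `H` brings it
  -- down to level `max Λ Λ'`.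
  have hid : EqOn (E - E') 0 H :=
    AnalyticOnNhd.eqOn_zero_of_preconnected_of_eventuallyEq_zero hyan
      (convex_freqHalfPlane _ _).isPreconnected (hLH1 hz₁) (by
        filter_upwards [(isOpen_freqHalfPlane _ _).mem_nhds hz₁] with w hw using hzero w hw)
  have h1 := hdiff z₀ hz₀
  rw [hid hz₀, Pi.zero_apply, mul_zero, Pi.sub_apply] at h1
  exact sub_eq_zero.1 h1

/-- The distinguished solution `Ψ_α` exists, is unique, and the Borel sum along every ray of the
sector `Ω_α` of a `1`-Gevrey formal solution `e^{-αz} z^{-τ_α} F(z⁻¹)` is one and the same scalar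
multiple of it. -/
theorem theorem4p4 (P Q : Polynomial ℂ) (R : ℂ → ℂ) (A : ℝ)
    (hP : P.Monic) (hProots : P.roots.Nodup)
    (hQdeg : Q.natDegree + 1 = P.natDegree)
    (hQ : ∀ x : ℂ, P.IsRoot x → Q.eval x ≠ 0)
    (hA : 0 < A) (hR : DifferentiableOn ℂ R (Metric.ball 0 A⁻¹))
    (α : ℂ) (hα : P.IsRoot (-α)) (hτ : 0 < (tauExp P Q α).re)
    (θ₁ θ₂ : ℝ) (hθ : θ₁ < θ₂) (hθπ : θ₂ - θ₁ ≤ Real.pi)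
    (hsector : ∀ β ∈ closure (openSector α θ₁ θ₂), P.IsRoot (-β) → β = α) :
    (∃ (Λ : ℝ) (Ψ : ℂ → ℂ), IsDistinguishedSolution P Q R A α θ₁ θ₂ Λ Ψ) ∧
    (∀ (Λ Λ' : ℝ) (Ψ Ψ' : ℂ → ℂ), IsDistinguishedSolution P Q R A α θ₁ θ₂ Λ Ψ →
      IsDistinguishedSolution P Q R A α θ₁ θ₂ Λ' Ψ' →
      Set.EqOn Ψ Ψ' (dualSector θ₁ θ₂ (max Λ Λ'))) ∧
    (∀ (Λ : ℝ) (Ψ : ℂ → ℂ), IsDistinguishedSolution P Q R A α θ₁ θ₂ Λ Ψ →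
      ∀ F : PowerSeries ℂ, IsOneGevrey F →
        formalLevelOneOp P Q R α (tauExp P Q α) F = 0 →
        ∃ (c : ℂ) (Λ' : ℝ), Λ ≤ Λ' ∧ ∀ θ ∈ Set.Ioo θ₁ θ₂,
          IsBorelSum α (tauExp P Q α) F θ Λ' (fun z => c * Ψ z)) := by
  obtain ⟨M, B, hM, hB, hr⟩ := exists_norm_coeff_taylorPS_le hA hR
  obtain ⟨Λ₁, U, h, hL, hp⟩ :=
    exists_isBorelProfile hP hProots hQdeg hα hτ hsector hM hB hr (max A B)
  have hAΛ : A ≤ Λ₁ := (le_max_left _ _).trans hL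
  have hsol := hp.isDistinguishedSolution hα hτ hθ hθπ hA hR hM hB hr
    ((le_max_right _ _).trans hL) hAΛ
  have huniq := fun (Λ Λ' : ℝ) (Ψ Ψ' : ℂ → ℂ)
      (h₁ : IsDistinguishedSolution P Q R A α θ₁ θ₂ Λ Ψ)
      (h₂ : IsDistinguishedSolution P Q R A α θ₁ θ₂ Λ' Ψ') =>
    h₁.eqOn hP hProots hQdeg hA hR hα hτ hθπ hsector h₂
  refine ⟨⟨Λ₁, _, hsol⟩, huniq, fun Λ Ψ hΨ F _ hF => ?_⟩
  obtain ⟨k, ρ, hρ, hk⟩ := exists_hasSum_borelCoeff hα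
    (derivative_eval_ne_zero hP.ne_zero hProots hα) hτ hM hB hr
    (hp.differentiableOn.analyticAt (hp.isOpen.mem_nhds hp.zero_mem)) hp.apply_zero
    (by filter_upwards [hp.isOpen.mem_nhds hp.zero_mem] with u hu using hp.eq_zero u hu) hF
  have hΓ : Complex.Gamma (tauExp P Q α) ≠ 0 := Complex.Gamma_ne_zero_of_re_pos hτ
  -- The factor `Γ(τ)` undoes the normalisation of the distinguished solution. The level lies above
  -- that of the given solution and leaves room for the growth of `t^{τ-1}`.
  refine ⟨k * Complex.Gamma (tauExp P Q α), max Λ (Λ₁ + (tauExp P Q α).re), le_max_left _ _,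
    fun θ hθ => hp.isBorelSum hτ hρ hk (le_max_right _ _) hθ fun z hz => ?_⟩
  have hz₁ : z ∈ freqHalfPlane θ (max Λ Λ₁) :=
    freqHalfPlane_mono (max_le_max le_rfl (by linarith)) hz
  -- By uniqueness the given solution equals the constructed Laplace integral on this half-plane.
  rw [huniq Λ Λ₁ Ψ _ hΨ hsol ⟨θ, hθ, hz₁⟩, hp.sectorLaplace_eq hτ hθπ (hA.le.trans hAΛ) hθ
    (freqHalfPlane_mono (le_max_right _ _) hz₁), mul_assoc, mul_inv_cancel_left₀ hΓ]
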